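/- Let $d\ge 1$, let $\Omega\subset\mathbb{R}^d$ be a bounded open set with Lipschitz boundary (near each boundary point, after a rigid motion, $\Omega$ is the strict epigraph of a Lipschitz function of $d-1$ variables), let $\Gamma=\partial\Omega$ be equipped with the $(d-1)$-dimensional Hausdorff measure $\sigma$, and let $\beta\in L^\infty(\Gamma)$ be complex-valued. All function spaces are complex. For $u\in H^1(\Omega)$, a function $\varphi\in L^2(\Gamma)$ is called a trace of $u$ if there are $u_n\in C(\overline\Omega)\cap H^1(\Omega)$ with $u_n\to u$ in $H^1(\Omega)$ and $u_n|_\Gamma\to\varphi$ in $L^2(\Gamma)$. For $u\in H^1(\Omega)$ whose distributional Laplacian $\Delta u$ lies in $L^2(\Omega)$ and $h\in L^2(\Gamma)$, we write $\partial_\nu u=h$ if \[ \int_\Omega (\Delta u)\,\overline{v} + \int_\Omega \nabla u\cdot\overline{\nabla v} = \int_\Gamma h\,\overline{v}\,d\sigma\qquad\text{for all } v\in C(\overline\Omega)\cap H^1(\Omega). \] Then every $u\in H^1(\Omega)$ has exactly one trace $u_\Gamma\in L^2(\Gamma)$, and the operator $\Delta^{\mathrm W}_{H^1}$ in $H^1(\Omega)$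 given by \[ D(\Delta^{\mathrm W}_{H^1})=\{u\in H^1(\Omega):\ \Delta u\in H^1(\Omega),\ \partial_\nu u+\beta u_\Gamma+(\Delta u)_\Gamma=0\},\qquad \Delta^{\mathrm W}_{H^1}u=\Delta u, \] where the boundary condition means that $\partial_\nu u = -\beta u_\Gamma-(\Delta u)_\Gamma$ in $L^2(\Gamma)$, generates a holomorphic $C_0$-semigroup on $H^1(\Omega)$; that is, it is the generator of a $C_0$-semigroup $(T(t))_{t\ge0}$ on $H^1(\Omega)$ which, for some $\theta\in(0,\pi/2]$, has a holomorphic extension to the sector $\{z\ne0:|\arg z|<\theta\}$ that is bounded on $\{z\neq 0:|\arg z|<\theta',\ |z|\le1\}$ for every $\theta'\in(0,\theta)$. -/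

import Mathlib

open MeasureTheory Filter Topology Set
open scoped ContDiff ENNReal

noncomputable section

namespace Wentzell

/-- The Euclidean space `ℝ^d`. -/
abbrev E (d : ℕ) : Type := EuclideanSpace ℝ (Fin d)

variable {d : ℕ}

/-- `Ω` has Lipschitz boundary: near each boundary point, `Ω` is the strict epigraph of a
Lipschitz function defined on a hyperplane `e^⊥` (in the direction of the unit vector `e`). -/
def HasLipschitzBoundary (Ω : Set (E d)) : Prop :=
  ∀ x ∈ frontier Ω, ∃ (U : Set (E d)) (e : E d) (K : NNReal) (g : (Submodule.span ℝ {e})ᗮ → ℝ),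
    IsOpen U ∧ x ∈ U ∧ ‖e‖ = 1 ∧ LipschitzWith K g ∧
      Ω ∩ U = {y ∈ U | g ((Submodule.span ℝ {e})ᗮ.orthogonalProjectionOnto y) < inner ℝ e y}

/-- The surface measure `σ` on `Γ = ∂Ω`: the `(d-1)`-dimensional Hausdorff measure,
in the normalization that agrees with Lebesgue measure on hyperplanes. -/
def surfaceMeasure (Ω : Set (E d)) : Measure (E d) :=
  (Measure.euclideanHausdorffMeasure (d - 1)).restrict (frontier Ω)

/-- `L²(Ω)`, complex-valued. -/
abbrev L2 (Ω : Set (E d)) : Type := Lp ℂ 2 (volume.restrict Ω)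

/-- `L²(Γ)`, complex-valued. -/
abbrev L2Bdry (Ω : Set (E d)) : Type := Lp ℂ 2 (surfaceMeasure Ω)

/-- `L^∞(Γ)`, complex-valued. -/
abbrev LInfBdry (Ω : Set (E d)) : Type := Lp ℂ ∞ (surfaceMeasure Ω)

/-- `φ ∈ C_c^∞(Ω)`. Real-valued test functions suffice also for complex distributions. -/
structure IsTestFunction (Ω : Set (E d)) (φ : E d → ℝ) : Prop where
  contDiff : ContDiff ℝ ∞ φ
  hasCompactSupport : HasCompactSupport φ
  tsupport_subset : tsupport φ ⊆ Ω

/-- The classical partial derivative `∂ᵢφ(x)`. -/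
def partialDeriv (i : Fin d) (φ : E d → ℝ) (x : E d) : ℝ :=
  fderiv ℝ φ x (EuclideanSpace.single i 1)

/-- `g` is the weak partial derivative `∂ᵢu` in `Ω`. -/
def IsWeakPartialDeriv (Ω : Set (E d)) (i : Fin d) (u g : L2 Ω) : Prop :=
  ∀ φ : E d → ℝ, IsTestFunction Ω φ →
    ∫ x in Ω, partialDeriv i φ x • u x = - ∫ x in Ω, φ x • g x

theorem integrable_smul_L2 {Ω : Set (E d)} {η : E d → ℝ} (hη : Continuous η)
    (hc : HasCompactSupport η) (u : L2 Ω) :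
    Integrable (fun x => η x • u x) (volume.restrict Ω) := by
  have h1 : MemLp η 2 (volume.restrict Ω) := (hη.memLp_of_hasCompactSupport hc).restrict Ω
  exact memLp_one_iff_integrable.mp ((Lp.memLp u).smul h1)

theorem IsTestFunction.integrable_smul {Ω : Set (E d)} {φ : E d → ℝ} (hφ : IsTestFunction Ω φ)
    (u : L2 Ω) : Integrable (fun x => φ x • u x) (volume.restrict Ω) :=
  integrable_smul_L2 hφ.contDiff.continuous hφ.hasCompactSupport u

theorem IsTestFunction.integrable_partialDeriv_smul {Ω : Set (E d)} {φ : E d → ℝ}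
    (hφ : IsTestFunction Ω φ) (i : Fin d) (u : L2 Ω) :
    Integrable (fun x => partialDeriv i φ x • u x) (volume.restrict Ω) := by
  refine integrable_smul_L2 ?_ ?_ u
  · exact (hφ.contDiff.continuous_fderiv (by simp)).clm_apply continuous_const
  · exact hφ.hasCompactSupport.fderiv_apply (𝕜 := ℝ) _

theorem isWeakPartialDeriv_zero (Ω : Set (E d)) (i : Fin d) :
    IsWeakPartialDeriv Ω i 0 0 := by
  intro φ _
  have h : ∀ η : E d → ℝ, ∫ x in Ω, η x • (0 : L2 Ω) x = 0 := fun η =>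
    integral_eq_zero_of_ae <| by
      filter_upwards [Lp.coeFn_zero ℂ 2 (volume.restrict Ω)] with x hx
      rw [hx]; simp
  rw [h, h, neg_zero]

theorem IsWeakPartialDeriv.add {Ω : Set (E d)} {i : Fin d} {u g v k : L2 Ω}
    (hu : IsWeakPartialDeriv Ω i u g) (hv : IsWeakPartialDeriv Ω i v k) :
    IsWeakPartialDeriv Ω i (u + v) (g + k) := by
  intro φ hφ
  have h : ∀ (η : E d → ℝ) (a b : L2 Ω), Integrable (fun x => η x • a x) (volume.restrict Ω) →
      Integrable (fun x => η x • b x) (volume.restrict Ω) →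
      ∫ x in Ω, η x • (a + b : L2 Ω) x = (∫ x in Ω, η x • a x) + ∫ x in Ω, η x • b x := by
    intro η a b ha hb
    rw [← integral_add ha hb]
    refine integral_congr_ae ?_
    filter_upwards [Lp.coeFn_add a b] with x hx
    rw [hx, Pi.add_apply, smul_add]
  rw [h _ _ _ (hφ.integrable_partialDeriv_smul i u) (hφ.integrable_partialDeriv_smul i v),
    h _ _ _ (hφ.integrable_smul g) (hφ.integrable_smul k), hu φ hφ, hv φ hφ, neg_add]

theorem IsWeakPartialDeriv.smul {Ω : Set (E d)} {i : Fin d} {u g : L2 Ω} (c : ℂ)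
    (hu : IsWeakPartialDeriv Ω i u g) : IsWeakPartialDeriv Ω i (c • u) (c • g) := by
  intro φ hφ
  have h : ∀ (η : E d → ℝ) (a : L2 Ω),
      ∫ x in Ω, η x • (c • a : L2 Ω) x = c * ∫ x in Ω, η x • a x := by
    intro η a
    rw [← integral_const_mul]
    refine integral_congr_ae ?_
    filter_upwards [Lp.coeFn_smul c a] with x hx
    simp [hx, mul_left_comm]
  rw [h, h, hu φ hφ, mul_neg]

/-- The complex Sobolev space `H¹(Ω)`, realized as the space of pairs `(u, ∇u)` with
`u ∈ L²(Ω)` whose weak gradient `∇u` lies in `L²(Ω)^d`. The inherited (Hilbert) norm is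
`‖u‖² = ‖u‖²_{L²} + ∑ᵢ ‖∂ᵢu‖²_{L²}`. -/
def H1 (Ω : Set (E d)) :
    Submodule ℂ (WithLp 2 (L2 Ω × PiLp 2 (fun _ : Fin d => L2 Ω))) where
  carrier := {p | ∀ i, IsWeakPartialDeriv Ω i p.fst (p.snd i)}
  zero_mem' := fun i => isWeakPartialDeriv_zero Ω i
  add_mem' := fun hp hq i => (hp i).add (hq i)
  smul_mem' := fun c _ hp i => (hp i).smul c

/-- The `L²` function underlying an element of `H¹(Ω)`. -/
def toL2 {Ω : Set (E d)} (u : H1 Ω) : L2 Ω := u.1.fst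

/-- The weak partial derivative `∂ᵢu` of `u ∈ H¹(Ω)`. -/
def grad {Ω : Set (E d)} (u : H1 Ω) (i : Fin d) : L2 Ω := u.1.snd i

/-- `w` is a continuous representative on `Ω̄` of `u ∈ H¹(Ω)`. Thus `u ∈ C(Ω̄) ∩ H¹(Ω)` iff such
a `w` exists, and then `w` is unique on `Ω̄`. -/
def IsContRep {Ω : Set (E d)} (u : H1 Ω) (w : E d → ℂ) : Prop :=
  ContinuousOn w (closure Ω) ∧ toL2 u =ᵐ[volume.restrict Ω] w

/-- `φ ∈ Tr(u)`: there are `uₙ ∈ C(Ω̄) ∩ H¹(Ω)` with `uₙ → u` in `H¹(Ω)` and `uₙ|_Γ → φ`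
in `L²(Γ)`. -/
def IsTrace {Ω : Set (E d)} (u : H1 Ω) (φ : L2Bdry Ω) : Prop :=
  ∃ (v : ℕ → H1 Ω) (w : ℕ → E d → ℂ),
    (∀ n, IsContRep (v n) (w n)) ∧ Tendsto v atTop (𝓝 u) ∧
      Tendsto (fun n => eLpNorm (fun x => w n x - φ x) 2 (surfaceMeasure Ω)) atTop (𝓝 0)

/-- `Δu = f` in the sense of distributions in `Ω`, with `f ∈ L²(Ω)`. -/
def IsLaplacian {Ω : Set (E d)} (u : H1 Ω) (f : L2 Ω) : Prop :=
  ∀ φ : E d → ℝ, IsTestFunction Ω φ →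
    ∫ x in Ω, Laplacian.laplacian φ x • toL2 u x = ∫ x in Ω, φ x • f x

/-- `Δu ∈ L²(Ω)` and `∂_ν u = h` in the sense of Green's formula. -/
def IsNormalDeriv {Ω : Set (E d)} (u : H1 Ω) (h : L2Bdry Ω) : Prop :=
  ∃ f : L2 Ω, IsLaplacian u f ∧
    ∀ (v : H1 Ω) (w : E d → ℂ), IsContRep v w →
      (∫ x in Ω, f x * star (toL2 v x)) + (∫ x in Ω, ∑ i, grad u i x * star (grad v i x)) =
        ∫ x, h x * star (w x) ∂(surfaceMeasure Ω)

/-- The graph of the Laplacian in `H¹(Ω)` with Wentzell boundary conditions: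
`u ∈ H¹(Ω)`, `Δu = f ∈ H¹(Ω)` and `∂_ν u + β u_Γ + (Δu)_Γ = 0` in `L²(Γ)`. -/
def IsWentzellLaplacian {Ω : Set (E d)} (β : LInfBdry Ω) (u f : H1 Ω) : Prop :=
  IsLaplacian u (toL2 f) ∧
    ∃ h uΓ fΓ : L2Bdry Ω, IsNormalDeriv u h ∧ IsTrace u uΓ ∧ IsTrace f fΓ ∧
      ∀ᵐ x ∂(surfaceMeasure Ω), h x + β x * uΓ x + fΓ x = 0

section Semigroup

variable {X : Type*} [NormedAddCommGroup X] [NormedSpace ℂ X]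

/-- `(T(t))_{t ≥ 0}` is a `C₀`-semigroup on `X` (the values at `t < 0` are irrelevant). -/
structure IsC0Semigroup (T : ℝ → X →L[ℂ] X) : Prop where
  zero : T 0 = ContinuousLinearMap.id ℂ X
  add : ∀ s t : ℝ, 0 ≤ s → 0 ≤ t → T (s + t) = (T s).comp (T t)
  continuousOn : ∀ x : X, ContinuousOn (fun t => T t x) (Ici 0)

/-- The open sector `{z ≠ 0 : |arg z| < θ}`. -/
def sector (θ : ℝ) : Set ℂ := {z | z ≠ 0 ∧ |z.arg| < θ}

/-- A `C₀`-semigroup is holomorphic if, for some `θ ∈ (0, π/2]`, it extends to a holomorphic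
function on the open sector of half-angle `θ` that is bounded near `0` on all smaller sectors. -/
structure IsHolomorphicC0Semigroup (T : ℝ → X →L[ℂ] X) : Prop extends IsC0Semigroup T where
  holomorphic : ∃ θ : ℝ, 0 < θ ∧ θ ≤ Real.pi / 2 ∧ ∃ F : ℂ → X →L[ℂ] X,
    DifferentiableOn ℂ F (sector θ) ∧ (∀ t : ℝ, 0 < t → F t = T t) ∧
      ∀ θ' : ℝ, 0 < θ' → θ' < θ → ∃ M : ℝ, ∀ z ∈ sector θ', ‖z‖ ≤ 1 → ‖F z‖ ≤ M

/-- The operator with graph `A` is the generator of `T`: `x ∈ D(A)` and `Ax = y` iff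
`(T(t)x - x)/t → y` as `t ↓ 0`. -/
def IsGeneratorOf (A : X → X → Prop) (T : ℝ → X →L[ℂ] X) : Prop :=
  ∀ x y : X, A x y ↔ Tendsto (fun t : ℝ => ((t⁻¹ : ℝ) : ℂ) • (T t x - x)) (𝓝[>] 0) (𝓝 y)

end Semigroup

end Wentzell

end

/-! The operator is treated by the form method. Let `j u = (u, u_Γ)` map `H¹(Ω)` into
`H = L²(Ω) × L²(Γ)`. Testing the Wentzell problem `Δu = f` with `v` and integrating by parts gives
`⟨v, u⟩_{H¹} + ⟨j v, S j u⟩_H = -⟨j v, j f⟩_H` with the bounded operator `S (g, φ) = (-g, βφ)`.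
Taking `v = f` shows, since `j` is bounded, that `A u = f` is sectorial for the inner product of
`V = H¹(Ω)` itself, and Lax–Milgram solves the resolvent equation there; `A` is single-valued
because `j` is injective. The semigroup is the limit of the exponentials of the Yosida
approximations, along complex times in a small sector.

The trace is bounded because, along a direction `e` transversal to `Γ`, a function supported in a
Lipschitz chart is on `Γ` the integral of its `e`-derivative over rays in `Ω`; mollifying after a
shift along `e` produces the continuous approximations. -/

open scoped NNReal

noncomputable section

namespace Wentzell

section Exponential

variable {V : Type*}

section Banach

variable [NormedAddCommGroup V] [NormedSpace ℂ V] [CompleteSpace V]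

theorem hasDerivAt_exp_smul_apply (C : V →L[ℂ] V) (x : V) (s : ℝ) :
    HasDerivAt (fun s : ℝ => NormedSpace.exp (s • C) x) (NormedSpace.exp (s • C) (C x)) s :=
  ((ContinuousLinearMap.apply ℂ V x).restrictScalars ℝ).hasFDerivAt.comp_hasDerivAt s
    (hasDerivAt_exp_smul_const (𝕂 := ℝ) C s)

theorem differentiable_exp_smul_apply (C : V →L[ℂ] V) (x : V) :
    Differentiable ℂ fun z : ℂ => NormedSpace.exp (z • C) x := fun z =>
  (ContinuousLinearMap.apply ℂ V x).differentiableAt.comp z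
    (hasDerivAt_exp_smul_const (𝕂 := ℂ) C z).differentiableAt

theorem exp_add_smul (C : V →L[ℂ] V) (z w : ℂ) :
    NormedSpace.exp ((z + w) • C) = NormedSpace.exp (z • C) * NormedSpace.exp (w • C) := by
  let _ : NormedAlgebra ℚ (V →L[ℂ] V) := NormedAlgebra.restrictScalars ℚ ℂ _
  rw [add_smul, NormedSpace.exp_add_of_commute (((Commute.refl C).smul_left z).smul_right w)]

theorem norm_exp_apply_sub_exp_apply_le {B C : V →L[ℂ] V} (hBC : Commute B C)
    (hB : ∀ s : ℝ, 0 ≤ s → ∀ x, ‖NormedSpace.exp (s • B) x‖ ≤ ‖x‖)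
    (hC : ∀ s : ℝ, 0 ≤ s → ∀ x, ‖NormedSpace.exp (s • C) x‖ ≤ ‖x‖) (x : V) :
    ‖NormedSpace.exp B x - NormedSpace.exp C x‖ ≤ ‖B x - C x‖ := by
  -- interpolate between the two exponentials along `s ↦ exp(sB) exp((1-s)C) x`
  have hderiv (s : ℝ) : HasDerivAt
      (fun s : ℝ => (NormedSpace.exp (s • B) * NormedSpace.exp ((1 - s) • C)) x)
      ((NormedSpace.exp (s • B) * NormedSpace.exp ((1 - s) • C)) (B x - C x)) s := by
    have hprod := (hasDerivAt_exp_smul_const (𝕂 := ℝ) B s).mul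
      ((hasDerivAt_exp_smul_const (𝕂 := ℝ) C (1 - s)).scomp s ((hasDerivAt_id s).const_sub 1))
    have happly := ((ContinuousLinearMap.apply ℂ V x).restrictScalars ℝ).hasFDerivAt.comp_hasDerivAt
      s hprod
    refine happly.congr_deriv ?_
    have hcomm : B * NormedSpace.exp ((1 - s) • C) = NormedSpace.exp ((1 - s) • C) * B :=
      ((hBC.smul_right (1 - s)).exp_right).eq
    simp only [Function.comp_apply, neg_smul, one_smul, mul_assoc, hcomm]
    simp [sub_eq_add_neg]
  have hbound : ∀ s ∈ Ico (0 : ℝ) 1,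
      ‖(NormedSpace.exp (s • B) * NormedSpace.exp ((1 - s) • C)) (B x - C x)‖ ≤ ‖B x - C x‖ :=
    fun s hs => (hB s hs.1 _).trans (hC (1 - s) (sub_nonneg.mpr hs.2.le) _)
  simpa using norm_image_sub_le_of_norm_deriv_le_segment_01'
    (fun s _ => (hderiv s).hasDerivWithinAt) hbound

end Banach

/-- The closed sector `{|Im z| ≤ k Re z}` of slope `k` around the positive half-line; the condition
`0 ≤ Re z` only matters for `k ≤ 0`. -/
def closedSector (k : ℝ) : Set ℂ := {z | 0 ≤ z.re ∧ |z.im| ≤ k * z.re}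

theorem smul_mem_closedSector {k : ℝ} {z : ℂ} (hz : z ∈ closedSector k) {s : ℝ} (hs : 0 ≤ s) :
    s • z ∈ closedSector k := by
  constructor
  · simpa using mul_nonneg hs hz.1
  · rw [Complex.smul_re, Complex.smul_im, smul_eq_mul, smul_eq_mul, abs_mul, abs_of_nonneg hs,
      mul_left_comm]
    exact mul_le_mul_of_nonneg_left hz.2 hs

theorem add_mem_closedSector {k : ℝ} {z w : ℂ} (hz : z ∈ closedSector k)
    (hw : w ∈ closedSector k) : z + w ∈ closedSector k := by
  constructor
  · simpa using add_nonneg hz.1 hw.1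
  · rw [Complex.add_re, Complex.add_im, mul_add]
    exact (abs_add_le _ _).trans (add_le_add hz.2 hw.2)

theorem zero_mem_closedSector {k : ℝ} : (0 : ℂ) ∈ closedSector k := by
  simp [closedSector]

theorem ofReal_mem_closedSector {k : ℝ} (hk : 0 ≤ k) {t : ℝ} (ht : 0 ≤ t) :
    (t : ℂ) ∈ closedSector k :=
  ⟨by simpa using ht, by simpa using mul_nonneg hk ht⟩

variable [NormedAddCommGroup V] [InnerProductSpace ℂ V]

/-- A bounded operator is sectorial (of slope `k`) if its numerical range is contained in the
sector `{k |Im w| ≤ -Re w}` around the negative half-line. -/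
def IsSectorial (k : ℝ) (C : V →L[ℂ] V) : Prop :=
  ∀ x, k * |(inner ℂ x (C x)).im| ≤ -(inner ℂ x (C x)).re

theorem norm_exp_apply_le_of_re_inner_nonpos [CompleteSpace V] {C : V →L[ℂ] V}
    (hC : ∀ x, (inner ℂ x (C x)).re ≤ 0) (x : V) : ‖NormedSpace.exp C x‖ ≤ ‖x‖ := by
  have hderiv (s : ℝ) : HasDerivAt (fun s : ℝ => ‖NormedSpace.exp (s • C) x‖ ^ 2)
      (2 * (inner ℂ (NormedSpace.exp (s • C) x) (NormedSpace.exp (s • C) (C x))).re) s := by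
    let _ : InnerProductSpace ℝ V := InnerProductSpace.rclikeToReal ℂ V
    simpa [real_inner_eq_re_inner ℂ] using (hasDerivAt_exp_smul_apply C x s).norm_sq
  have hcomm (s : ℝ) : NormedSpace.exp (s • C) (C x) = C (NormedSpace.exp (s • C) x) :=
    congrArg (fun L : V →L[ℂ] V => L x) ((Commute.refl C).smul_left s).exp_left.eq
  have hanti : Antitone fun s : ℝ => ‖NormedSpace.exp (s • C) x‖ ^ 2 := by
    refine antitone_of_deriv_nonpos (fun s => (hderiv s).differentiableAt) fun s => ?_
    rw [(hderiv s).deriv, hcomm]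
    exact mul_nonpos_of_nonneg_of_nonpos zero_le_two (hC _)
  have hsq : ‖NormedSpace.exp C x‖ ^ 2 ≤ ‖x‖ ^ 2 := by
    simpa using hanti (zero_le_one : (0 : ℝ) ≤ 1)
  exact (sq_le_sq₀ (norm_nonneg _) (norm_nonneg x)).mp hsq

namespace IsSectorial

variable {k : ℝ} {B C : V →L[ℂ] V} {z : ℂ}

theorem re_inner_smul_nonpos (hC : IsSectorial k C) (hz : z ∈ closedSector k) (x : V) :
    (inner ℂ x ((z • C) x)).re ≤ 0 := by
  rw [smul_apply, inner_smul_right, Complex.mul_re]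
  have hre := mul_le_mul_of_nonneg_left (hC x) hz.1
  have him := mul_le_mul_of_nonneg_right hz.2 (abs_nonneg (inner ℂ x (C x)).im)
  have habs := neg_abs_le (z.im * (inner ℂ x (C x)).im)
  rw [abs_mul] at habs
  linarith

variable [CompleteSpace V]

theorem norm_exp_smul_apply_le (hC : IsSectorial k C) (hz : z ∈ closedSector k) (x : V) :
    ‖NormedSpace.exp (z • C) x‖ ≤ ‖x‖ :=
  norm_exp_apply_le_of_re_inner_nonpos (hC.re_inner_smul_nonpos hz) x

theorem norm_exp_smul_apply_sub_le (hB : IsSectorial k B) (hC : IsSectorial k C)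
    (hBC : Commute B C) (hz : z ∈ closedSector k) (x : V) :
    ‖NormedSpace.exp (z • B) x - NormedSpace.exp (z • C) x‖ ≤ ‖z‖ * ‖B x - C x‖ := by
  have hcontr {L : V →L[ℂ] V} (hL : IsSectorial k L) (s : ℝ) (hs : 0 ≤ s) (y : V) :
      ‖NormedSpace.exp (s • (z • L)) y‖ ≤ ‖y‖ := by
    rw [← smul_assoc]
    exact hL.norm_exp_smul_apply_le (smul_mem_closedSector hz hs) y
  calc ‖NormedSpace.exp (z • B) x - NormedSpace.exp (z • C) x‖
      ≤ ‖(z • B) x - (z • C) x‖ := norm_exp_apply_sub_exp_apply_le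
        ((hBC.smul_left z).smul_right z) (hcontr hB) (hcontr hC) x
    _ = ‖z‖ * ‖B x - C x‖ := by rw [smul_apply, smul_apply, ← smul_sub, norm_smul]

end IsSectorial

end Exponential

section StrongHolomorphy

variable {V W : Type*} [NormedAddCommGroup V] [NormedSpace ℂ V] [NormedAddCommGroup W]
  [NormedSpace ℂ W]

theorem circleIntegral_apply {F : ℂ → V →L[ℂ] W} {c : ℂ} {R : ℝ}
    (hF : CircleIntegrable F c R) (x : V) : (∮ z in C(c, R), F z) x = ∮ z in C(c, R), F z x :=
  ContinuousLinearMap.intervalIntegral_apply hF.out x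

theorem norm_sub_le_of_differentiableOn_apply {F : ℂ → V →L[ℂ] W} {z₀ : ℂ} {r M : ℝ} (hr : 0 < r)
    (hF : ∀ x, DifferentiableOn ℂ (fun z => F z x) (Metric.closedBall z₀ (2 * r)))
    (hM : ∀ z ∈ Metric.closedBall z₀ (2 * r), ‖F z‖ ≤ M) {a b : ℂ}
    (ha : a ∈ Metric.closedBall z₀ r) (hb : b ∈ Metric.closedBall z₀ r) :
    ‖F b - F a‖ ≤ M / r * ‖b - a‖ := by
  have hsub {w : ℂ} (hw : w ∈ Metric.closedBall z₀ r) :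
      Metric.closedBall w r ⊆ Metric.closedBall z₀ (2 * r) :=
    Metric.closedBall_subset_closedBall' (by linarith [Metric.mem_closedBall.mp hw])
  have hM₀ : 0 ≤ M := (norm_nonneg _).trans (hM z₀ (Metric.mem_closedBall_self (by positivity)))
  have hball : Metric.closedBall z₀ r ⊆ Metric.ball z₀ (2 * r) :=
    Metric.closedBall_subset_ball (by linarith)
  refine ContinuousLinearMap.opNorm_le_bound _ (by positivity) fun x => ?_
  have hmem {w : ℂ} (hw : w ∈ Metric.closedBall z₀ r) : DifferentiableAt ℂ (fun z => F z x) w :=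
    (hF x).differentiableAt (Metric.closedBall_mem_nhds_of_mem (hball hw))
  have hcauchy : ∀ w ∈ Metric.closedBall z₀ r, ‖deriv (fun z => F z x) w‖ ≤ M * ‖x‖ / r := by
    intro w hw
    have hw' := hsub hw
    refine Complex.norm_deriv_le_of_forall_mem_sphere_norm_le hr
      (((hF x).mono hw').diffContOnCl_ball subset_rfl) fun z hz => ?_
    exact (F z).le_of_opNorm_le (hM z (hw' (Metric.sphere_subset_closedBall hz))) x
  calc ‖(F b - F a) x‖ ≤ M * ‖x‖ / r * ‖b - a‖ :=
        (convex_closedBall z₀ r).norm_image_sub_le_of_norm_deriv_le (fun w hw => hmem hw)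
          hcauchy ha hb
    _ = M / r * ‖b - a‖ * ‖x‖ := by ring

theorem continuousOn_of_differentiableOn_apply {F : ℂ → V →L[ℂ] W} {z₀ : ℂ} {r M : ℝ}
    (hr : 0 < r) (hF : ∀ x, DifferentiableOn ℂ (fun z => F z x) (Metric.closedBall z₀ (2 * r)))
    (hM : ∀ z ∈ Metric.closedBall z₀ (2 * r), ‖F z‖ ≤ M) :
    ContinuousOn F (Metric.closedBall z₀ r) := by
  have hM₀ : 0 ≤ M := (norm_nonneg _).trans (hM z₀ (Metric.mem_closedBall_self (by positivity)))
  have hlip : LipschitzOnWith ⟨M / r, by positivity⟩ F (Metric.closedBall z₀ r) :=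
    LipschitzOnWith.of_dist_le_mul fun a ha b hb => by
      rw [dist_eq_norm, dist_eq_norm]
      exact norm_sub_le_of_differentiableOn_apply hr hF hM hb ha
  exact hlip.continuousOn

theorem differentiableOn_of_differentiableOn_apply [CompleteSpace W] {F : ℂ → V →L[ℂ] W}
    {U : Set ℂ} (hU : IsOpen U) (hF : ∀ x, DifferentiableOn ℂ (fun z => F z x) U) {M : ℝ}
    (hM : ∀ z ∈ U, ‖F z‖ ≤ M) : DifferentiableOn ℂ F U := by
  intro z₀ hz₀
  refine DifferentiableAt.differentiableWithinAt ?_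
  obtain ⟨R, hR, hRU⟩ := Metric.nhds_basis_closedBall.mem_iff.mp (hU.mem_nhds hz₀)
  obtain ⟨r, hr, rfl⟩ : ∃ r : ℝ, 0 < r ∧ 2 * r = R := ⟨R / 2, by positivity, by ring⟩
  have hrU : Metric.closedBall z₀ r ⊆ U :=
    (Metric.closedBall_subset_closedBall (by linarith)).trans hRU
  have hcont : ContinuousOn F (Metric.closedBall z₀ r) :=
    continuousOn_of_differentiableOn_apply hr (fun x => (hF x).mono hRU) fun z hz => hM z (hRU hz)
  have hsphere := hcont.mono Metric.sphere_subset_closedBall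
  -- the Cauchy integral of the norm-continuous `F` is analytic, and it agrees with `F` pointwise
  have hcauchy := (hasFPowerSeriesOn_cauchy_integral (R := ⟨r, hr.le⟩)
    (hsphere.circleIntegrable hr.le) hr).analyticAt.differentiableAt
  refine hcauchy.congr_of_eventuallyEq ?_
  filter_upwards [Metric.ball_mem_nhds z₀ hr] with w hw
  have hker : ContinuousOn (fun z : ℂ => (z - w)⁻¹) (Metric.sphere z₀ r) := by
    refine ContinuousOn.inv₀ (by fun_prop) fun z hz => sub_ne_zero.mpr ?_
    rintro rfl
    exact (Metric.mem_ball.mp hw).ne (Metric.mem_sphere.mp hz)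
  ext x
  change F w x = ((2 * Real.pi * Complex.I : ℂ)⁻¹ • ∮ z in C(z₀, r), (z - w)⁻¹ • F z) x
  have hintegral : CircleIntegrable (fun z => (z - w)⁻¹ • F z) z₀ r :=
    (hker.smul hsphere).circleIntegrable hr.le
  rw [smul_apply, circleIntegral_apply hintegral]
  simp only [smul_apply]
  rw [((hF x).mono hrU).circleIntegral_sub_inv_smul hw, smul_smul,
    inv_mul_cancel₀ Complex.two_pi_I_ne_zero, one_smul]

end StrongHolomorphy

section ExponentialLimit

variable {V : Type*} [NormedAddCommGroup V] [InnerProductSpace ℂ V] [CompleteSpace V]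
  {Y : ℕ → V →L[ℂ] V} {F : ℂ → V →L[ℂ] V} {k : ℝ}

/-- `F z` is the strong limit of `exp (z Yₙ)`, uniformly for `z` in bounded parts of the closed
sector of slope `k`; it is the candidate for the semigroup generated by the limit of the `Yₙ`. -/
structure IsExpLimit (k : ℝ) (Y : ℕ → V →L[ℂ] V) (F : ℂ → V →L[ℂ] V) : Prop where
  norm_apply_le : ∀ z ∈ closedSector k, ∀ x, ‖F z x‖ ≤ ‖x‖
  tendstoUniformlyOn : ∀ x R, TendstoUniformlyOn (fun n z => NormedSpace.exp (z • Y n) x)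
    (fun z => F z x) atTop (closedSector k ∩ Metric.closedBall 0 R)

theorem uniformCauchySeqOn_exp_smul_apply (hcomm : ∀ m n, Commute (Y m) (Y n))
    (hsec : ∀ n, IsSectorial k (Y n)) {D : Set V} (hD : Dense D)
    (hY : ∀ x ∈ D, CauchySeq fun n => Y n x) (x : V) (R : ℝ) :
    UniformCauchySeqOn (fun n z => NormedSpace.exp (z • Y n) x) atTop
      (closedSector k ∩ Metric.closedBall 0 R) := by
  rw [Metric.uniformCauchySeqOn_iff]
  intro ε hε
  obtain ⟨y, hxy, hy⟩ := Metric.dense_iff.mp hD x (ε / 4) (by positivity)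
  obtain ⟨N, hN⟩ := Metric.cauchySeq_iff.mp (hY y hy) (ε / (4 * (|R| + 1))) (by positivity)
  refine ⟨N, fun m hm n hn z ⟨hz, hzR⟩ => ?_⟩
  have hYmn : ‖NormedSpace.exp (z • Y m) y - NormedSpace.exp (z • Y n) y‖ ≤ ε / 4 := by
    have hz' : ‖z‖ ≤ |R| + 1 := by
      linarith [mem_closedBall_zero_iff.mp hzR, le_abs_self R]
    have hdist := (hN m hm n hn).le
    rw [dist_eq_norm] at hdist
    calc _ ≤ ‖z‖ * ‖Y m y - Y n y‖ := (hsec m).norm_exp_smul_apply_sub_le (hsec n) (hcomm m n) hz y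
      _ ≤ (|R| + 1) * (ε / (4 * (|R| + 1))) := by gcongr
      _ = ε / 4 := by field_simp
  have happrox (l : ℕ) : ‖NormedSpace.exp (z • Y l) (y - x)‖ < ε / 4 :=
    ((hsec l).norm_exp_smul_apply_le hz _).trans_lt (mem_ball_iff_norm.mp hxy)
  have hsplit : NormedSpace.exp (z • Y m) x - NormedSpace.exp (z • Y n) x =
      -NormedSpace.exp (z • Y m) (y - x) +
        (NormedSpace.exp (z • Y m) y - NormedSpace.exp (z • Y n) y) +
        NormedSpace.exp (z • Y n) (y - x) := by
    simp only [map_sub]; abel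
  rw [dist_eq_norm, hsplit]
  refine norm_add₃_le.trans_lt ?_
  rw [norm_neg]
  linarith [happrox m, happrox n]

theorem exists_isExpLimit (hcomm : ∀ m n, Commute (Y m) (Y n)) (hsec : ∀ n, IsSectorial k (Y n))
    {D : Set V} (hD : Dense D) (hY : ∀ x ∈ D, CauchySeq fun n => Y n x) :
    ∃ F, IsExpLimit k Y F := by
  have hcauchy := uniformCauchySeqOn_exp_smul_apply hcomm hsec hD hY
  have hlim (z : ℂ) : ∃ L : V →L[ℂ] V, z ∈ closedSector k → (∀ x, ‖L x‖ ≤ ‖x‖) ∧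
      ∀ x, Tendsto (fun n => NormedSpace.exp (z • Y n) x) atTop (𝓝 (L x)) := by
    by_cases hz : z ∈ closedSector k
    swap
    · exact ⟨0, fun h => absurd h hz⟩
    choose f hf using fun x => cauchySeq_tendsto_of_complete
      ((hcauchy x ‖z‖).cauchySeq (x := z) ⟨hz, by simp⟩)
    have hnorm (x : V) : ‖f x‖ ≤ ‖x‖ :=
      le_of_tendsto (hf x).norm (.of_forall fun n => (hsec n).norm_exp_smul_apply_le hz x)
    let l : V →ₗ[ℂ] V := linearMapOfTendsto f (fun n => (NormedSpace.exp (z • Y n)).toLinearMap)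
      (tendsto_pi_nhds.mpr hf)
    exact ⟨l.mkContinuous 1 fun x => by rw [one_mul]; exact hnorm x, fun _ => ⟨hnorm, hf⟩⟩
  choose F hF using hlim
  exact ⟨F, fun z hz => (hF z hz).1, fun x R =>
    (hcauchy x R).tendstoUniformlyOn_of_tendsto fun z hz => (hF z hz.1).2 x⟩

namespace IsExpLimit

theorem tendsto_apply (hF : IsExpLimit k Y F) {z : ℂ} (hz : z ∈ closedSector k) (x : V) :
    Tendsto (fun n => NormedSpace.exp (z • Y n) x) atTop (𝓝 (F z x)) :=
  (hF.tendstoUniformlyOn x ‖z‖).tendsto_at ⟨hz, by simp⟩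

theorem norm_le_one (hF : IsExpLimit k Y F) {z : ℂ} (hz : z ∈ closedSector k) : ‖F z‖ ≤ 1 :=
  ContinuousLinearMap.opNorm_le_bound _ zero_le_one fun x => by
    rw [one_mul]; exact hF.norm_apply_le z hz x

theorem continuousOn_apply (hF : IsExpLimit k Y F) (x : V) :
    ContinuousOn (fun z => F z x) (closedSector k) := by
  intro z hz
  have hcont := (hF.tendstoUniformlyOn x (‖z‖ + 1)).continuousOn
    (Frequently.of_forall fun n => (differentiable_exp_smul_apply (Y n) x).continuous.continuousOn)
  exact (hcont z ⟨hz, by simp⟩).mono_of_mem_nhdsWithin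
    (inter_mem_nhdsWithin _ (Metric.closedBall_mem_nhds_of_mem (by simp)))

theorem continuousOn_ofReal_apply (hF : IsExpLimit k Y F) (hk : 0 ≤ k) (x : V) :
    ContinuousOn (fun t : ℝ => F t x) (Ici 0) :=
  (hF.continuousOn_apply x).comp Complex.continuous_ofReal.continuousOn
    fun _ ht => ofReal_mem_closedSector hk ht

theorem differentiableOn (hF : IsExpLimit k Y F) {U : Set ℂ} (hU : IsOpen U)
    (hUk : U ⊆ closedSector k) : DifferentiableOn ℂ F U := by
  refine differentiableOn_of_differentiableOn_apply hU (fun x => ?_)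
    fun z hz => hF.norm_le_one (hUk hz)
  refine TendstoLocallyUniformlyOn.differentiableOn (φ := atTop)
    (F := fun n z => NormedSpace.exp (z • Y n) x) ?_
    (.of_forall fun n => (differentiable_exp_smul_apply (Y n) x).differentiableOn) hU
  rw [tendstoLocallyUniformlyOn_iff_forall_isCompact hU]
  intro K hKU hK
  obtain ⟨R, hR⟩ := hK.isBounded.subset_closedBall 0
  exact (hF.tendstoUniformlyOn x R).mono fun z hz => ⟨hUk (hKU hz), hR hz⟩

theorem map_zero (hF : IsExpLimit k Y F) : F 0 = ContinuousLinearMap.id ℂ V := by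
  ext x
  refine tendsto_nhds_unique (hF.tendsto_apply zero_mem_closedSector x) ?_
  simp

theorem tendsto_exp_smul_apply_of_tendsto (hF : IsExpLimit k Y F)
    (hsec : ∀ n, IsSectorial k (Y n)) {z : ℂ} (hz : z ∈ closedSector k) {u : ℕ → V} {x : V}
    (hu : Tendsto u atTop (𝓝 x)) :
    Tendsto (fun n => NormedSpace.exp (z • Y n) (u n)) atTop (𝓝 (F z x)) := by
  have hdiff : Tendsto (fun n => NormedSpace.exp (z • Y n) (u n - x)) atTop (𝓝 0) :=
    squeeze_zero_norm (fun n => (hsec n).norm_exp_smul_apply_le hz _)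
      (tendsto_iff_norm_sub_tendsto_zero.mp hu)
  simpa using hdiff.add (hF.tendsto_apply hz x)

theorem map_add (hF : IsExpLimit k Y F) (hsec : ∀ n, IsSectorial k (Y n)) {z w : ℂ}
    (hz : z ∈ closedSector k) (hw : w ∈ closedSector k) : F (z + w) = (F z).comp (F w) := by
  ext x
  refine tendsto_nhds_unique (hF.tendsto_apply (add_mem_closedSector hz hw) x) ?_
  simp only [exp_add_smul]
  exact hF.tendsto_exp_smul_apply_of_tendsto hsec hz (hF.tendsto_apply hw x)

theorem isC0Semigroup (hF : IsExpLimit k Y F) (hk : 0 ≤ k) (hsec : ∀ n, IsSectorial k (Y n)) :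
    IsC0Semigroup fun t : ℝ => F t where
  zero := by rw [Complex.ofReal_zero, hF.map_zero]
  add s t hs ht := by
    rw [Complex.ofReal_add]
    exact hF.map_add hsec (ofReal_mem_closedSector hk hs) (ofReal_mem_closedSector hk ht)
  continuousOn := hF.continuousOn_ofReal_apply hk

theorem apply_sub_eq_integral (hF : IsExpLimit k Y F) (hk : 0 ≤ k)
    (hsec : ∀ n, IsSectorial k (Y n)) {x y : V} (hxy : Tendsto (fun n => Y n x) atTop (𝓝 y))
    {t : ℝ} (ht : 0 ≤ t) : F t x - x = ∫ s in 0..t, F (s : ℂ) y := by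
  have hintegral (n : ℕ) : ∫ s in 0..t, NormedSpace.exp ((s : ℂ) • Y n) (Y n x) =
      NormedSpace.exp ((t : ℂ) • Y n) x - x := by
    have hcont : Continuous fun s : ℝ => NormedSpace.exp ((s : ℂ) • Y n) (Y n x) :=
      (differentiable_exp_smul_apply (Y n) (Y n x)).continuous.comp Complex.continuous_ofReal
    rw [intervalIntegral.integral_eq_sub_of_hasDerivAt
      (fun s _ => by simpa only [Complex.coe_smul] using hasDerivAt_exp_smul_apply (Y n) x s)
      (hcont.intervalIntegrable 0 t)]
    simp
  have hsector {s : ℝ} (hs : s ∈ uIoc 0 t) : (s : ℂ) ∈ closedSector k :=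
    ofReal_mem_closedSector hk (uIoc_of_le ht ▸ hs).1.le
  refine tendsto_nhds_unique
    ((hF.tendsto_apply (ofReal_mem_closedSector hk ht) x).sub_const x) ?_
  simp only [← hintegral]
  refine intervalIntegral.tendsto_integral_filter_of_dominated_convergence
    (fun _ => ‖y‖ + 1) (.of_forall fun n => ?_) ?_ intervalIntegrable_const
    (.of_forall fun s hs => hF.tendsto_exp_smul_apply_of_tendsto hsec (hsector hs) hxy)
  · exact ((differentiable_exp_smul_apply (Y n) (Y n x)).continuous.comp
      Complex.continuous_ofReal).aestronglyMeasurable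
  · filter_upwards [hxy.norm.eventually_le_const (lt_add_one ‖y‖)] with n hn
    exact .of_forall fun s hs => ((hsec n).norm_exp_smul_apply_le (hsector hs) _).trans hn

theorem tendsto_inv_smul_apply_sub (hF : IsExpLimit k Y F) (hk : 0 ≤ k)
    (hsec : ∀ n, IsSectorial k (Y n)) {x y : V} (hxy : Tendsto (fun n => Y n x) atTop (𝓝 y)) :
    Tendsto (fun t : ℝ => ((t⁻¹ : ℝ) : ℂ) • (F t x - x)) (𝓝[>] 0) (𝓝 y) := by
  have hcont := hF.continuousOn_ofReal_apply hk y
  have hderiv : HasDerivWithinAt (fun t : ℝ => ∫ s in 0..t, F (s : ℂ) y) (F (0 : ℝ) y) (Ici 0) 0 :=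
    intervalIntegral.integral_hasDerivWithinAt_right (f := fun s : ℝ => F s y) .refl
      ((hcont.stronglyMeasurableAtFilter_nhdsWithin measurableSet_Ici 0).filter_mono
        (nhdsWithin_mono 0 Ioi_subset_Ici_self))
      ((hcont 0 self_mem_Ici).mono Ioi_subset_Ici_self)
  have hslope := (hasDerivWithinAt_iff_tendsto_slope' self_notMem_Ioi).mp hderiv.Ioi_of_Ici
  rw [Complex.ofReal_zero, hF.map_zero] at hslope
  refine hslope.congr' ?_
  filter_upwards [self_mem_nhdsWithin] with t ht
  rw [slope_def_module, intervalIntegral.integral_same, sub_zero, sub_zero,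
    hF.apply_sub_eq_integral hk hsec hxy (le_of_lt ht), Complex.coe_smul]

end IsExpLimit

end ExponentialLimit

section Generation

variable {V : Type*} [NormedAddCommGroup V] [InnerProductSpace ℂ V] {A : V → V → Prop} {k a : ℝ}

theorem re_inner_self (x : V) : (inner ℂ x x).re = ‖x‖ ^ 2 :=
  inner_self_eq_norm_sq (𝕜 := ℂ) x

/-- The operator with graph `A` is quasi-m-sectorial: its numerical range, shifted by `-a`, lies in
the sector `{k |Im w| ≤ -Re w}`, and `lam - A` is surjective for every `lam > a`. -/
structure IsMSectorial (A : V → V → Prop) (k a : ℝ) : Prop where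
  add : ∀ {x y x' y'}, A x y → A x' y' → A (x + x') (y + y')
  smul : ∀ (c : ℂ) {x y}, A x y → A (c • x) (c • y)
  eq_zero : ∀ {y}, A 0 y → y = 0
  sector : ∀ {x y}, A x y → k * |(inner ℂ x y).im| ≤ -(inner ℂ x y).re + a * ‖x‖ ^ 2
  range : ∀ {lam : ℝ}, a < lam → ∀ g, ∃ x y, A x y ∧ (lam : ℂ) • x - y = g

/-- `R` is the resolvent `(lam - A)⁻¹` of the operator with graph `A`. -/
structure IsResolvent (A : V → V → Prop) (lam : ℝ) (R : V →L[ℂ] V) : Prop where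
  graph : ∀ g, A (R g) ((lam : ℂ) • R g - g)
  apply_smul_sub : ∀ {x y}, A x y → R ((lam : ℂ) • x - y) = x

namespace IsMSectorial

theorem sub (hA : IsMSectorial A k a) {x y x' y' : V} (h : A x y) (h' : A x' y') :
    A (x - x') (y - y') := by
  simpa [sub_eq_add_neg] using hA.add h (hA.smul (-1) h')

theorem shift (hA : IsMSectorial A k a) :
    IsMSectorial (fun x y => A x (y + (a : ℂ) • x)) k 0 where
  add {x y x' y'} h h' := by
    simpa only [smul_add, add_add_add_comm y] using hA.add h h'
  smul c x y h := by
    simpa only [smul_add, smul_comm (a : ℂ) c x] using hA.smul c h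
  eq_zero h := hA.eq_zero (by simpa using h)
  sector {x y} h := by
    have hinner : inner ℂ x (y + (a : ℂ) • x) = inner ℂ x y + ((a * ‖x‖ ^ 2 : ℝ) : ℂ) := by
      rw [inner_add_right, inner_smul_right, inner_self_eq_norm_sq_to_K]
      push_cast
      rfl
    have hsector := hA.sector h
    rw [hinner, Complex.add_im, Complex.add_re, Complex.ofReal_re, Complex.ofReal_im,
      add_zero] at hsector
    linarith
  range {lam} hlam g := by
    obtain ⟨x, y, h, rfl⟩ := hA.range (lam := lam + a) (by linarith) g
    refine ⟨x, y - (a : ℂ) • x, by simpa using h, ?_⟩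
    rw [Complex.ofReal_add, add_smul]
    abel

theorem re_inner_nonpos (hA : IsMSectorial A k 0) (hk : 0 ≤ k) {x y : V} (h : A x y) :
    (inner ℂ x y).re ≤ 0 := by
  have hsector := hA.sector h
  have him : 0 ≤ k * |(inner ℂ x y).im| := by positivity
  linarith

theorem mul_norm_le (hA : IsMSectorial A k 0) (hk : 0 ≤ k) {x y : V} (h : A x y) (lam : ℝ) :
    lam * ‖x‖ ≤ ‖(lam : ℂ) • x - y‖ := by
  rcases (norm_nonneg x).eq_or_lt with hx | hx
  · simp [← hx]
  refine le_of_mul_le_mul_left ?_ hx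
  calc ‖x‖ * (lam * ‖x‖) ≤ lam * ‖x‖ ^ 2 - (inner ℂ x y).re := by
        linarith [hA.re_inner_nonpos hk h]
    _ = (inner ℂ x ((lam : ℂ) • x - y)).re := by
        rw [inner_sub_right, inner_smul_right, Complex.sub_re, Complex.re_ofReal_mul,
          re_inner_self]
    _ ≤ ‖x‖ * ‖(lam : ℂ) • x - y‖ := re_inner_le_norm (𝕜 := ℂ) _ _

theorem exists_isResolvent (hA : IsMSectorial A k 0) (hk : 0 ≤ k) {lam : ℝ} (hlam : 0 < lam) :
    ∃ R, IsResolvent A lam R := by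
  have hsurj (g : V) : ∃ x, A x ((lam : ℂ) • x - g) := by
    obtain ⟨x, y, h, rfl⟩ := hA.range hlam g
    exact ⟨x, by simpa using h⟩
  choose r hr using hsurj
  have hinj {x y : V} (h : A x y) : r ((lam : ℂ) • x - y) = x := by
    have hnorm := hA.mul_norm_le hk (hA.sub (hr ((lam : ℂ) • x - y)) h) lam
    have hcancel : (lam : ℂ) • (r ((lam : ℂ) • x - y) - x) -
        ((lam : ℂ) • r ((lam : ℂ) • x - y) - ((lam : ℂ) • x - y) - y) = 0 := by
      rw [smul_sub]
      abel
    rw [hcancel, norm_zero] at hnorm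
    exact sub_eq_zero.mp (norm_le_zero_iff.mp (nonpos_of_mul_nonpos_right hnorm hlam))
  let l : V →ₗ[ℂ] V :=
    { toFun := r
      map_add' := fun g h => by
        rw [← hinj (hA.add (hr g) (hr h))]
        congr 1
        rw [smul_add]
        abel
      map_smul' := fun c g => by
        rw [RingHom.id_apply, ← hinj (hA.smul c (hr g))]
        congr 1
        rw [smul_sub, smul_comm]
        abel }
  refine ⟨l.mkContinuous lam⁻¹ fun g => ?_, hr, hinj⟩
  rw [inv_mul_eq_div, le_div_iff₀ hlam, mul_comm]
  change lam * ‖r g‖ ≤ ‖g‖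
  simpa using hA.mul_norm_le hk (hr g) lam

theorem dense_domain [CompleteSpace V] (hA : IsMSectorial A k 0) (hk : 0 ≤ k) :
    Dense {x | ∃ y, A x y} := by
  let D : Submodule ℂ V :=
    { carrier := {x | ∃ y, A x y}
      add_mem' := fun ⟨y, h⟩ ⟨y', h'⟩ => ⟨y + y', hA.add h h'⟩
      zero_mem' := by
        obtain ⟨x, y, h, -⟩ := hA.range one_pos (0 : V)
        exact ⟨0, by simpa using hA.smul 0 h⟩
      smul_mem' := fun c x ⟨y, h⟩ => ⟨c • y, hA.smul c h⟩ }
  suffices hD : Dᗮ = ⊥ from Submodule.dense_iff_topologicalClosure_eq_top.mpr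
    (Submodule.topologicalClosure_eq_top_iff.mpr hD)
  refine (Submodule.eq_bot_iff _).mpr fun g hg => ?_
  obtain ⟨x, y, h, rfl⟩ := hA.range one_pos g
  have horth : (inner ℂ x (((1 : ℝ) : ℂ) • x - y)).re = 0 :=
    congrArg Complex.re ((Submodule.mem_orthogonal _ _).mp hg x ⟨y, h⟩)
  rw [Complex.ofReal_one, one_smul, inner_sub_right, Complex.sub_re, re_inner_self] at horth
  obtain rfl : x = 0 := norm_eq_zero.mp (pow_eq_zero_iff two_ne_zero |>.mp
    (le_antisymm (by linarith [hA.re_inner_nonpos hk h]) (sq_nonneg _)))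
  rw [hA.eq_zero h, smul_zero, sub_zero]

end IsMSectorial

namespace IsResolvent

variable {lam mu : ℝ} {R R' : V →L[ℂ] V}

theorem norm_smul_apply_le (hR : IsResolvent A lam R) (hA : IsMSectorial A k 0) (hk : 0 ≤ k)
    (hlam : 0 ≤ lam) (g : V) : ‖(lam : ℂ) • R g‖ ≤ ‖g‖ := by
  rw [norm_smul, Complex.norm_of_nonneg hlam]
  simpa using hA.mul_norm_le hk (hR.graph g) lam

theorem smul_apply_sub (hR : IsResolvent A lam R) {x y : V} (h : A x y) :
    (lam : ℂ) • R x - x = R y := by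
  have happly := hR.apply_smul_sub h
  rw [map_sub, map_smul] at happly
  rw [sub_eq_iff_eq_add, ← sub_eq_iff_eq_add', happly]

theorem smul_comp_apply (hR : IsResolvent A lam R) (hR' : IsResolvent A mu R')
    (hA : IsMSectorial A k a) (g : V) : ((mu : ℂ) - lam) • R (R' g) = R g - R' g := by
  rw [← hR.apply_smul_sub (hA.sub (hR.graph g) (hR'.graph g)), ← map_smul]
  congr 1
  rw [sub_smul, smul_sub]
  abel

theorem commute (hR : IsResolvent A lam R) (hR' : IsResolvent A mu R') (hA : IsMSectorial A k a) :
    Commute R R' := by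
  ext g
  rcases eq_or_ne lam mu with rfl | hne
  · have heq (h : V) : R h = R' h := by
      simpa [sub_eq_zero] using (hR.smul_comp_apply hR' hA h).symm
    simp [heq]
  · have hsub : (mu : ℂ) - lam ≠ 0 := sub_ne_zero.mpr (by exact_mod_cast hne.symm)
    refine smul_right_injective V hsub ?_
    change ((mu : ℂ) - lam) • R (R' g) = ((mu : ℂ) - lam) • R' (R g)
    rw [hR.smul_comp_apply hR' hA, ← neg_sub (lam : ℂ), neg_smul, hR'.smul_comp_apply hR hA,
      neg_sub]

end IsResolvent

theorem tendsto_smul_resolvent_apply [CompleteSpace V] {lam : ℕ → ℝ} {R : ℕ → V →L[ℂ] V}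
    (hA : IsMSectorial A k 0) (hk : 0 ≤ k) (hlam : ∀ n, 0 < lam n) (hlim : Tendsto lam atTop atTop)
    (hR : ∀ n, IsResolvent A (lam n) (R n)) (g : V) :
    Tendsto (fun n => (lam n : ℂ) • R n g) atTop (𝓝 g) := by
  have hcontr (n : ℕ) (h : V) : ‖(lam n : ℂ) • R n h‖ ≤ ‖h‖ :=
    (hR n).norm_smul_apply_le hA hk (hlam n).le h
  rw [Metric.tendsto_atTop']
  intro ε hε
  obtain ⟨x, hgx, y, hxy⟩ := Metric.dense_iff.mp (hA.dense_domain hk) g (ε / 3) (by positivity)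
  rw [mem_ball_iff_norm'] at hgx
  obtain ⟨N, hN⟩ := eventually_atTop.mp (hlim.eventually_gt_atTop (‖y‖ / (ε / 3)))
  refine ⟨N, fun n hn => ?_⟩
  have hsmall : ‖(lam n : ℂ) • R n x - x‖ < ε / 3 := by
    rw [(hR n).smul_apply_sub hxy]
    refine lt_of_mul_lt_mul_left ?_ (hlam n).le
    calc lam n * ‖R n y‖ = ‖(lam n : ℂ) • R n y‖ := by
          rw [norm_smul, Complex.norm_of_nonneg (hlam n).le]
      _ ≤ ‖y‖ := hcontr n y
      _ < lam n * (ε / 3) := (div_lt_iff₀ (by positivity)).mp (hN n hn.le)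
  have hsplit : (lam n : ℂ) • R n g - g =
      (lam n : ℂ) • R n (g - x) + ((lam n : ℂ) • R n x - x) + (x - g) := by
    rw [map_sub, smul_sub]
    abel
  rw [dist_eq_norm, hsplit]
  refine norm_add₃_le.trans_lt ?_
  rw [norm_sub_rev x g]
  linarith [hcontr n (g - x)]

/-- The Yosida approximation `lam (lam R - 1)`, where `R` is the resolvent at `lam`. -/
def yosida (lam : ℝ) (R : V →L[ℂ] V) : V →L[ℂ] V := (lam : ℂ) • ((lam : ℂ) • R - 1)

theorem inner_yosida_apply (R : V →L[ℂ] V) (lam : ℝ) (g : V) :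
    inner ℂ g (yosida lam R g) = ((lam ^ 2 : ℝ) : ℂ) * inner ℂ (R g) ((lam : ℂ) • R g - g) -
      ((lam * ‖(lam : ℂ) • R g - g‖ ^ 2 : ℝ) : ℂ) := by
  set y := (lam : ℂ) • R g - g with hy
  have hg : g = (lam : ℂ) • R g - y := by rw [hy]; abel
  have hyosida : yosida lam R g = (lam : ℂ) • y := rfl
  rw [hyosida, inner_smul_right]
  nth_rewrite 1 [hg]
  rw [inner_sub_left, inner_smul_left, inner_self_eq_norm_sq_to_K, Complex.conj_ofReal]
  push_cast
  rw [RCLike.ofReal_eq_complex_ofReal]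
  ring

theorem commute_yosida {lam mu : ℝ} {R R' : V →L[ℂ] V} (h : Commute R R') :
    Commute (yosida lam R) (yosida mu R') :=
  ((((((h.smul_left _).smul_right _).sub_right (Commute.one_right _)).sub_left
    (Commute.one_left _)).smul_left _).smul_right _)

namespace IsResolvent

variable {lam : ℝ} {R : V →L[ℂ] V}

theorem yosida_apply (hR : IsResolvent A lam R) {x y : V} (h : A x y) :
    yosida lam R x = (lam : ℂ) • R y :=
  congrArg ((lam : ℂ) • ·) (hR.smul_apply_sub h)

theorem isSectorial_yosida (hR : IsResolvent A lam R) (hA : IsMSectorial A k 0)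
    (hlam : 0 ≤ lam) : IsSectorial k (yosida lam R) := by
  intro g
  have hsector := mul_le_mul_of_nonneg_left (hA.sector (hR.graph g)) (sq_nonneg lam)
  have hnorm : 0 ≤ lam * ‖(lam : ℂ) • R g - g‖ ^ 2 := by positivity
  rw [inner_yosida_apply, Complex.sub_re, Complex.sub_im, Complex.re_ofReal_mul,
    Complex.im_ofReal_mul, Complex.ofReal_re, Complex.ofReal_im, sub_zero, abs_mul,
    abs_of_nonneg (sq_nonneg lam)]
  linarith

end IsResolvent

theorem IsMSectorial.exists_yosida [CompleteSpace V] (hA : IsMSectorial A k 0) (hk : 0 ≤ k) :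
    ∃ Y : ℕ → V →L[ℂ] V, (∀ m n, Commute (Y m) (Y n)) ∧ (∀ n, IsSectorial k (Y n)) ∧
      ∀ x y, A x y → Tendsto (fun n => Y n x) atTop (𝓝 y) := by
  have hpos (n : ℕ) : (0 : ℝ) < n + 1 := by positivity
  choose R hR using fun n : ℕ => hA.exists_isResolvent hk (hpos n)
  refine ⟨fun n => yosida (n + 1) (R n), fun m n => commute_yosida ((hR m).commute (hR n) hA),
    fun n => (hR n).isSectorial_yosida hA (hpos n).le, fun x y h => ?_⟩
  simp only [(hR _).yosida_apply h]
  exact tendsto_smul_resolvent_apply hA hk hpos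
    (tendsto_natCast_atTop_atTop.atTop_add tendsto_const_nhds) hR y

theorem eq_zero_of_tendsto_inv_smul_sub {f : ℝ → V} {v : V} (hf : ∀ t, 0 < t → ‖f t‖ ≤ ‖v‖)
    (hv : Tendsto (fun t : ℝ => ((t⁻¹ : ℝ) : ℂ) • (f t - v)) (𝓝[>] 0) (𝓝 v)) : v = 0 := by
  have hlim : Tendsto (fun t : ℝ => (inner ℂ v (((t⁻¹ : ℝ) : ℂ) • (f t - v))).re) (𝓝[>] 0)
      (𝓝 (inner ℂ v v).re) :=
    (Complex.continuous_re.tendsto _).comp (tendsto_const_nhds.inner hv)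
  have hnonpos : (inner ℂ v v).re ≤ 0 := by
    refine le_of_tendsto hlim ?_
    filter_upwards [self_mem_nhdsWithin] with t ht
    rw [inner_smul_right, Complex.re_ofReal_mul, inner_sub_right, Complex.sub_re, re_inner_self]
    have hcs : (inner ℂ v (f t)).re ≤ ‖v‖ * ‖v‖ := (re_inner_le_norm (𝕜 := ℂ) v (f t)).trans
      (mul_le_mul_of_nonneg_left (hf t ht) (norm_nonneg v))
    exact mul_nonpos_of_nonneg_of_nonpos (inv_nonneg.mpr (le_of_lt ht)) (by linarith)
  rw [re_inner_self] at hnonpos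
  exact norm_eq_zero.mp (pow_eq_zero_iff two_ne_zero |>.mp (le_antisymm hnonpos (sq_nonneg _)))

theorem IsMSectorial.isGeneratorOf (hA : IsMSectorial A k 0) {T : ℝ → V →L[ℂ] V}
    (hT : ∀ t, 0 < t → ∀ x, ‖T t x‖ ≤ ‖x‖) (hgen : ∀ x y, A x y →
      Tendsto (fun t : ℝ => ((t⁻¹ : ℝ) : ℂ) • (T t x - x)) (𝓝[>] 0) (𝓝 y)) :
    IsGeneratorOf A T := by
  refine fun x y => ⟨hgen x y, fun hxy => ?_⟩
  obtain ⟨x', y', h, hsub⟩ := hA.range one_pos (x - y)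
  have hdiff : y - y' = x - x' := by
    rw [Complex.ofReal_one, one_smul] at hsub
    rw [sub_eq_sub_iff_add_eq_add] at hsub ⊢
    rw [add_comm y x', hsub, add_comm]
  have hlim : Tendsto (fun t : ℝ => ((t⁻¹ : ℝ) : ℂ) • (T t (x - x') - (x - x'))) (𝓝[>] 0)
      (𝓝 (x - x')) := by
    refine (hdiff ▸ hxy.sub (hgen x' y' h)).congr fun t => ?_
    rw [← smul_sub, map_sub, sub_sub_sub_comm]
  have hx : x - x' = 0 := eq_zero_of_tendsto_inv_smul_sub (fun t ht => hT t ht _) hlim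
  rw [hx] at hdiff
  rwa [sub_eq_zero.mp hx, sub_eq_zero.mp hdiff]

/-- The open sector of slope `k` around the positive half-line. -/
def openSector (k : ℝ) : Set ℂ := {z | |z.im| < k * z.re}

theorem isOpen_openSector : IsOpen (openSector k) :=
  isOpen_lt (by fun_prop) (by fun_prop)

theorem openSector_subset_closedSector (hk : 0 < k) : openSector k ⊆ closedSector k :=
  fun _ hz => ⟨(pos_of_mul_pos_right ((abs_nonneg _).trans_lt hz) hk.le).le, le_of_lt hz⟩

theorem sector_arctan_subset_openSector : sector (Real.arctan k) ⊆ openSector k := by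
  rintro z ⟨hz₀, hz⟩
  have harg : |z.arg| < Real.pi / 2 := hz.trans (Real.arctan_lt_pi_div_two k)
  have hre : 0 < z.re := (Complex.abs_arg_lt_pi_div_two_iff.mp harg).resolve_right hz₀
  have hmem := abs_lt.mp harg
  rwa [← Real.arctan_tan hmem.1 hmem.2, Complex.tan_arg, abs_lt, ← Real.arctan_neg,
    Real.arctan_lt_arctan_iff, Real.arctan_lt_arctan_iff, ← abs_lt, abs_div, abs_of_pos hre,
    div_lt_iff₀ hre] at hz

theorem IsMSectorial.exists_isGeneratorOf [CompleteSpace V] (hA : IsMSectorial A k 0) (hk : 0 < k) :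
    ∃ F : ℂ → V →L[ℂ] V, (∀ z ∈ openSector k, ‖F z‖ ≤ 1) ∧ DifferentiableOn ℂ F (openSector k) ∧
      IsC0Semigroup (fun t : ℝ => F t) ∧ IsGeneratorOf A fun t : ℝ => F t := by
  obtain ⟨Y, hcomm, hsec, hlim⟩ := hA.exists_yosida hk.le
  obtain ⟨F, hF⟩ := exists_isExpLimit hcomm hsec (hA.dense_domain hk.le)
    fun x ⟨y, hxy⟩ => (hlim x y hxy).cauchySeq
  exact ⟨F, fun z hz => hF.norm_le_one (openSector_subset_closedSector hk hz),
    hF.differentiableOn isOpen_openSector (openSector_subset_closedSector hk),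
    hF.isC0Semigroup hk.le hsec,
    hA.isGeneratorOf (fun t ht => hF.norm_apply_le t (ofReal_mem_closedSector hk.le ht.le))
      fun x y hxy => hF.tendsto_inv_smul_apply_sub hk.le hsec (hlim x y hxy)⟩

end Generation

section Rescaling

theorem tendsto_inv_smul_exp_smul_sub {V : Type*} [NormedAddCommGroup V] [NormedSpace ℂ V]
    {f : ℝ → V} {x y : V} (c : ℝ)
    (h : Tendsto (fun t : ℝ => ((t⁻¹ : ℝ) : ℂ) • (f t - x)) (𝓝[>] 0) (𝓝 y)) :
    Tendsto (fun t : ℝ => ((t⁻¹ : ℝ) : ℂ) • (Complex.exp (c * t) • f t - x)) (𝓝[>] 0)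
      (𝓝 (y + (c : ℂ) • x)) := by
  have hderiv : HasDerivAt (fun t : ℝ => Complex.exp (c * t)) (c : ℂ) 0 := by
    simpa using ((Complex.ofRealCLM.hasDerivAt (x := (0 : ℝ))).const_mul (c : ℂ)).cexp
  have hslope : Tendsto (fun t : ℝ => ((t⁻¹ : ℝ) : ℂ) * (Complex.exp (c * t) - 1)) (𝓝[>] 0)
      (𝓝 (c : ℂ)) := by
    simpa using hderiv.tendsto_slope_zero_right
  have hexp : Tendsto (fun t : ℝ => Complex.exp (c * t)) (𝓝[>] 0) (𝓝 1) := by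
    simpa using hderiv.continuousAt.tendsto.mono_left (nhdsWithin_le_nhds (s := Ioi 0))
  have hsum := (hexp.smul h).add (hslope.smul_const x)
  rw [one_smul] at hsum
  refine hsum.congr fun t => ?_
  rw [smul_comm, mul_smul, ← smul_add, smul_sub, sub_smul, one_smul, sub_add_sub_cancel]

variable {V : Type*} [NormedAddCommGroup V] [NormedSpace ℂ V] {T : ℝ → V →L[ℂ] V}

theorem IsC0Semigroup.exp_smul (hT : IsC0Semigroup T) (c : ℝ) :
    IsC0Semigroup fun t : ℝ => Complex.exp (c * t) • T t where
  zero := by simpa using hT.zero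
  add s t hs ht := by
    rw [hT.add s t hs ht, ContinuousLinearMap.comp_smul, ContinuousLinearMap.smul_comp, smul_smul,
      ← Complex.exp_add, Complex.ofReal_add, mul_add, add_comm]
  continuousOn x :=
    (show Continuous fun t : ℝ => Complex.exp (c * t) by fun_prop).continuousOn.smul
      (hT.continuousOn x)

theorem IsGeneratorOf.exp_smul {A : V → V → Prop} {c : ℝ}
    (hT : IsGeneratorOf (fun x y => A x (y + (c : ℂ) • x)) T) :
    IsGeneratorOf A fun t : ℝ => Complex.exp (c * t) • T t := by
  intro x y
  have hshift := hT x (y - (c : ℂ) • x)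
  simp only [sub_add_cancel] at hshift
  refine hshift.trans ⟨fun h => by simpa using tendsto_inv_smul_exp_smul_sub c h, fun h => ?_⟩
  have hback := tendsto_inv_smul_exp_smul_sub (-c) h
  rw [Complex.ofReal_neg, neg_smul, ← sub_eq_add_neg] at hback
  refine hback.congr fun t => ?_
  rw [smul_apply, smul_smul, ← Complex.exp_add, neg_mul, neg_add_cancel, Complex.exp_zero, one_smul]

theorem IsC0Semigroup.isHolomorphicC0Semigroup_exp_smul {F : ℂ → V →L[ℂ] V} {k : ℝ} (hk : 0 < k)
    (hT : IsC0Semigroup fun t : ℝ => F t) (hF : DifferentiableOn ℂ F (openSector k))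
    (hnorm : ∀ z ∈ openSector k, ‖F z‖ ≤ 1) (c : ℝ) :
    IsHolomorphicC0Semigroup fun t : ℝ => Complex.exp (c * t) • F t where
  toIsC0Semigroup := hT.exp_smul c
  holomorphic := by
    refine ⟨Real.arctan k, Real.arctan_pos.mpr hk, (Real.arctan_lt_pi_div_two k).le,
      fun z => Complex.exp (c * z) • F z, ?_, fun t _ => rfl,
      fun θ' _ hθ' => ⟨Real.exp |c|, fun z hz hz₁ => ?_⟩⟩
    · have hexp : Differentiable ℂ fun z : ℂ => Complex.exp (c * z) := by fun_prop
      exact hexp.differentiableOn.smul (hF.mono sector_arctan_subset_openSector)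
    · have hz' : z ∈ openSector k := sector_arctan_subset_openSector ⟨hz.1, hz.2.trans hθ'⟩
      have hre : ((c : ℂ) * z).re ≤ |c| := by
        refine (Complex.re_le_norm _).trans ?_
        rw [norm_mul, Complex.norm_real, Real.norm_eq_abs]
        exact mul_le_of_le_one_right (abs_nonneg c) hz₁
      calc ‖Complex.exp (c * z) • F z‖ = Real.exp ((c : ℂ) * z).re * ‖F z‖ := by
            rw [norm_smul, Complex.norm_exp]
        _ ≤ Real.exp |c| * 1 := by gcongr; exact hnorm z hz'
        _ = Real.exp |c| := mul_one _

theorem IsMSectorial.exists_isHolomorphicC0Semigroup {V : Type*} [NormedAddCommGroup V]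
    [InnerProductSpace ℂ V] [CompleteSpace V] {A : V → V → Prop} {k a : ℝ}
    (hA : IsMSectorial A k a) (hk : 0 < k) :
    ∃ T : ℝ → V →L[ℂ] V, IsHolomorphicC0Semigroup T ∧ IsGeneratorOf A T := by
  obtain ⟨F, hnorm, hF, hT, hgen⟩ := hA.shift.exists_isGeneratorOf hk
  exact ⟨_, hT.isHolomorphicC0Semigroup_exp_smul hk hF hnorm a, hgen.exp_smul⟩

end Rescaling

section Form

variable {V H : Type*} [NormedAddCommGroup V] [InnerProductSpace ℂ V]
  [NormedAddCommGroup H] [InnerProductSpace ℂ H]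

theorem norm_inner_apply_self_le (S : H →L[ℂ] H) (x y : H) :
    ‖inner ℂ x (S y)‖ ≤ ‖x‖ * (‖S‖ * ‖y‖) :=
  (norm_inner_le_norm _ _).trans (by gcongr; exact S.le_opNorm _)

/-- The operator `-B` in `V`, where `j (B u)` represents the form `⟪v, u⟫ + ⟪j v, S (j u)⟫` in `H`.
It is single-valued when `j` is injective, even if the range of `j` is not dense in `H`. -/
def formRel (j : V →L[ℂ] H) (S : H →L[ℂ] H) (u f : V) : Prop :=
  ∀ v, inner ℂ v u + inner ℂ (j v) (S (j u)) = -inner ℂ (j v) (j f)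

theorem formRel.sector {j : V →L[ℂ] H} {S : H →L[ℂ] H} {u f : V} (h : formRel j S u f) :
    |(inner ℂ u f).im| ≤ -(inner ℂ u f).re + ‖S‖ ^ 2 * ‖j‖ ^ 2 * ‖u‖ ^ 2 := by
  have hform : inner ℂ f u = -((‖j f‖ ^ 2 : ℝ) : ℂ) - inner ℂ (j f) (S (j u)) := by
    rw [eq_sub_iff_add_eq, h f, inner_self_eq_norm_sq_to_K]
    push_cast
    rfl
  rw [← inner_conj_symm, Complex.conj_re, Complex.conj_im, abs_neg, hform]
  simp only [Complex.sub_re, Complex.sub_im, Complex.neg_re, Complex.neg_im, Complex.ofReal_re,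
    Complex.ofReal_im, neg_zero, zero_sub, abs_neg]
  set c := inner ℂ (j f) (S (j u))
  have hc : ‖c‖ ≤ ‖j f‖ * (‖S‖ * (‖j‖ * ‖u‖)) := (norm_inner_apply_self_le S _ _).trans
    (by gcongr; exact j.le_opNorm u)
  have him := Complex.abs_im_le_norm c
  have hre := (abs_le.mp (Complex.abs_re_le_norm c)).1
  -- `2 ‖j f‖ (‖S‖ ‖j‖ ‖u‖) ≤ ‖j f‖² + (‖S‖ ‖j‖ ‖u‖)²`
  linarith [two_mul_le_add_sq ‖j f‖ (‖S‖ * (‖j‖ * ‖u‖))]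

theorem formRel.exists_smul_sub_eq [CompleteSpace V] [CompleteSpace H] (j : V →L[ℂ] H)
    (S : H →L[ℂ] H) {lam : ℝ} (hlam : ‖S‖ ≤ lam) (g : V) :
    ∃ u f, formRel j S u f ∧ (lam : ℂ) • u - f = g := by
  set L : V →L[ℂ] V := 1 + j.adjoint ∘L S ∘L j + (lam : ℂ) • (j.adjoint ∘L j) with hL
  have hinner (v u : V) : inner ℂ v (L u) =
      inner ℂ v u + inner ℂ (j v) (S (j u)) + lam * inner ℂ (j v) (j u) := by
    simp [hL, ContinuousLinearMap.adjoint_inner_right]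
  have hcoercive (u : V) : ‖u‖ ^ 2 ≤ ‖inner ℂ (L u) u‖ := by
    have hS := (abs_le.mp ((Complex.abs_re_le_norm _).trans
      (norm_inner_apply_self_le S (j u) (j u)))).1
    rw [norm_inner_symm]
    refine le_trans ?_ (Complex.re_le_norm _)
    rw [hinner, Complex.add_re, Complex.add_re, Complex.re_ofReal_mul, re_inner_self, re_inner_self]
    linarith [mul_le_mul_of_nonneg_right hlam (sq_nonneg ‖j u‖)]
  have hunit : IsUnit L := ContinuousLinearMap.isUnit_of_forall_le_norm_inner_map L (c := 1)
    one_pos fun u => by rw [NNReal.coe_one, mul_one]; exact hcoercive u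
  obtain ⟨u, hu⟩ := (ContinuousLinearMap.isUnit_iff_bijective.mp hunit).2 (j.adjoint (j g))
  refine ⟨u, (lam : ℂ) • u - g, fun v => ?_, sub_sub_cancel _ _⟩
  have hv := hinner v u
  rw [hu, ContinuousLinearMap.adjoint_inner_right] at hv
  simp only [map_sub, map_smul, inner_sub_right, inner_smul_right]
  linear_combination -hv

theorem isMSectorial_formRel [CompleteSpace V] [CompleteSpace H] {j : V →L[ℂ] H}
    (hj : Function.Injective j) (S : H →L[ℂ] H) :
    IsMSectorial (formRel j S) 1 (‖S‖ ^ 2 * ‖j‖ ^ 2 + ‖S‖) where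
  add h h' v := by
    simp only [map_add, inner_add_right]
    linear_combination h v + h' v
  smul c _ _ h v := by
    simp only [map_smul, inner_smul_right]
    linear_combination c * h v
  eq_zero {y} h := by
    have hy : inner ℂ (j y) (j y) = 0 := by simpa using (h y).symm
    exact hj (by rw [inner_self_eq_zero.mp hy, map_zero])
  sector {u f} h := by
    have hnonneg : 0 ≤ ‖S‖ * ‖u‖ ^ 2 := by positivity
    linarith [h.sector]
  range hlam g := formRel.exists_smul_sub_eq j S
    (le_of_lt (lt_of_le_of_lt (le_add_of_nonneg_left (by positivity)) hlam)) g

end Form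

section LebesgueSquare

variable {α F : Type*} [MeasurableSpace α] {μ : Measure α}

theorem eLpNorm_two_sq [NormedAddCommGroup F] (μ : Measure α) (f : α → F) :
    eLpNorm f 2 μ ^ 2 = ∫⁻ x, ‖f x‖ₑ ^ 2 ∂μ := by
  rw [eLpNorm_eq_lintegral_rpow_enorm_toReal (by norm_num) (by norm_num), ← ENNReal.rpow_natCast,
    ← ENNReal.rpow_mul]
  norm_num

theorem sq_lintegral_mul_le_of_lintegral_eq_one {p h : α → ℝ≥0∞} (hp : Measurable p)
    (hh : AEMeasurable h μ) (hp1 : ∫⁻ x, p x ∂μ = 1) :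
    (∫⁻ x, p x * h x ∂μ) ^ 2 ≤ ∫⁻ x, p x * h x ^ 2 ∂μ := by
  -- Cauchy–Schwarz for the factorization `p h = √p · (√p h)`
  have holder := ENNReal.lintegral_mul_le_Lp_mul_Lq μ Real.HolderConjugate.two_two
    (f := fun x => p x ^ (1 / 2 : ℝ)) (g := fun x => p x ^ (1 / 2 : ℝ) * h x)
    (hp.pow_const _).aemeasurable ((hp.pow_const _).aemeasurable.mul hh)
  have sqrt_mul_sqrt : ∀ x, ((fun x => p x ^ (1 / 2 : ℝ)) * fun x => p x ^ (1 / 2 : ℝ) * h x) x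
      = p x * h x := by
    intro x
    simp only [Pi.mul_apply]
    rw [← mul_assoc, ← ENNReal.rpow_add_of_nonneg _ _ (by norm_num) (by norm_num)]
    norm_num
  have sqrt_sq : ∀ x, (p x ^ (1 / 2 : ℝ)) ^ (2 : ℝ) = p x := by
    intro x
    rw [← ENNReal.rpow_mul]
    norm_num
  have sqrt_mul_sq : ∀ x, (p x ^ (1 / 2 : ℝ) * h x) ^ (2 : ℝ) = p x * h x ^ 2 := by
    intro x
    rw [ENNReal.mul_rpow_of_nonneg _ _ (by norm_num), sqrt_sq]
    norm_cast
  simp only [sqrt_mul_sqrt, sqrt_sq, sqrt_mul_sq, hp1, ENNReal.one_rpow, one_mul] at holder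
  calc (∫⁻ x, p x * h x ∂μ) ^ 2
      ≤ ((∫⁻ x, p x * h x ^ 2 ∂μ) ^ (1 / 2 : ℝ)) ^ 2 := by gcongr
    _ = ∫⁻ x, p x * h x ^ 2 ∂μ := by
        rw [← ENNReal.rpow_natCast, ← ENNReal.rpow_mul]
        norm_num

theorem eLpNorm_two_le_of_bound_of_support_subset [NormedAddCommGroup F] {f : α → F} {K : Set α}
    (hK : MeasurableSet K) (hfK : ∀ x ∉ K, f x = 0) {C : ℝ} (hC : ∀ x, ‖f x‖ ≤ C) :
    eLpNorm f 2 μ ≤ ENNReal.ofReal C * μ K ^ (1 / 2 : ℝ) := by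
  have hfind : K.indicator f = f :=
    indicator_eq_self.mpr fun x hx => by_contra fun hxK => hx (hfK x hxK)
  rw [← hfind, eLpNorm_indicator_eq_eLpNorm_restrict hK, mul_comm]
  simpa using eLpNorm_le_of_ae_bound (p := 2) (μ := μ.restrict K) (Eventually.of_forall hC)

end LebesgueSquare

section Mollify

theorem mem_ball_of_mem_closedBall_add {G : Type*} [SeminormedAddCommGroup G]
    {x y x₀ τ : G} {r ε R : ℝ} (hy : y ∈ Metric.ball x₀ r)
    (hyx : y ∈ Metric.closedBall (x + τ) ε) (hR : r + ε + ‖τ‖ ≤ R) : x ∈ Metric.ball x₀ R := by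
  rw [mem_ball_iff_norm] at hy ⊢
  rw [mem_closedBall_iff_norm] at hyx
  calc ‖x - x₀‖ = ‖(y - x₀) - (y - (x + τ)) - τ‖ := by congr 1; abel
    _ ≤ ‖y - x₀‖ + ‖y - (x + τ)‖ + ‖τ‖ :=
        (norm_sub_le _ _).trans (by gcongr; exact norm_sub_le _ _)
    _ < R := by linarith

variable {G F : Type*} [NormedAddCommGroup G] [InnerProductSpace ℝ G] [FiniteDimensional ℝ G]
  [MeasurableSpace G] [BorelSpace G] [NormedAddCommGroup F] [NormedSpace ℝ F]

/-- The mollification of `f` by the bump function `φ`, evaluated at the point translated by `τ`: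
the average of `f` near `x + τ`. -/
def mollify (φ : ContDiffBump (0 : G)) (τ : G) (f : G → F) (x : G) : F :=
  convolution (φ.normed volume) f (ContinuousLinearMap.lsmul ℝ ℝ) volume (x + τ)

variable {φ : ContDiffBump (0 : G)} {τ : G} {f g : G → F}

theorem mollify_eq_integral (x : G) :
    mollify φ τ f x = ∫ y, φ.normed volume (x + τ - y) • f y :=
  convolution_lsmul_swap

theorem contDiff_mollify (hf : LocallyIntegrable f volume) :
    ContDiff ℝ ∞ (mollify φ τ f) := by
  have hconv : ContDiff ℝ ∞
      (convolution (φ.normed volume) f (ContinuousLinearMap.lsmul ℝ ℝ) volume) :=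
    φ.hasCompactSupport_normed.contDiff_convolution_left _ (φ.contDiff_normed (μ := volume)) hf
  exact hconv.comp (contDiff_id.add contDiff_const)

theorem fderiv_mollify (hf : LocallyIntegrable f volume) (x v : G) :
    fderiv ℝ (mollify φ τ f) x v = ∫ y, fderiv ℝ (φ.normed volume) (x + τ - y) v • f y := by
  have hconv := φ.hasCompactSupport_normed.hasFDerivAt_convolution_left (μ := volume)
    (ContinuousLinearMap.lsmul ℝ ℝ) (φ.contDiff_normed (μ := volume) (n := 1)) hf (x + τ)
  have htranslate : fderiv ℝ (mollify φ τ f) x = fderiv ℝ (convolution (φ.normed volume) f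
      (ContinuousLinearMap.lsmul ℝ ℝ) volume) (x + τ) := fderiv_comp_add_right τ
  have hexists : ConvolutionExistsAt (fderiv ℝ (φ.normed volume)) f (x + τ)
      (ContinuousLinearMap.precompL G (ContinuousLinearMap.lsmul ℝ ℝ)) volume :=
    (φ.hasCompactSupport_normed.fderiv ℝ).convolutionExists_left _
      ((φ.contDiff_normed (μ := volume) (n := 1)).continuous_fderiv one_ne_zero) hf _
  rw [htranslate, hconv.fderiv, convolution_eq_swap,
    ContinuousLinearMap.integral_apply hexists.integrable_swap]
  rfl

theorem integrable_normed_bump_smul (hf : LocallyIntegrable f volume) (x : G) :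
    Integrable fun y => φ.normed volume (x - y) • f y :=
  (φ.hasCompactSupport_normed.convolutionExists_left (ContinuousLinearMap.lsmul ℝ ℝ)
    φ.continuous_normed hf x).integrable_swap

theorem mollify_sub (hf : LocallyIntegrable f volume) (hg : LocallyIntegrable g volume) :
    mollify φ τ (f - g) = mollify φ τ f - mollify φ τ g := by
  ext x
  rw [Pi.sub_apply, mollify_eq_integral, mollify_eq_integral, mollify_eq_integral,
    ← integral_sub (integrable_normed_bump_smul hf _) (integrable_normed_bump_smul hg _)]
  exact integral_congr_ae (Eventually.of_forall fun y => smul_sub _ _ _)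

theorem normed_bump_sub_eq_zero {x y : G} (hy : y ∉ Metric.ball x φ.rOut) :
    φ.normed volume (x - y) = 0 := by
  rw [← Function.notMem_support, φ.support_normed_eq]
  rwa [Metric.mem_ball, dist_zero_right, ← dist_eq_norm, dist_comm]

theorem mollify_congr (x : G) (h : ∀ᵐ y, y ∈ Metric.ball (x + τ) φ.rOut → f y = g y) :
    mollify φ τ f x = mollify φ τ g x := by
  rw [mollify_eq_integral, mollify_eq_integral]
  refine integral_congr_ae ?_
  filter_upwards [h] with y hy
  by_cases hyball : y ∈ Metric.ball (x + τ) φ.rOut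
  · simp only [hy hyball]
  · simp only [normed_bump_sub_eq_zero hyball, zero_smul]

theorem mollify_eq_zero_of_notMem_ball {x₀ : G} {r R : ℝ}
    (hf : ∀ᵐ y, y ∉ Metric.ball x₀ r → f y = 0) (hR : r + φ.rOut + ‖τ‖ ≤ R) {x : G}
    (hx : x ∉ Metric.ball x₀ R) : mollify φ τ f x = 0 := by
  rw [mollify_congr (g := 0) x]
  · simp [mollify]
  filter_upwards [hf] with y hy hyball
  exact hy fun hyr =>
    hx (mem_ball_of_mem_closedBall_add hyr (Metric.ball_subset_closedBall hyball) hR)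

theorem lintegral_enorm_normed_bump (φ : ContDiffBump (0 : G)) :
    ∫⁻ x, ‖φ.normed volume x‖ₑ = 1 := by
  have hintegral := φ.integral_normed (μ := volume)
  rw [integral_eq_lintegral_of_nonneg_ae (Eventually.of_forall fun x => φ.nonneg_normed x)
    φ.continuous_normed.aestronglyMeasurable] at hintegral
  simpa only [Real.enorm_of_nonneg (φ.nonneg_normed _)] using
    (ENNReal.toReal_eq_one_iff _).mp hintegral

theorem enorm_mollify_sq_le (hf : AEStronglyMeasurable f volume) (x : G) :
    ‖mollify φ τ f x‖ₑ ^ 2 ≤ ∫⁻ y, ‖φ.normed volume y‖ₑ * ‖f (x + τ - y)‖ₑ ^ 2 := by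
  have hmeas : AEMeasurable (fun y => ‖f (x + τ - y)‖ₑ) volume :=
    (hf.comp_quasiMeasurePreserving
      (Measure.measurePreserving_sub_left volume (x + τ)).quasiMeasurePreserving).enorm
  refine le_trans ?_ (sq_lintegral_mul_le_of_lintegral_eq_one
    φ.continuous_normed.measurable.enorm hmeas (lintegral_enorm_normed_bump φ))
  gcongr
  refine (enorm_integral_le_lintegral_enorm _).trans (lintegral_mono fun y => ?_)
  exact (enorm_smul (φ.normed volume y) (f (x + τ - y))).le

theorem quasiMeasurePreserving_add_sub (τ : G) :
    Measure.QuasiMeasurePreserving (fun p : G × G => p.1 + τ - p.2)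
      (volume.prod volume) volume := by
  have hadd : Measure.QuasiMeasurePreserving (fun p : G × G => (p.1 + τ, p.2))
      (volume.prod volume) (volume.prod volume) :=
    ((measurePreserving_add_right (volume : Measure G) τ).prod
      (MeasurePreserving.id volume)).quasiMeasurePreserving
  exact (quasiMeasurePreserving_sub (volume : Measure G) volume).comp hadd

theorem eLpNorm_mollify_le (hf : AEStronglyMeasurable f volume) :
    eLpNorm (mollify φ τ f) 2 volume ≤ eLpNorm f 2 volume := by
  have hbump : Measurable fun y => ‖φ.normed volume y‖ₑ := φ.continuous_normed.measurable.enorm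
  refine (ENNReal.pow_le_pow_left_iff two_ne_zero).mp ?_
  rw [eLpNorm_two_sq, eLpNorm_two_sq]
  calc ∫⁻ x, ‖mollify φ τ f x‖ₑ ^ 2
      ≤ ∫⁻ x, ∫⁻ y, ‖φ.normed volume y‖ₑ * ‖f (x + τ - y)‖ₑ ^ 2 :=
        lintegral_mono fun x => enorm_mollify_sq_le hf x
    _ = ∫⁻ y, ∫⁻ x, ‖φ.normed volume y‖ₑ * ‖f (x + τ - y)‖ₑ ^ 2 :=
        lintegral_lintegral_swap <| (hbump.comp measurable_snd).aemeasurable.mul <|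
          (hf.comp_quasiMeasurePreserving (quasiMeasurePreserving_add_sub τ)).enorm.pow_const 2
    _ = ∫⁻ y, ‖φ.normed volume y‖ₑ * ∫⁻ x, ‖f x‖ₑ ^ 2 := by
        congr 1; ext y
        rw [lintegral_const_mul' _ _ enorm_ne_top,
          ← lintegral_add_right_eq_self (fun x => ‖f x‖ₑ ^ 2) (τ - y)]
        simp only [add_sub_assoc]
    _ = ∫⁻ x, ‖f x‖ₑ ^ 2 := by
        rw [lintegral_mul_const _ hbump, lintegral_enorm_normed_bump, one_mul]

variable {φs : ℕ → ContDiffBump (0 : G)} {τs : ℕ → G}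

theorem tendstoUniformly_mollify [CompleteSpace F] (hφ : Tendsto (fun n => (φs n).rOut) atTop (𝓝 0))
    (hτ : Tendsto τs atTop (𝓝 0)) (hg : Continuous g) (hgc : HasCompactSupport g) :
    TendstoUniformly (fun n => mollify (φs n) (τs n) g) g atTop := by
  rw [Metric.tendstoUniformly_iff]
  intro ε hε
  obtain ⟨δ, hδ, hgδ⟩ := Metric.uniformContinuous_iff.mp
    (hgc.uniformContinuous_of_continuous hg) (ε / 3) (by positivity)
  filter_upwards [hφ.eventually_lt_const hδ, Metric.tendsto_nhds.mp hτ δ hδ] with n hφn hτn x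
  have haverage : dist (mollify (φs n) (τs n) g x) (g (x + τs n)) ≤ ε / 3 :=
    ContDiffBump.dist_normed_convolution_le hg.aestronglyMeasurable fun y hy =>
      (hgδ (lt_trans hy hφn)).le
  have htranslate : dist (g (x + τs n)) (g x) < ε / 3 := hgδ (by simpa using hτn)
  rw [dist_comm]
  linarith [dist_triangle (mollify (φs n) (τs n) g x) (g (x + τs n)) (g x)]

theorem tendsto_eLpNorm_mollify_sub_of_continuous [CompleteSpace F]
    (hφ : Tendsto (fun n => (φs n).rOut) atTop (𝓝 0)) (hτ : Tendsto τs atTop (𝓝 0))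
    (hg : Continuous g) (hgc : HasCompactSupport g) :
    Tendsto (fun n => eLpNorm (mollify (φs n) (τs n) g - g) 2 volume) atTop (𝓝 0) := by
  obtain ⟨R, hR⟩ := hgc.isCompact.isBounded.subset_ball 0
  have hgR : ∀ y ∉ Metric.ball 0 R, g y = 0 := fun y hy =>
    image_eq_zero_of_notMem_tsupport fun hmem => hy (hR hmem)
  set K := Metric.ball (0 : G) (R + 2)
  have hbound : Tendsto (fun δ : ℝ => ENNReal.ofReal δ * volume K ^ (1 / 2 : ℝ)) (𝓝[>] 0)
      (𝓝 0) := by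
    have hKfin : volume K ^ (1 / 2 : ℝ) ≠ ⊤ :=
      (ENNReal.rpow_lt_top_of_nonneg (by norm_num) measure_ball_lt_top.ne).ne
    simpa using ENNReal.Tendsto.mul_const
      ((ENNReal.continuous_ofReal.tendsto 0).mono_left nhdsWithin_le_nhds) (Or.inr hKfin)
  rw [ENNReal.tendsto_nhds_zero]
  intro ε hε
  obtain ⟨δ, hδε, hδ⟩ :=
    ((ENNReal.tendsto_nhds_zero.mp hbound ε hε).and self_mem_nhdsWithin).exists
  filter_upwards [Metric.tendstoUniformly_iff.mp (tendstoUniformly_mollify hφ hτ hg hgc) δ hδ,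
    hφ.eventually_lt_const one_pos, Metric.tendsto_nhds.mp hτ 1 one_pos] with n hn hφn hτn
  rw [dist_zero_right] at hτn
  refine (eLpNorm_two_le_of_bound_of_support_subset Metric.isOpen_ball.measurableSet
    (fun x hx => ?_) fun x => ?_).trans hδε
  · rw [Pi.sub_apply,
      mollify_eq_zero_of_notMem_ball (Eventually.of_forall hgR) (by linarith) hx,
      hgR x fun hxR => hx (Metric.ball_subset_ball (by linarith) hxR), sub_zero]
  · rw [Pi.sub_apply, ← dist_eq_norm, dist_comm]
    exact (hn x).le

theorem tendsto_eLpNorm_mollify_sub [CompleteSpace F]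
    (hφ : Tendsto (fun n => (φs n).rOut) atTop (𝓝 0))
    (hτ : Tendsto τs atTop (𝓝 0)) (hf : MemLp f 2 volume) :
    Tendsto (fun n => eLpNorm (mollify (φs n) (τs n) f - f) 2 volume) atTop (𝓝 0) := by
  rw [ENNReal.tendsto_nhds_zero]
  intro ε hε
  have hε3 : 0 < ε / 3 := ENNReal.div_pos hε.ne' (by norm_num)
  obtain ⟨g, hgc, hfg, hg, hgm⟩ :=
    hf.exists_hasCompactSupport_eLpNorm_sub_le (by norm_num) hε3.ne'
  have hfl : LocallyIntegrable f volume := hf.locallyIntegrable (by norm_num)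
  have hgl : LocallyIntegrable g volume := hg.locallyIntegrable
  filter_upwards [ENNReal.tendsto_nhds_zero.mp
    (tendsto_eLpNorm_mollify_sub_of_continuous hφ hτ hg hgc) _ hε3] with n hn
  have hmol_fg : AEStronglyMeasurable (mollify (φs n) (τs n) (f - g)) volume :=
    (contDiff_mollify (hfl.sub hgl)).continuous.aestronglyMeasurable
  have hmol_g : AEStronglyMeasurable (mollify (φs n) (τs n) g - g) volume :=
    ((contDiff_mollify hgl).continuous.sub hg).aestronglyMeasurable
  calc eLpNorm (mollify (φs n) (τs n) f - f) 2 volume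
      = eLpNorm (mollify (φs n) (τs n) (f - g) + (mollify (φs n) (τs n) g - g) + (g - f)) 2
          volume := by
        rw [mollify_sub hfl hgl]
        congr 1; abel
    _ ≤ eLpNorm (mollify (φs n) (τs n) (f - g)) 2 volume
        + eLpNorm (mollify (φs n) (τs n) g - g) 2 volume + eLpNorm (g - f) 2 volume := by
        refine (eLpNorm_add_le (hmol_fg.add hmol_g) (hgm.1.sub hf.1) (by norm_num)).trans ?_
        gcongr
        exact eLpNorm_add_le hmol_fg hmol_g (by norm_num)
    _ ≤ ε / 3 + ε / 3 + ε / 3 := by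
        gcongr
        · exact (eLpNorm_mollify_le (hf.1.sub hgm.1)).trans hfg
        · rwa [eLpNorm_sub_comm]
    _ = ε := ENNReal.add_thirds ε

end Mollify

variable {d : ℕ} {Ω : Set (E d)}

section Sobolev

/-- The Hilbert space `L²(Ω) × L²(Ω)^d` containing `H¹(Ω)`. -/
abbrev H1Ambient (Ω : Set (E d)) : Type :=
  WithLp 2 (L2 Ω × PiLp 2 (fun _ : Fin d => L2 Ω))

/-- The pair `(u, g)` in `L²(Ω) × L²(Ω)^d`. -/
def mkAmbient (u : L2 Ω) (g : Fin d → L2 Ω) : H1Ambient Ω :=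
  WithLp.toLp 2 (u, WithLp.toLp 2 g)

theorem tendsto_ambient {ι : Type*} {l : Filter ι} {p : ι → H1Ambient Ω} {q : H1Ambient Ω}
    (hfst : Tendsto (fun n => (p n).fst) l (𝓝 q.fst))
    (hsnd : ∀ i, Tendsto (fun n => (p n).snd i) l (𝓝 (q.snd i))) : Tendsto p l (𝓝 q) := by
  have hsnd' : Tendsto (fun n => (p n).snd) l (𝓝 q.snd) :=
    ((PiLp.continuous_toLp 2 _).tendsto _).comp
      (tendsto_pi_nhds.mpr hsnd : Tendsto (fun n => WithLp.ofLp (p n).snd) l _)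
  exact ((WithLp.prod_continuous_toLp 2 _ _).tendsto _).comp (hfst.prodMk_nhds hsnd')

theorem continuous_fst_ambient : Continuous fun p : H1Ambient Ω => p.fst :=
  continuous_fst.comp (WithLp.prod_continuous_ofLp 2 _ _)

theorem continuous_snd_ambient (i : Fin d) : Continuous fun p : H1Ambient Ω => p.snd i :=
  ((continuous_apply i).comp (PiLp.continuous_ofLp 2 _)).comp
    (continuous_snd.comp (WithLp.prod_continuous_ofLp 2 _ _))

theorem continuous_integral_smul {η : E d → ℝ} (hη : Continuous η) (hc : HasCompactSupport η) :
    Continuous fun u : L2 Ω => ∫ x in Ω, η x • u x := by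
  have hmem : MemLp (fun x => (η x : ℂ)) 2 (volume.restrict Ω) :=
    ((hη.memLp_of_hasCompactSupport hc).restrict Ω).ofReal
  have integral_eq_inner : ∀ u : L2 Ω, ∫ x in Ω, η x • u x = inner ℂ (hmem.toLp _) u := by
    intro u
    rw [L2.inner_def]
    refine integral_congr_ae ?_
    filter_upwards [hmem.coeFn_toLp] with x hx
    simp [hx, mul_comm]
  simp only [integral_eq_inner]
  fun_prop

theorem continuous_partialDeriv {φ : E d → ℝ} (hφ : ContDiff ℝ ∞ φ) (i : Fin d) :
    Continuous (partialDeriv i φ) :=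
  (hφ.continuous_fderiv (by simp)).clm_apply continuous_const

theorem hasCompactSupport_partialDeriv {φ : E d → ℝ} (hφ : HasCompactSupport φ) (i : Fin d) :
    HasCompactSupport (partialDeriv i φ) :=
  hφ.fderiv_apply (𝕜 := ℝ) _

theorem isClosed_H1 : IsClosed (H1 Ω : Set (H1Ambient Ω)) := by
  have eq_iInter : (H1 Ω : Set (H1Ambient Ω)) =
      ⋂ (i : Fin d) (φ : E d → ℝ) (_ : IsTestFunction Ω φ),
        {p | ∫ x in Ω, partialDeriv i φ x • p.fst x = - ∫ x in Ω, φ x • p.snd i x} := by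
    ext p
    simp only [mem_iInter]
    rfl
  rw [eq_iInter]
  refine isClosed_iInter fun i => isClosed_iInter fun φ => isClosed_iInter fun hφ =>
    isClosed_eq ?_ ?_
  · exact (continuous_integral_smul (continuous_partialDeriv hφ.contDiff i)
      (hasCompactSupport_partialDeriv hφ.hasCompactSupport i)).comp continuous_fst_ambient
  · exact ((continuous_integral_smul hφ.contDiff.continuous hφ.hasCompactSupport).comp
      (continuous_snd_ambient i)).neg

instance : CompleteSpace (H1 Ω) := isClosed_H1.completeSpace_coe

theorem isWeakPartialDeriv_grad (u : H1 Ω) (i : Fin d) :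
    IsWeakPartialDeriv Ω i (toL2 u) (grad u i) := u.2 i

theorem L2_ext_of_test (hΩ : IsOpen Ω) {f g : L2 Ω}
    (h : ∀ φ : E d → ℝ, IsTestFunction Ω φ → ∫ x in Ω, φ x • f x = ∫ x in Ω, φ x • g x) :
    f = g := by
  have hloc : LocallyIntegrableOn (f - g : L2 Ω) Ω volume :=
    locallyIntegrableOn_of_locallyIntegrable_restrict
      ((Lp.memLp (f - g)).locallyIntegrable (by norm_num))
  have integral_sub_eq_zero : ∀ φ : E d → ℝ, IsTestFunction Ω φ →
      ∫ x, φ x • (f - g : L2 Ω) x = 0 := by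
    intro φ hφ
    rw [← setIntegral_eq_integral_of_forall_compl_eq_zero (s := Ω) fun x hx => by
        rw [image_eq_zero_of_notMem_tsupport (fun hx' => hx (hφ.tsupport_subset hx')), zero_smul],
      ← sub_eq_zero.mpr (h φ hφ),
      ← integral_sub (hφ.integrable_smul f) (hφ.integrable_smul g)]
    refine integral_congr_ae ?_
    filter_upwards [Lp.coeFn_sub f g] with x hx
    rw [hx, Pi.sub_apply, smul_sub]
  rw [← sub_eq_zero]
  refine Lp.ext ?_
  filter_upwards [(ae_restrict_iff' hΩ.measurableSet).mpr
      (hΩ.ae_eq_zero_of_integral_contDiff_smul_eq_zero hloc fun φ hsmooth hsupp hsub =>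
        integral_sub_eq_zero φ ⟨hsmooth, hsupp, hsub⟩),
    Lp.coeFn_zero ℂ 2 (volume.restrict Ω)] with x hx hzero
  rw [hx, hzero, Pi.zero_apply]

theorem toL2_injective (hΩ : IsOpen Ω) : Function.Injective (toL2 : H1 Ω → L2 Ω) := by
  intro u v h
  have hgrad : ∀ i, grad u i = grad v i := fun i => L2_ext_of_test hΩ fun φ hφ => by
    rw [← neg_inj, ← isWeakPartialDeriv_grad u i φ hφ, ← isWeakPartialDeriv_grad v i φ hφ, h]
  exact Subtype.ext (WithLp.ofLp_injective 2 (Prod.ext h (PiLp.ext hgrad)))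

theorem memLp_restrict_of_isBounded {F : Type*} [NormedAddCommGroup F]
    (hb : Bornology.IsBounded Ω) {w : E d → F} (hw : Continuous w) (p : ℝ≥0∞) :
    MemLp w p (volume.restrict Ω) := by
  have : IsFiniteMeasure (volume.restrict Ω) :=
    ⟨by simpa only [Measure.restrict_apply_univ] using hb.measure_lt_top⟩
  obtain ⟨C, hC⟩ := hb.isCompact_closure.exists_bound_of_continuousOn hw.continuousOn
  exact MemLp.of_bound hw.aestronglyMeasurable C
    (ae_restrict_of_ae_restrict_of_subset subset_closure
      (ae_restrict_of_forall_mem isClosed_closure.measurableSet hC))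

theorem setIntegral_smul_eq_integral {η : E d → ℝ} (hη : tsupport η ⊆ Ω) {u : L2 Ω} {w : E d → ℂ}
    (hu : u =ᵐ[volume.restrict Ω] w) : ∫ x in Ω, η x • u x = ∫ x, η x • w x := by
  have hcompl : ∀ x ∉ Ω, η x • w x = 0 := fun x hx => by
    rw [image_eq_zero_of_notMem_tsupport fun hx' => hx (hη hx'), zero_smul]
  rw [← setIntegral_eq_integral_of_forall_compl_eq_zero hcompl]
  refine integral_congr_ae ?_
  filter_upwards [hu] with x hx
  rw [hx]

theorem IsTestFunction.tsupport_partialDeriv_subset {φ : E d → ℝ} (hφ : IsTestFunction Ω φ)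
    (i : Fin d) : tsupport (partialDeriv i φ) ⊆ Ω :=
  (tsupport_fderiv_apply_subset ℝ _).trans hφ.tsupport_subset

theorem IsTestFunction.integral_partialDeriv_smul {φ : E d → ℝ} (hφ : IsTestFunction Ω φ)
    {w : E d → ℂ} (hw : ContDiff ℝ 1 w) (i : Fin d) :
    ∫ x, partialDeriv i φ x • w x =
      -∫ x, φ x • fderiv ℝ w x (EuclideanSpace.single i 1) := by
  have integrable_smul : ∀ {η : E d → ℝ} {g : E d → ℂ}, Continuous η → HasCompactSupport η →
      Continuous g → Integrable fun x => η x • g x := fun hη hc hg =>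
    (hη.smul hg).integrable_of_hasCompactSupport hc.smul_right
  rw [integral_smul_fderiv_eq_neg_fderiv_smul_of_integrable
    (integrable_smul (continuous_partialDeriv hφ.contDiff i)
      (hasCompactSupport_partialDeriv hφ.hasCompactSupport i) hw.continuous)
    (integrable_smul hφ.contDiff.continuous hφ.hasCompactSupport
      ((hw.continuous_fderiv one_ne_zero).clm_apply continuous_const))
    (integrable_smul hφ.contDiff.continuous hφ.hasCompactSupport hw.continuous)
    (fun x _ => hφ.contDiff.differentiable (by simp) x)
    (fun x _ => hw.differentiable one_ne_zero x), neg_neg]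
  rfl

theorem exists_H1_of_contDiff (hb : Bornology.IsBounded Ω) {w : E d → ℂ}
    (hw : ContDiff ℝ 1 w) :
    ∃ v : H1 Ω, toL2 v =ᵐ[volume.restrict Ω] w ∧
      ∀ i, grad v i =ᵐ[volume.restrict Ω] fun x =>
        fderiv ℝ w x (EuclideanSpace.single i 1) := by
  have hmem : MemLp w 2 (volume.restrict Ω) := memLp_restrict_of_isBounded hb hw.continuous 2
  have hmem' : ∀ i : Fin d,
      MemLp (fun x => fderiv ℝ w x (EuclideanSpace.single i 1)) 2 (volume.restrict Ω) := fun i =>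
    memLp_restrict_of_isBounded hb
      ((hw.continuous_fderiv one_ne_zero).clm_apply continuous_const) 2
  refine ⟨⟨mkAmbient (hmem.toLp w) fun i => (hmem' i).toLp _, fun i φ hφ => ?_⟩,
    hmem.coeFn_toLp, fun i => (hmem' i).coeFn_toLp⟩
  change ∫ x in Ω, partialDeriv i φ x • (hmem.toLp w) x =
    -∫ x in Ω, φ x • ((hmem' i).toLp _) x
  rw [setIntegral_smul_eq_integral (hφ.tsupport_partialDeriv_subset i) hmem.coeFn_toLp,
    setIntegral_smul_eq_integral hφ.tsupport_subset (hmem' i).coeFn_toLp,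
    hφ.integral_partialDeriv_smul hw]

end Sobolev

section Cutoff

theorem memLp_top_ofReal {η : E d → ℝ} (hη : Continuous η) (hc : HasCompactSupport η)
    (μ : Measure (E d)) : MemLp (fun x => (η x : ℂ)) ∞ μ := by
  obtain ⟨C, hC⟩ := hc.exists_bound_of_continuous hη
  exact memLp_top_of_bound (Complex.continuous_ofReal.comp hη).aestronglyMeasurable C
    (Eventually.of_forall fun x => by simpa using hC x)

/-- Multiplication by a continuous compactly supported function on `L²(Ω)`. -/
def mulL2 {η : E d → ℝ} (hη : Continuous η) (hc : HasCompactSupport η) : L2 Ω →L[ℂ] L2 Ω :=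
  (ContinuousLinearMap.mul ℂ ℂ).holderL (volume.restrict Ω) ∞ 2 2
    ((memLp_top_ofReal hη hc _).toLp _)

theorem coeFn_mulL2 {η : E d → ℝ} (hη : Continuous η) (hc : HasCompactSupport η) (u : L2 Ω) :
    mulL2 hη hc u =ᵐ[volume.restrict Ω] fun x => η x • u x := by
  have hmem := memLp_top_ofReal hη hc (volume.restrict Ω)
  filter_upwards [(ContinuousLinearMap.mul ℂ ℂ).coeFn_holder (r := 2) (hmem.toLp _) u,
    hmem.coeFn_toLp] with x hholder hx
  refine hholder.trans ?_
  simp [hx]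

theorem setIntegral_smul_mulL2 {η : E d → ℝ} (hη : Continuous η) (hc : HasCompactSupport η)
    (ρ : E d → ℝ) (u : L2 Ω) :
    ∫ y in Ω, ρ y • mulL2 hη hc u y = ∫ y in Ω, (ρ y * η y) • u y := by
  refine integral_congr_ae ?_
  filter_upwards [coeFn_mulL2 hη hc u] with y hy
  rw [hy, smul_smul]

/-- Multiplication of `(u, ∇u)` by a smooth cutoff function, with the product rule. -/
def cutoff {χ : E d → ℝ} (hχ : ContDiff ℝ ∞ χ) (hc : HasCompactSupport χ) :
    H1Ambient Ω →L[ℂ] H1Ambient Ω :=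
  (WithLp.prodContinuousLinearEquiv 2 ℂ _ _).symm.toContinuousLinearMap ∘L
    ((mulL2 hχ.continuous hc ∘L WithLp.fstL 2 ℂ _ _).prod
      ((PiLp.continuousLinearEquiv 2 ℂ (fun _ : Fin d => L2 Ω)).symm.toContinuousLinearMap ∘L
        ContinuousLinearMap.pi fun i =>
          mulL2 hχ.continuous hc ∘L PiLp.proj 2 (fun _ : Fin d => L2 Ω) i ∘L WithLp.sndL 2 ℂ _ _ +
          mulL2 (continuous_partialDeriv hχ i) (hasCompactSupport_partialDeriv hc i) ∘L
            WithLp.fstL 2 ℂ _ _))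

variable {χ : E d → ℝ}

theorem cutoff_fst (hχ : ContDiff ℝ ∞ χ) (hc : HasCompactSupport χ) (p : H1Ambient Ω) :
    (cutoff hχ hc p).fst = mulL2 hχ.continuous hc p.fst := rfl

theorem coeFn_cutoff_snd (hχ : ContDiff ℝ ∞ χ) (hc : HasCompactSupport χ) (p : H1Ambient Ω)
    (i : Fin d) : (cutoff hχ hc p).snd i =ᵐ[volume.restrict Ω]
      fun x => χ x • p.snd i x + partialDeriv i χ x • p.fst x :=
  (Lp.coeFn_add _ _).trans ((coeFn_mulL2 hχ.continuous hc _).add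
    (coeFn_mulL2 (continuous_partialDeriv hχ i) (hasCompactSupport_partialDeriv hc i) _))

theorem memLp_indicator (hΩ : IsOpen Ω) (f : L2 Ω) : MemLp (Ω.indicator f) 2 volume :=
  (memLp_indicator_iff_restrict hΩ.measurableSet).mpr (Lp.memLp f)

theorem locallyIntegrable_indicator (hΩ : IsOpen Ω) (f : L2 Ω) :
    LocallyIntegrable (Ω.indicator f) volume :=
  (memLp_indicator hΩ f).locallyIntegrable (by norm_num)

theorem integral_smul_indicator (hΩ : IsOpen Ω) (η : E d → ℝ) (f : E d → ℂ) :
    ∫ y, η y • Ω.indicator f y = ∫ y in Ω, η y • f y := by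
  rw [← integral_indicator hΩ.measurableSet]
  exact integral_congr_ae (Eventually.of_forall fun y => (indicator_smul_apply Ω η f y).symm)

variable {φ : ContDiffBump (0 : E d)}

theorem isTestFunction_normed_bump_sub_mul (hχ : ContDiff ℝ ∞ χ) (hc : HasCompactSupport χ)
    {x : E d} (hsub : ∀ y ∈ tsupport χ, y ∈ Metric.closedBall x φ.rOut → y ∈ Ω) :
    IsTestFunction Ω fun y => φ.normed volume (x - y) * χ y where
  contDiff := (φ.contDiff_normed.comp (contDiff_const.sub contDiff_id)).mul hχ
  hasCompactSupport := hc.mul_left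
  tsupport_subset y hy := by
    refine hsub y (tsupport_mul_subset_right hy) ?_
    have hball : (Function.support fun y => φ.normed volume (x - y)) ⊆
        Metric.closedBall x φ.rOut := fun z hz =>
      Metric.ball_subset_closedBall (by_contra fun hzball => hz (normed_bump_sub_eq_zero hzball))
    exact closure_minimal hball Metric.isClosed_closedBall (tsupport_mul_subset_left hy)

theorem partialDeriv_comp_sub_mul {ρ : E d → ℝ} (hρ : Differentiable ℝ ρ)
    (hχ : Differentiable ℝ χ) (i : Fin d) (x y : E d) :
    partialDeriv i (fun y => ρ (x - y) * χ y) y =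
      ρ (x - y) * partialDeriv i χ y - partialDeriv i ρ (x - y) * χ y := by
  have hreflect : HasFDerivAt (fun y => ρ (x - y)) (-fderiv ℝ ρ (x - y)) y := by
    have hcomp := (hρ (x - y)).hasFDerivAt.comp y ((hasFDerivAt_id y).const_sub x)
    rwa [ContinuousLinearMap.comp_neg, ContinuousLinearMap.comp_id] at hcomp
  have hmul : fderiv ℝ (fun y => ρ (x - y) * χ y) y = _ :=
    (hreflect.mul (hχ y).hasFDerivAt).fderiv
  unfold partialDeriv
  rw [hmul]
  simp only [smul_neg, add_apply, neg_apply, smul_apply, smul_eq_mul]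
  ring

/-- The translation has to move the part of `supp χ` seen by the mollifier into `Ω`, so that the
mollifier times `χ` is an admissible test function for `u`. -/
theorem fderiv_mollify_cutoff (hΩ : IsOpen Ω) (hχ : ContDiff ℝ ∞ χ) (hc : HasCompactSupport χ)
    (τ : E d) (u : H1 Ω) {x : E d}
    (hsub : ∀ y ∈ tsupport χ, y ∈ Metric.closedBall (x + τ) φ.rOut → y ∈ Ω) (i : Fin d) :
    fderiv ℝ (mollify φ τ (Ω.indicator (cutoff hχ hc u.1).fst)) x (EuclideanSpace.single i 1) =
      mollify φ τ (Ω.indicator ((cutoff hχ hc u.1).snd i)) x := by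
  set ρ := φ.normed volume
  have hρ : ContDiff ℝ ∞ ρ := φ.contDiff_normed
  have hψ := isTestFunction_normed_bump_sub_mul hχ hc hsub
  have hint_rho : Integrable (fun y => (ρ (x + τ - y) * partialDeriv i χ y) • toL2 u y)
      (volume.restrict Ω) :=
    integrable_smul_L2 ((hρ.continuous.comp (by fun_prop)).mul (continuous_partialDeriv hχ i))
      (hasCompactSupport_partialDeriv hc i).mul_left (toL2 u)
  have hint_deriv : Integrable (fun y => (partialDeriv i ρ (x + τ - y) * χ y) • toL2 u y)
      (volume.restrict Ω) :=
    integrable_smul_L2 (((continuous_partialDeriv hρ i).comp (by fun_prop)).mul hχ.continuous)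
      hc.mul_left (toL2 u)
  have hweak : (∫ y in Ω, (ρ (x + τ - y) * partialDeriv i χ y) • toL2 u y) -
        ∫ y in Ω, (partialDeriv i ρ (x + τ - y) * χ y) • toL2 u y =
      -∫ y in Ω, (ρ (x + τ - y) * χ y) • grad u i y := by
    rw [← isWeakPartialDeriv_grad u i _ hψ, ← integral_sub hint_rho hint_deriv]
    simp only [partialDeriv_comp_sub_mul (hρ.differentiable (by simp))
      (hχ.differentiable (by simp)), sub_smul, ρ]
  have hfst : fderiv ℝ (mollify φ τ (Ω.indicator (cutoff hχ hc u.1).fst)) x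
      (EuclideanSpace.single i 1) =
        ∫ y in Ω, (partialDeriv i ρ (x + τ - y) * χ y) • toL2 u y := by
    rw [fderiv_mollify (locallyIntegrable_indicator hΩ _), integral_smul_indicator hΩ, cutoff_fst,
      setIntegral_smul_mulL2]
    rfl
  have hsnd : mollify φ τ (Ω.indicator ((cutoff hχ hc u.1).snd i)) x =
      (∫ y in Ω, (ρ (x + τ - y) * χ y) • grad u i y) +
        ∫ y in Ω, (ρ (x + τ - y) * partialDeriv i χ y) • toL2 u y := by
    rw [mollify_eq_integral, integral_smul_indicator hΩ,
      ← integral_add (hψ.integrable_smul (grad u i)) hint_rho]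
    refine integral_congr_ae ?_
    filter_upwards [coeFn_cutoff_snd hχ hc u.1 i] with y hy
    rw [hy, smul_add, smul_smul, smul_smul]
    rfl
  rw [hfst, hsnd]
  linear_combination (-1 : ℂ) * hweak

variable {φs : ℕ → ContDiffBump (0 : E d)} {τs : ℕ → E d}

theorem tendsto_L2_of_mollify (hΩ : IsOpen Ω) (hφ : Tendsto (fun n => (φs n).rOut) atTop (𝓝 0))
    (hτ : Tendsto τs atTop (𝓝 0)) {f : L2 Ω} {v : ℕ → L2 Ω}
    (hv : ∀ n, v n =ᵐ[volume.restrict Ω] mollify (φs n) (τs n) (Ω.indicator f)) :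
    Tendsto v atTop (𝓝 f) := by
  rw [Lp.tendsto_Lp_iff_tendsto_eLpNorm']
  refine tendsto_of_tendsto_of_tendsto_of_le_of_le tendsto_const_nhds
    (tendsto_eLpNorm_mollify_sub hφ hτ (memLp_indicator hΩ f)) (fun _ => zero_le) fun n => ?_
  calc eLpNorm (⇑(v n) - ⇑f) 2 (volume.restrict Ω)
      = eLpNorm (mollify (φs n) (τs n) (Ω.indicator f) - Ω.indicator f) 2 (volume.restrict Ω) := by
        refine eLpNorm_congr_ae ?_
        filter_upwards [hv n, ae_restrict_mem hΩ.measurableSet] with x hx hxΩ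
        simp [hx, hxΩ]
    _ ≤ _ := eLpNorm_mono_measure _ Measure.restrict_le_self

theorem exists_tendsto_cutoff (hΩ : IsOpen Ω) (hb : Bornology.IsBounded Ω)
    (hχ : ContDiff ℝ ∞ χ) (hc : HasCompactSupport χ)
    (hφ : Tendsto (fun n => (φs n).rOut) atTop (𝓝 0)) (hτ : Tendsto τs atTop (𝓝 0))
    (hsub : ∀ n, ∀ x ∈ Ω, ∀ y ∈ tsupport χ,
      y ∈ Metric.closedBall (x + τs n) (φs n).rOut → y ∈ Ω) (u : H1 Ω) :
    ∃ v : ℕ → H1 Ω,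
      (∀ n, toL2 (v n) =ᵐ[volume.restrict Ω]
        mollify (φs n) (τs n) (Ω.indicator (cutoff hχ hc u.1).fst)) ∧
      (∀ n i, grad (v n) i =ᵐ[volume.restrict Ω] fun x =>
        fderiv ℝ (mollify (φs n) (τs n) (Ω.indicator (cutoff hχ hc u.1).fst)) x
          (EuclideanSpace.single i 1)) ∧
      Tendsto (fun n => (v n).1) atTop (𝓝 (cutoff hχ hc u.1)) := by
  have hsmooth : ∀ n, ContDiff ℝ 1 (mollify (φs n) (τs n) (Ω.indicator (cutoff hχ hc u.1).fst)) :=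
    fun n => (contDiff_mollify (locallyIntegrable_indicator hΩ _)).of_le (by simp)
  choose v hv hgrad using fun n => exists_H1_of_contDiff hb (hsmooth n)
  refine ⟨v, hv, hgrad, tendsto_ambient (tendsto_L2_of_mollify hΩ hφ hτ hv) fun i =>
    tendsto_L2_of_mollify hΩ hφ hτ fun n => ?_⟩
  filter_upwards [hgrad n i, ae_restrict_mem hΩ.measurableSet] with x hx hxΩ
  rw [← fderiv_mollify_cutoff hΩ hχ hc (τs n) u (hsub n x hxΩ) i, ← hx]
  rfl

end Cutoff

section Graph

variable {G : Type*} [NormedAddCommGroup G] [InnerProductSpace ℝ G] {e : G}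

/-- The hyperplane `e^⊥` over which a Lipschitz boundary is a graph. -/
abbrev hyperplane (e : G) : Submodule ℝ G := (Submodule.span ℝ {e})ᗮ

/-- The orthogonal projection onto the hyperplane `e^⊥`. -/
abbrev hproj (e : G) : G →L[ℝ] hyperplane e :=
  (Submodule.span ℝ {e})ᗮ.orthogonalProjectionOnto

theorem hproj_add_smul (z : G) (s : ℝ) : hproj e (z + s • e) = hproj e z := by
  rw [map_add, map_smul, Submodule.orthogonalProjectionOnto_orthogonalComplement_singleton_eq_zero,
    smul_zero, add_zero]

theorem hproj_add_inner (he : ‖e‖ = 1) (y : G) :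
    (hproj e y : G) + (inner ℝ e y : ℝ) • e = y := by
  rw [← Submodule.starProjection_unit_singleton ℝ he, add_comm]
  exact Submodule.starProjection_add_starProjection_orthogonal _

theorem inner_add_smul_self (he : ‖e‖ = 1) (y : G) (s : ℝ) :
    inner ℝ e (y + s • e) = (inner ℝ e y : ℝ) + s := by
  rw [inner_add_right, inner_smul_right, real_inner_self_eq_norm_sq, he, one_pow, mul_one]

/-- The splitting of space into the hyperplane `e^⊥` and the line spanned by the unit vector `e`. -/
def hyperplaneEquiv (he : ‖e‖ = 1) : (hyperplane e × ℝ) ≃L[ℝ] G where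
  toFun p := (p.1 : G) + p.2 • e
  map_add' p q := by simp only [Prod.fst_add, Prod.snd_add, Submodule.coe_add, add_smul]; abel
  map_smul' c p := by simp [smul_add, mul_smul]
  invFun y := (hproj e y, inner ℝ e y)
  left_inv p := by
    ext1
    · simp only [hproj_add_smul, Submodule.orthogonalProjectionOnto_mem_subspace_eq_self]
    · simp only [inner_add_smul_self he,
        (Submodule.mem_orthogonal_singleton_iff_inner_right).mp p.1.2, zero_add]
  right_inv y := hproj_add_inner he y
  continuous_toFun := by fun_prop
  continuous_invFun := by fun_prop

theorem finrank_hyperplane [FiniteDimensional ℝ G] (he : ‖e‖ = 1) :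
    Module.finrank ℝ (hyperplane e) = Module.finrank ℝ G - 1 := by
  have hne : e ≠ 0 := by rintro rfl; simp at he
  rw [← Submodule.finrank_add_finrank_orthogonal (Submodule.span ℝ {e}),
    finrank_span_singleton hne, add_tsub_cancel_left]

/-- The parametrization of the graph of `g` over the hyperplane `e^⊥`. -/
def graphMap (g : hyperplane e → ℝ) (z : hyperplane e) : G := (z : G) + g z • e

theorem lipschitzWith_graphMap (he : ‖e‖ = 1) {K : ℝ≥0} {g : hyperplane e → ℝ}
    (hg : LipschitzWith K g) : LipschitzWith (1 + K) (graphMap g) := by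
  refine (LipschitzWith.subtype_val _).add (LipschitzWith.of_dist_le_mul fun z z' => ?_)
  rw [dist_eq_norm, ← sub_smul, norm_smul, he, mul_one, ← dist_eq_norm]
  exact hg.dist_le_mul z z'

variable [MeasurableSpace G] [BorelSpace G]

theorem exists_lintegral_lintegral_le [FiniteDimensional ℝ G] (he : ‖e‖ = 1)
    (ν : Measure (hyperplane e)) [ν.IsAddHaarMeasure] (μ : Measure G) [μ.IsAddHaarMeasure] :
    ∃ C : ℝ≥0, ∀ F : G → ℝ≥0∞, Measurable F →
      ∫⁻ z, (∫⁻ s : ℝ, F ((z : G) + s • e)) ∂ν ≤ C * ∫⁻ y, F y ∂μ := by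
  let T := hyperplaneEquiv he
  have hT : (Measure.map T (ν.prod volume)).IsAddHaarMeasure := T.isAddHaarMeasure_map _
  refine ⟨Measure.addHaarScalarFactor (Measure.map T (ν.prod volume)) μ, fun F hF => le_of_eq ?_⟩
  calc ∫⁻ z, (∫⁻ s : ℝ, F ((z : G) + s • e)) ∂ν
      = ∫⁻ p, F (T p) ∂(ν.prod volume) :=
        (lintegral_prod (fun p => F (T p)) (hF.comp T.continuous.measurable).aemeasurable).symm
    _ = ∫⁻ y, F y ∂(Measure.map T (ν.prod volume)) :=
        (lintegral_map hF T.continuous.measurable).symm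
    _ = _ := by
        conv_lhs => rw [Measure.isAddLeftInvariant_eq_smul (Measure.map T (ν.prod volume)) μ]
        exact lintegral_smul_measure _ _

theorem hausdorff_restrict_graph_le (n : ℕ) (he : ‖e‖ = 1) {K : ℝ≥0} {g : hyperplane e → ℝ}
    (hg : LipschitzWith K g) {A : Set G} (hA : ∀ x ∈ A, graphMap g (hproj e x) = x) :
    (Measure.euclideanHausdorffMeasure n : Measure G).restrict A ≤
      ((1 + K) ^ n : ℝ≥0) • Measure.map (graphMap g)
        (Measure.euclideanHausdorffMeasure n : Measure (hyperplane e)) := by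
  have hLip := lipschitzWith_graphMap he hg
  refine Measure.le_iff.mpr fun B hB => ?_
  rw [Measure.restrict_apply hB, Measure.smul_apply,
    Measure.map_apply hLip.continuous.measurable hB]
  have hsub : B ∩ A ⊆ graphMap g '' (graphMap g ⁻¹' B) := by
    rintro x ⟨hxB, hxA⟩
    exact ⟨hproj e x, by rwa [mem_preimage, hA x hxA], hA x hxA⟩
  have himage := (hLip.lipschitzOnWith (s := graphMap g ⁻¹' B)).hausdorffMeasure_image_le
    (d := n) n.cast_nonneg
  rw [Measure.euclideanHausdorffMeasure_def, Measure.euclideanHausdorffMeasure_def,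
    Measure.smul_apply, Measure.smul_apply, smul_comm]
  refine smul_le_smul_of_nonneg_left ((measure_mono hsub).trans (himage.trans (le_of_eq ?_)))
    zero_le
  rw [ENNReal.rpow_natCast]
  simp [ENNReal.smul_def]

end Graph

section Chart

variable {G : Type*} [NormedAddCommGroup G] [InnerProductSpace ℝ G]

/-- In `U`, the set `Ω` is the strict epigraph, in the direction of the unit vector `e`, of the
`K`-Lipschitz function `g` on `e^⊥`. -/
structure IsLipschitzChart (Ω U : Set G) (e : G) (K : ℝ≥0) (g : hyperplane e → ℝ) : Prop where
  isOpen : IsOpen U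
  norm_eq_one : ‖e‖ = 1
  lipschitz : LipschitzWith K g
  inter_eq : Ω ∩ U = {y ∈ U | g (hproj e y) < inner ℝ e y}

namespace IsLipschitzChart

variable {Ω U : Set G} {e : G} {K : ℝ≥0} {g : hyperplane e → ℝ} {x y : G}

theorem le_inner (h : IsLipschitzChart Ω U e K g) (hy : y ∈ closure Ω) (hyU : y ∈ U) :
    g (hproj e y) ≤ inner ℝ e y := by
  have hclosed : IsClosed {y : G | g (hproj e y) ≤ inner ℝ e y} :=
    isClosed_le (h.lipschitz.continuous.comp (hproj e).continuous) (by fun_prop)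
  refine closure_minimal ?_ hclosed (h.isOpen.inter_closure ⟨hyU, hy⟩)
  rw [inter_comm, h.inter_eq]
  exact fun z hz => le_of_lt hz.2

theorem eq_inner (h : IsLipschitzChart Ω U e K g) (hΩ : IsOpen Ω) (hy : y ∈ frontier Ω)
    (hyU : y ∈ U) : g (hproj e y) = inner ℝ e y := by
  refine (h.le_inner hy.1 hyU).antisymm (not_lt.mp fun hlt => ?_)
  have hmem : y ∈ Ω ∩ U := h.inter_eq ▸ ⟨hyU, hlt⟩
  exact (hΩ.frontier_eq ▸ hy).2 hmem.1

theorem graphMap_hproj (h : IsLipschitzChart Ω U e K g) (hΩ : IsOpen Ω) (hx : x ∈ frontier Ω)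
    (hxU : x ∈ U) : graphMap g (hproj e x) = x := by
  rw [graphMap, h.eq_inner hΩ hx hxU, hproj_add_inner h.norm_eq_one]

theorem mem_of_mem_closedBall_add_smul (h : IsLipschitzChart Ω U e K g) {t ε : ℝ}
    (hε : (1 + K) * ε < t) (hx : x ∈ closure Ω) (hxU : x ∈ U) (hyU : y ∈ U)
    (hxy : y ∈ Metric.closedBall (x + t • e) ε) : y ∈ Ω := by
  rw [mem_closedBall_iff_norm] at hxy
  have hlower : (inner ℝ e x : ℝ) + t - ε ≤ inner ℝ e y := by
    have hinner : inner ℝ e (x + t • e - y) ≤ ε :=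
      (real_inner_le_norm _ _).trans (by rwa [h.norm_eq_one, one_mul, norm_sub_rev])
    rw [inner_sub_right, inner_add_smul_self h.norm_eq_one] at hinner
    linarith
  have hupper : g (hproj e y) ≤ inner ℝ e x + K * ε :=
    calc g (hproj e y) ≤ g (hproj e x) + K * dist (hproj e y) (hproj e x) := by
          linarith [le_abs_self (g (hproj e y) - g (hproj e x)),
            Real.dist_eq _ _ ▸ h.lipschitz.dist_le_mul (hproj e y) (hproj e x)]
      _ ≤ inner ℝ e x + K * ε := by
          rw [← hproj_add_smul x t, dist_eq_norm, ← map_sub]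
          gcongr
          · rw [hproj_add_smul]; exact h.le_inner hx hxU
          · exact (Submodule.norm_orthogonalProjectionOnto_apply_le _ _).trans hxy
  have hmem : y ∈ Ω ∩ U := h.inter_eq ▸ ⟨hyU, by linarith⟩
  exact hmem.1

end IsLipschitzChart

end Chart

section Ray

theorem enorm_sq_eq_ofReal {F : Type*} [SeminormedAddCommGroup F] (a : F) :
    ‖a‖ₑ ^ 2 = ENNReal.ofReal (‖a‖ ^ 2) := by
  rw [ENNReal.ofReal_pow (norm_nonneg a), ofReal_norm]

theorem enorm_map_sq_le_sum {F : Type*} [NormedAddCommGroup F] [NormedSpace ℝ F]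
    (L : E d →L[ℝ] F) (v : E d) :
    ‖L v‖ₑ ^ 2 ≤ ‖v‖ₑ ^ 2 * ∑ i, ‖L (EuclideanSpace.single i 1)‖ₑ ^ 2 := by
  have hnorm : ‖L v‖ ≤ ∑ i, ‖v i‖ * ‖L (EuclideanSpace.single i 1)‖ := by
    have hv : v = ∑ i, v i • EuclideanSpace.single i (1 : ℝ) := by
      ext j
      simp [Finset.sum_apply, Pi.single_apply]
    conv_lhs => rw [hv, map_sum]
    exact (norm_sum_le _ _).trans_eq
      (Finset.sum_congr rfl fun i _ => by rw [map_smul, norm_smul])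
  simp only [enorm_sq_eq_ofReal]
  rw [← ENNReal.ofReal_sum_of_nonneg fun _ _ => sq_nonneg _, ← ENNReal.ofReal_mul (sq_nonneg _)]
  refine ENNReal.ofReal_le_ofReal ?_
  calc ‖L v‖ ^ 2 ≤ (∑ i, ‖v i‖ * ‖L (EuclideanSpace.single i 1)‖) ^ 2 := by gcongr
    _ ≤ (∑ i, ‖v i‖ ^ 2) * ∑ i, ‖L (EuclideanSpace.single i 1)‖ ^ 2 :=
        Finset.sum_mul_sq_le_sq_mul_sq _ _ _
    _ = _ := by rw [EuclideanSpace.norm_sq_eq]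

variable {F : Type*} [NormedAddCommGroup F] [InnerProductSpace ℝ F]

theorem norm_sq_le_integral_of_eq_zero {f f' : ℝ → F} {a b : ℝ} (hab : a ≤ b)
    (hf : ∀ s, HasDerivAt f (f' s) s) (hf' : Continuous f') (hb : f b = 0) :
    ‖f a‖ ^ 2 ≤ ∫ s in a..b, (‖f s‖ ^ 2 + ‖f' s‖ ^ 2) := by
  have hfc : Continuous f := continuous_iff_continuousAt.mpr fun s => (hf s).continuousAt
  have hcont : Continuous fun s => 2 * inner ℝ (f s) (f' s) := by fun_prop
  have hftc := intervalIntegral.integral_eq_sub_of_hasDerivAt (a := a) (b := b)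
    (fun s _ => (hf s).norm_sq) (hcont.intervalIntegrable a b)
  have heq : ‖f a‖ ^ 2 = ∫ s in a..b, -(2 * inner ℝ (f s) (f' s)) := by
    rw [intervalIntegral.integral_neg, hftc, hb]
    simp
  rw [heq]
  refine intervalIntegral.integral_mono_on hab (hcont.neg.intervalIntegrable a b)
    (((hfc.norm.pow 2).add (hf'.norm.pow 2)).intervalIntegrable a b) fun s _ => ?_
  linarith [neg_le_of_abs_le (abs_real_inner_le_norm (f s) (f' s)),
    two_mul_le_add_sq ‖f s‖ ‖f' s‖]

theorem enorm_sq_le_lintegral_of_eq_zero {f f' : ℝ → F} {a b : ℝ} (hab : a ≤ b)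
    (hf : ∀ s, HasDerivAt f (f' s) s) (hf' : Continuous f') (hb : f b = 0) :
    ‖f a‖ₑ ^ 2 ≤ ∫⁻ s in Ioc a b, (‖f s‖ₑ ^ 2 + ‖f' s‖ₑ ^ 2) := by
  have hfc : Continuous f := continuous_iff_continuousAt.mpr fun s => (hf s).continuousAt
  have hintegral : IntegrableOn (fun s => ‖f s‖ ^ 2 + ‖f' s‖ ^ 2) (Ioc a b) :=
    ((hfc.norm.pow 2).add (hf'.norm.pow 2)).integrableOn_Ioc
  simp only [enorm_sq_eq_ofReal, ← ENNReal.ofReal_add (sq_nonneg _) (sq_nonneg _)]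
  rw [← ofReal_integral_eq_lintegral_ofReal hintegral (Eventually.of_forall fun s => by positivity),
    ← intervalIntegral.integral_of_le hab]
  exact ENNReal.ofReal_le_ofReal (norm_sq_le_integral_of_eq_zero hab hf hf' hb)

end Ray

section Energy

/-- The integrand `|W|² + |∇W|²` of the squared `H¹`-norm of a differentiable function. -/
def energyDensity (W : E d → ℂ) (x : E d) : ℝ≥0∞ :=
  ‖W x‖ₑ ^ 2 + ∑ i, ‖fderiv ℝ W x (EuclideanSpace.single i 1)‖ₑ ^ 2

/-- The squared `H¹(Ω)`-norm of a differentiable function. -/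
def energy (Ω : Set (E d)) (W : E d → ℂ) : ℝ≥0∞ :=
  ∫⁻ x in Ω, energyDensity W x

variable {W : E d → ℂ}

theorem measurable_energyDensity (hW : ContDiff ℝ 1 W) : Measurable (energyDensity W) := by
  have hderiv : ∀ v, Continuous fun x => fderiv ℝ W x v := fun v =>
    (hW.continuous_fderiv one_ne_zero).clm_apply continuous_const
  exact (hW.continuous.measurable.enorm.pow_const 2).add
    (Finset.measurable_sum _ fun i _ => (hderiv _).measurable.enorm.pow_const 2)

theorem enorm_sq_le_lintegral_energyDensity (hW : ContDiff ℝ 1 W) {e : E d} (he : ‖e‖ = 1)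
    {x : E d} {R : ℝ} (hR : 0 ≤ R) (hend : W (x + R • e) = 0) :
    ‖W x‖ₑ ^ 2 ≤ ∫⁻ s in Ioc 0 R, energyDensity W (x + s • e) := by
  have hderiv : ∀ s, HasDerivAt (fun s : ℝ => W (x + s • e)) (fderiv ℝ W (x + s • e) e) s :=
    fun s => by
      have hline : HasDerivAt (fun s : ℝ => x + s • e) e s := by
        simpa only [one_smul, id] using! ((hasDerivAt_id s).smul_const e).const_add x
      exact (hW.differentiable one_ne_zero _).hasFDerivAt.comp_hasDerivAt s hline
  have hcont : Continuous fun s : ℝ => fderiv ℝ W (x + s • e) e :=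
    ((hW.continuous_fderiv one_ne_zero).comp (by fun_prop)).clm_apply continuous_const
  calc ‖W x‖ₑ ^ 2
      ≤ ∫⁻ s in Ioc 0 R, (‖W (x + s • e)‖ₑ ^ 2 + ‖fderiv ℝ W (x + s • e) e‖ₑ ^ 2) := by
        simpa only [zero_smul, add_zero] using
          enorm_sq_le_lintegral_of_eq_zero hR hderiv hcont hend
    _ ≤ _ := by
        refine lintegral_mono fun s => add_le_add le_rfl ?_
        have he' : ‖e‖ₑ = 1 := by rw [← ofReal_norm, he, ENNReal.ofReal_one]
        simpa only [he', one_pow, one_mul] using enorm_map_sq_le_sum (fderiv ℝ W (x + s • e)) e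

end Energy

namespace IsLipschitzChart

variable {U : Set (E d)} {e : E d} {K : ℝ≥0} {g : hyperplane e → ℝ}

theorem lintegral_surfaceMeasure_le (h : IsLipschitzChart Ω U e K g) (hΩ : IsOpen Ω)
    {f : E d → ℝ≥0∞} (hf : Measurable f) (hfU : ∀ x ∉ U, f x = 0) :
    ∫⁻ x, f x ∂(surfaceMeasure Ω) ≤ ((1 + K) ^ (d - 1) : ℝ≥0) *
      ∫⁻ z, (frontier Ω).indicator f (graphMap g z)
        ∂(Measure.euclideanHausdorffMeasure (d - 1)) := by
  have hfrontier : MeasurableSet (frontier Ω) := isClosed_frontier.measurableSet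
  have hgraph : Measurable (graphMap g) :=
    (lipschitzWith_graphMap h.norm_eq_one h.lipschitz).continuous.measurable
  have hindicator : (frontier Ω).indicator f = (frontier Ω ∩ U).indicator f := by
    rw [inter_comm, ← indicator_indicator, eq_comm, indicator_eq_self]
    intro x hx
    by_contra hxU
    exact hx (indicator_apply_eq_zero.mpr fun _ => hfU x hxU)
  calc ∫⁻ x, f x ∂(surfaceMeasure Ω)
      = ∫⁻ x, (frontier Ω).indicator f x
          ∂((Measure.euclideanHausdorffMeasure (d - 1)).restrict (frontier Ω ∩ U)) := by
        rw [surfaceMeasure, ← lintegral_indicator hfrontier, hindicator,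
          ← lintegral_indicator (hfrontier.inter h.isOpen.measurableSet),
          indicator_indicator, inter_self]
    _ ≤ ∫⁻ x, (frontier Ω).indicator f x ∂(((1 + K) ^ (d - 1) : ℝ≥0) •
          Measure.map (graphMap g) (Measure.euclideanHausdorffMeasure (d - 1))) :=
        lintegral_mono' (hausdorff_restrict_graph_le _ h.norm_eq_one h.lipschitz
          fun x hx => h.graphMap_hproj hΩ hx.1 hx.2) le_rfl
    _ = _ := by
        rw [lintegral_smul_measure, lintegral_map (hf.indicator hfrontier) hgraph,
          ENNReal.smul_def, smul_eq_mul]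

theorem enorm_sq_le_lintegral_line (h : IsLipschitzChart Ω U e K g) {x₀ : E d} {R : ℝ}
    (hRU : Metric.ball x₀ (4 * R) ⊆ U) {W : E d → ℂ} (hW : ContDiff ℝ 1 W)
    (hW₀ : ∀ x ∉ Metric.ball x₀ R, W x = 0) {x : E d} (hx : x ∈ closure Ω) :
    ‖W x‖ₑ ^ 2 ≤ ∫⁻ s : ℝ, Ω.indicator (energyDensity W) (x + s • e) := by
  by_cases hxR : x ∈ Metric.ball x₀ R
  swap
  · simp [hW₀ x hxR]
  have hR : 0 < R := Metric.pos_of_mem_ball hxR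
  rw [mem_ball_iff_norm] at hxR
  have hnorm : ∀ s : ℝ, 0 ≤ s → ‖s • e‖ = s := fun s hs => by
    rw [norm_smul, h.norm_eq_one, mul_one, Real.norm_of_nonneg hs]
  have hend : W (x + (2 * R) • e) = 0 := by
    refine hW₀ _ fun hmem => ?_
    rw [mem_ball_iff_norm, add_sub_right_comm] at hmem
    have htriangle := norm_sub_le (x - x₀ + (2 * R) • e) (x - x₀)
    rw [add_sub_cancel_left, hnorm _ (by positivity)] at htriangle
    linarith
  have hmem : ∀ s ∈ Ioc 0 (2 * R), x + s • e ∈ Ω := fun s hs => by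
    have hU : ∀ r, 0 ≤ r → r ≤ 2 * R → x + r • e ∈ U := fun r hr hrR => hRU <| by
      rw [mem_ball_iff_norm, add_sub_right_comm]
      linarith [norm_add_le (x - x₀) (r • e), hnorm r hr]
    exact h.mem_of_mem_closedBall_add_smul (ε := 0) (by simpa using hs.1) hx
      (by simpa using hU 0 le_rfl (by positivity)) (hU s hs.1.le hs.2) (by simp)
  calc ‖W x‖ₑ ^ 2 ≤ ∫⁻ s in Ioc 0 (2 * R), energyDensity W (x + s • e) :=
        enorm_sq_le_lintegral_energyDensity hW h.norm_eq_one (by positivity) hend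
    _ = ∫⁻ s in Ioc 0 (2 * R), Ω.indicator (energyDensity W) (x + s • e) :=
        setLIntegral_congr_fun measurableSet_Ioc fun s hs =>
          (indicator_of_mem (hmem s hs) _).symm
    _ ≤ _ := setLIntegral_le_lintegral _ _

theorem indicator_enorm_sq_graphMap_le (h : IsLipschitzChart Ω U e K g) {x₀ : E d} {R : ℝ}
    (hRU : Metric.ball x₀ (4 * R) ⊆ U) {W : E d → ℂ} (hW : ContDiff ℝ 1 W)
    (hW₀ : ∀ x ∉ Metric.ball x₀ R, W x = 0) (z : hyperplane e) :
    (frontier Ω).indicator (fun x => ‖W x‖ₑ ^ 2) (graphMap g z) ≤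
      ∫⁻ s : ℝ, Ω.indicator (energyDensity W) ((z : E d) + s • e) := by
  by_cases hz : graphMap g z ∈ frontier Ω
  · rw [indicator_of_mem hz, ← lintegral_add_left_eq_self
      (fun s : ℝ => Ω.indicator (energyDensity W) ((z : E d) + s • e)) (g z)]
    simpa only [graphMap, add_smul, add_assoc] using
      h.enorm_sq_le_lintegral_line hRU hW hW₀ (frontier_subset_closure hz)
  · rw [indicator_of_notMem hz]
    exact zero_le

theorem exists_lintegral_surfaceMeasure_le_energy (h : IsLipschitzChart Ω U e K g)
    (hΩ : IsOpen Ω) {x₀ : E d} {R : ℝ} (hRU : Metric.ball x₀ (4 * R) ⊆ U) :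
    ∃ C : ℝ≥0, ∀ W : E d → ℂ, ContDiff ℝ 1 W → (∀ x ∉ Metric.ball x₀ R, W x = 0) →
      ∫⁻ x, ‖W x‖ₑ ^ 2 ∂(surfaceMeasure Ω) ≤ C * energy Ω W := by
  have hν : (Measure.euclideanHausdorffMeasure (d - 1) :
      Measure (hyperplane e)).IsAddHaarMeasure := by
    rw [show d - 1 = Module.finrank ℝ (hyperplane e) by
      rw [finrank_hyperplane h.norm_eq_one, finrank_euclideanSpace_fin]]
    infer_instance
  obtain ⟨C, hC⟩ := exists_lintegral_lintegral_le h.norm_eq_one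
    (Measure.euclideanHausdorffMeasure (d - 1)) volume
  refine ⟨(1 + K) ^ (d - 1) * C, fun W hW hW₀ => ?_⟩
  set F := Ω.indicator (energyDensity W) with hF
  have hWU : ∀ x ∉ U, ‖W x‖ₑ ^ 2 = 0 := fun x hx => by
    have hxR : x ∉ Metric.ball x₀ R := fun hxR =>
      hx (hRU (Metric.ball_subset_ball (by linarith [Metric.pos_of_mem_ball hxR]) hxR))
    simp [hW₀ x hxR]
  calc ∫⁻ x, ‖W x‖ₑ ^ 2 ∂(surfaceMeasure Ω)
      ≤ ((1 + K) ^ (d - 1) : ℝ≥0) * ∫⁻ z : hyperplane e, (∫⁻ s : ℝ, F ((z : E d) + s • e))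
          ∂(Measure.euclideanHausdorffMeasure (d - 1)) :=
        (h.lintegral_surfaceMeasure_le hΩ (hW.continuous.measurable.enorm.pow_const 2) hWU).trans
          (mul_le_mul_right (lintegral_mono (h.indicator_enorm_sq_graphMap_le hRU hW hW₀)) _)
    _ ≤ ((1 + K) ^ (d - 1) : ℝ≥0) * (C * ∫⁻ y, F y) := by
        gcongr
        exact hC F ((measurable_energyDensity hW).indicator hΩ.measurableSet)
    _ = _ := by
        rw [hF, lintegral_indicator hΩ.measurableSet, energy, ENNReal.coe_mul, mul_assoc]

end IsLipschitzChart

section AdaptedMollifiers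

/-- Translated mollifiers adapted to the support of a cutoff function `χ`: on `Ω̄` they only see
values inside `Ω`, and a trace inequality holds for the mollified functions. -/
structure IsAdapted (Ω : Set (E d)) (χ : E d → ℝ) (φs : ℕ → ContDiffBump (0 : E d))
    (τs : ℕ → E d) (C : ℝ≥0) : Prop where
  tendsto_rOut : Tendsto (fun n => (φs n).rOut) atTop (𝓝 0)
  tendsto_shift : Tendsto τs atTop (𝓝 0)
  mem_of_mem_closedBall : ∀ n, ∀ x ∈ closure Ω, ∀ y ∈ tsupport χ,
    y ∈ Metric.closedBall (x + τs n) (φs n).rOut → y ∈ Ω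
  trace_le : ∀ n (f : E d → ℂ), LocallyIntegrable f volume → (∀ᵐ y, y ∉ tsupport χ → f y = 0) →
    ∫⁻ x, ‖mollify (φs n) (τs n) f x‖ₑ ^ 2 ∂(surfaceMeasure Ω) ≤
      C * energy Ω (mollify (φs n) (τs n) f)

theorem exists_contDiffBump_rOut_eq {G : Type*} (c : G) {ε : ℝ} (hε : 0 < ε) :
    ∃ φ : ContDiffBump c, φ.rOut = ε :=
  ⟨⟨ε / 2, ε, half_pos hε, half_lt_self hε⟩, rfl⟩

variable {x₀ : E d} {r : ℝ} {χ : E d → ℝ}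

theorem exists_isAdapted_of_ball_subset (hΩ : IsOpen Ω) (hr : 0 < r)
    (hball : Metric.ball x₀ (2 * r) ⊆ Ω) (hχ : tsupport χ ⊆ Metric.ball x₀ r) :
    ∃ φs τs C, IsAdapted Ω χ φs τs C := by
  obtain ⟨ε, -, hε, hε₀⟩ := exists_seq_strictAnti_tendsto' hr
  choose φs hφs using fun n => exists_contDiffBump_rOut_eq (0 : E d) (hε n).1
  refine ⟨φs, fun _ => 0, 0, by simpa only [hφs] using hε₀, tendsto_const_nhds, ?_, ?_⟩
  · exact fun n x _ y hy _ => hball (Metric.ball_subset_ball (by linarith) (hχ hy))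
  · intro n f _ hf
    have hzero : ∀ x ∈ frontier Ω, mollify (φs n) 0 f x = 0 := fun x hx =>
      mollify_eq_zero_of_notMem_ball (hf.mono fun y hy hyr => hy fun hyχ => hyr (hχ hyχ))
        (by rw [hφs, norm_zero]; linarith [(hε n).2])
        fun hxr => (hΩ.frontier_eq ▸ hx).2 (hball hxr)
    rw [surfaceMeasure, setLIntegral_congr_fun isClosed_frontier.measurableSet
      (g := fun _ => 0) fun x hx => by simp [hzero x hx]]
    simp

/-- The mollifiers are translated along `e` into `Ω`, by a distance that dominates their radius. -/
theorem IsLipschitzChart.exists_isAdapted {U : Set (E d)} {e : E d} {K : ℝ≥0}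
    {g : hyperplane e → ℝ} (h : IsLipschitzChart Ω U e K g) (hΩ : IsOpen Ω) (hr : 0 < r)
    (hball : Metric.ball x₀ (8 * r) ⊆ U) (hχ : tsupport χ ⊆ Metric.ball x₀ r) :
    ∃ φs τs C, IsAdapted Ω χ φs τs C := by
  obtain ⟨C, hC⟩ := h.exists_lintegral_surfaceMeasure_le_energy hΩ (x₀ := x₀) (R := 2 * r)
    (by convert hball using 2; ring)
  obtain ⟨t, -, ht, ht₀⟩ := exists_seq_strictAnti_tendsto' (half_pos hr)
  have hK : (0 : ℝ) < 2 * (1 + K) := by positivity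
  choose φs hφs using fun n => exists_contDiffBump_rOut_eq (0 : E d) (div_pos (ht n).1 hK)
  have hnorm : ∀ n, ‖t n • e‖ = t n := fun n => by
    rw [norm_smul, h.norm_eq_one, mul_one, Real.norm_of_nonneg (ht n).1.le]
  have hε : ∀ n, (1 + K) * (φs n).rOut = t n / 2 := fun n => by rw [hφs]; field_simp
  have hradius : ∀ n, r + (φs n).rOut + ‖t n • e‖ ≤ 2 * r := fun n => by
    have hle : (φs n).rOut ≤ (1 + K) * (φs n).rOut :=
      le_mul_of_one_le_left (φs n).rOut_pos.le (by simp)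
    linarith [hnorm n, hε n, (ht n).2]
  have hU : ∀ {R : ℝ}, R ≤ 8 * r → Metric.ball x₀ R ⊆ U := fun hR =>
    (Metric.ball_subset_ball hR).trans hball
  refine ⟨φs, fun n => t n • e, C, ?_, by simpa using ht₀.smul_const e, ?_, ?_⟩
  · simpa only [hφs, zero_div] using ht₀.div_const (2 * (1 + (K : ℝ)))
  · intro n x hx y hy hyx
    exact h.mem_of_mem_closedBall_add_smul (by linarith [hε n, (ht n).1]) hx
      (hU (by linarith) (mem_ball_of_mem_closedBall_add (hχ hy) hyx (hradius n)))
      (hU (by linarith) (hχ hy)) hyx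
  · intro n f hfl hf
    exact hC _ ((contDiff_mollify hfl).of_le (by simp)) fun x hx =>
      mollify_eq_zero_of_notMem_ball (hf.mono fun y hy hyr => hy fun hyχ => hyr (hχ hyχ))
        (hradius n) hx

theorem exists_ball_forall_isAdapted (hΩ : IsOpen Ω) (hL : HasLipschitzBoundary Ω)
    (hx₀ : x₀ ∈ closure Ω) :
    ∃ r > 0, ∀ χ : E d → ℝ, tsupport χ ⊆ Metric.ball x₀ r → ∃ φs τs C, IsAdapted Ω χ φs τs C := by
  by_cases hx : x₀ ∈ Ω
  · obtain ⟨ρ, hρ, hρΩ⟩ := Metric.isOpen_iff.mp hΩ x₀ hx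
    exact ⟨ρ / 2, half_pos hρ, fun χ =>
      exists_isAdapted_of_ball_subset hΩ (half_pos hρ) (by rwa [mul_div_cancel₀ _ two_ne_zero])⟩
  · obtain ⟨U, e, K, g, hU, hxU, he, hg, hΩU⟩ := hL x₀ (hΩ.frontier_eq ▸ ⟨hx₀, hx⟩)
    obtain ⟨ρ, hρ, hρU⟩ := Metric.isOpen_iff.mp hU x₀ hxU
    have hρ8 : 0 < ρ / 8 := by positivity
    exact ⟨ρ / 8, hρ8, fun χ => IsLipschitzChart.exists_isAdapted ⟨hU, he, hg, hΩU⟩ hΩ hρ8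
      (by rwa [mul_div_cancel₀ _ (by norm_num)])⟩

theorem exists_partition_isAdapted (hΩ : IsOpen Ω) (hb : Bornology.IsBounded Ω)
    (hL : HasLipschitzBoundary Ω) :
    ∃ (ι : Type) (_ : Fintype ι) (χ : ι → E d → ℝ), (∀ k, ContDiff ℝ ∞ (χ k)) ∧
      (∀ k, HasCompactSupport (χ k)) ∧ (∀ x ∈ closure Ω, ∑ k, χ k x = 1) ∧
      ∀ k, ∃ φs τs C, IsAdapted Ω (χ k) φs τs C := by
  choose! r hr hadapted using fun x hx => exists_ball_forall_isAdapted (x₀ := x) hΩ hL hx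
  obtain ⟨t, ht, hcover⟩ := hb.isCompact_closure.elim_nhds_subcover
    (fun x => Metric.ball x (r x)) fun x hx => Metric.ball_mem_nhds x (hr x hx)
  obtain ⟨χ, hχ⟩ := SmoothPartitionOfUnity.exists_isSubordinate (modelWithCornersSelf ℝ (E d))
    (isClosed_closure (s := Ω)) (fun k : t => Metric.ball k.1 (r k.1))
    (fun _ => Metric.isOpen_ball) fun x hx => by
      obtain ⟨y, hy, hxy⟩ := mem_iUnion₂.mp (hcover hx)
      exact mem_iUnion.mpr ⟨⟨y, hy⟩, hxy⟩
  refine ⟨t, inferInstance, fun k => χ k, fun k => contMDiff_iff_contDiff.mp (χ k).contMDiff,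
    fun k => ?_, fun x hx => ?_, fun k => hadapted k (ht k k.2) _ (hχ k)⟩
  · exact HasCompactSupport.of_support_subset_isCompact (isCompact_closedBall k.1 (r k))
      ((subset_tsupport _).trans ((hχ k).trans Metric.ball_subset_closedBall))
  · rw [← finsum_eq_sum_of_fintype, χ.sum_eq_one hx]

end AdaptedMollifiers

section TraceInequality

theorem ae_surfaceMeasure_mem_frontier : ∀ᵐ x ∂(surfaceMeasure Ω), x ∈ frontier Ω :=
  ae_restrict_mem isClosed_frontier.measurableSet

theorem enorm_sq_H1 (v : H1 Ω) : ‖v‖ₑ ^ 2 = ‖toL2 v‖ₑ ^ 2 + ∑ i, ‖grad v i‖ₑ ^ 2 := by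
  have hnorm : ‖v‖ ^ 2 = ‖toL2 v‖ ^ 2 + ∑ i, ‖grad v i‖ ^ 2 := by
    change ‖v.1‖ ^ 2 = _
    rw [WithLp.prod_norm_sq_eq_of_L2, PiLp.norm_sq_eq_of_L2]
    rfl
  simp only [enorm_sq_eq_ofReal]
  rw [hnorm, ENNReal.ofReal_add (sq_nonneg _) (Finset.sum_nonneg fun _ _ => sq_nonneg _),
    ENNReal.ofReal_sum_of_nonneg fun _ _ => sq_nonneg _]

theorem energy_eq_enorm_sq (v : H1 Ω) {W : E d → ℂ} (hW : toL2 v =ᵐ[volume.restrict Ω] W)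
    (hgrad : ∀ i, grad v i =ᵐ[volume.restrict Ω] fun x =>
      fderiv ℝ W x (EuclideanSpace.single i 1)) : energy Ω W = ‖v‖ₑ ^ 2 := by
  have hmeas : ∀ f : L2 Ω, AEMeasurable (fun x => ‖f x‖ₑ ^ 2) (volume.restrict Ω) := fun f =>
    (Lp.aestronglyMeasurable f).enorm.pow_const 2
  simp only [enorm_sq_H1, Lp.enorm_def, eLpNorm_two_sq]
  rw [← lintegral_finsetSum' _ fun i _ => hmeas (grad v i), ← lintegral_add_left' (hmeas _),
    energy]
  refine lintegral_congr_ae ?_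
  filter_upwards [hW, eventually_countable_forall.mpr hgrad] with x hWx hgradx
  simp only [energyDensity, hWx, hgradx]

theorem exists_continuous_eqOn.{u, v} {X : Type u} {Y : Type v} [TopologicalSpace X]
    [NormalSpace X] [TopologicalSpace Y] [TietzeExtension.{u, v} Y] {s : Set X} (hs : IsClosed s)
    {f : X → Y} (hf : ContinuousOn f s) : ∃ g : X → Y, Continuous g ∧ EqOn g f s := by
  obtain ⟨g, hg⟩ := ContinuousMap.exists_restrict_eq hs ⟨s.domRestrict f, hf.domRestrict⟩
  exact ⟨g, g.continuous, fun x hx => congrArg (fun k : C(s, Y) => k ⟨x, hx⟩) hg⟩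

variable {χ : E d → ℝ} {φs : ℕ → ContDiffBump (0 : E d)} {τs : ℕ → E d} {C : ℝ≥0}

theorem ae_indicator_cutoff_eq (hΩ : IsOpen Ω) (hχ : ContDiff ℝ ∞ χ) (hc : HasCompactSupport χ)
    (p : H1Ambient Ω) :
    Ω.indicator (cutoff hχ hc p).fst =ᵐ[volume] fun y => χ y • Ω.indicator p.fst y := by
  filter_upwards [(ae_restrict_iff' hΩ.measurableSet).mp (coeFn_mulL2 hχ.continuous hc p.fst)]
    with y hy
  by_cases hyΩ : y ∈ Ω
  · rw [indicator_of_mem hyΩ, indicator_of_mem hyΩ, cutoff_fst, hy hyΩ]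
  · rw [indicator_of_notMem hyΩ, indicator_of_notMem hyΩ, smul_zero]

namespace IsAdapted

variable {u : H1 Ω} {w : E d → ℂ}

theorem mollify_cutoff_eq (hA : IsAdapted Ω χ φs τs C) (hΩ : IsOpen Ω) (hχ : ContDiff ℝ ∞ χ)
    (hc : HasCompactSupport χ) (hw : toL2 u =ᵐ[volume.restrict Ω] w) (n : ℕ) {x : E d}
    (hx : x ∈ closure Ω) :
    mollify (φs n) (τs n) (Ω.indicator (cutoff hχ hc u.1).fst) x =
      mollify (φs n) (τs n) (fun y => χ y • w y) x := by
  refine mollify_congr x ?_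
  filter_upwards [ae_indicator_cutoff_eq hΩ hχ hc u.1,
    (ae_restrict_iff' hΩ.measurableSet).mp hw] with y hcut hwy hball
  rw [hcut]
  by_cases hyΩ : y ∈ Ω
  · rw [indicator_of_mem hyΩ, ← hwy hyΩ]
    rfl
  · have hyχ : y ∉ tsupport χ := fun hmem =>
      hyΩ (hA.mem_of_mem_closedBall n x hx y hmem (Metric.ball_subset_closedBall hball))
    rw [image_eq_zero_of_notMem_tsupport hyχ, zero_smul, zero_smul]

theorem tendsto_mollify_cutoff (hA : IsAdapted Ω χ φs τs C) (hΩ : IsOpen Ω)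
    (hχ : ContDiff ℝ ∞ χ) (hc : HasCompactSupport χ) (hw : IsContRep u w) {x : E d}
    (hx : x ∈ closure Ω) :
    Tendsto (fun n => mollify (φs n) (τs n) (Ω.indicator (cutoff hχ hc u.1).fst) x) atTop
      (𝓝 (χ x • w x)) := by
  obtain ⟨k, hk, hkw⟩ := exists_continuous_eqOn isClosed_closure hw.1
  have hrep : toL2 u =ᵐ[volume.restrict Ω] k := by
    filter_upwards [hw.2, ae_restrict_mem hΩ.measurableSet] with y hy hyΩ
    rw [hy, hkw (subset_closure hyΩ)]
  simp only [hA.mollify_cutoff_eq hΩ hχ hc hrep _ hx, ← hkw hx]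
  exact (tendstoUniformly_mollify hA.tendsto_rOut hA.tendsto_shift (hχ.continuous.smul hk)
    hc.smul_right).tendsto_at x

theorem eLpNorm_mollify_cutoff_le (hA : IsAdapted Ω χ φs τs C) (hΩ : IsOpen Ω)
    (hχ : ContDiff ℝ ∞ χ) (hc : HasCompactSupport χ) (p : H1Ambient Ω) {n : ℕ} {v : H1 Ω}
    (hv : toL2 v =ᵐ[volume.restrict Ω]
      mollify (φs n) (τs n) (Ω.indicator (cutoff hχ hc p).fst))
    (hgrad : ∀ i, grad v i =ᵐ[volume.restrict Ω] fun x =>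
      fderiv ℝ (mollify (φs n) (τs n) (Ω.indicator (cutoff hχ hc p).fst)) x
        (EuclideanSpace.single i 1)) :
    eLpNorm (mollify (φs n) (τs n) (Ω.indicator (cutoff hχ hc p).fst)) 2 (surfaceMeasure Ω) ≤
      NNReal.sqrt C * ‖v‖ₑ := by
  have hsupp : ∀ᵐ y, y ∉ tsupport χ → Ω.indicator (cutoff hχ hc p).fst y = 0 := by
    filter_upwards [ae_indicator_cutoff_eq hΩ hχ hc p] with y hy hyχ
    rw [hy, image_eq_zero_of_notMem_tsupport hyχ, zero_smul]
  have hle := hA.trace_le n _ (locallyIntegrable_indicator hΩ _) hsupp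
  rw [energy_eq_enorm_sq v hv hgrad, ← eLpNorm_two_sq] at hle
  refine (ENNReal.pow_le_pow_left_iff two_ne_zero).mp (hle.trans_eq ?_)
  rw [mul_pow, ← ENNReal.coe_pow, NNReal.sq_sqrt]

theorem eLpNorm_smul_le (hA : IsAdapted Ω χ φs τs C) (hΩ : IsOpen Ω)
    (hb : Bornology.IsBounded Ω) (hχ : ContDiff ℝ ∞ χ) (hc : HasCompactSupport χ)
    (hw : IsContRep u w) :
    eLpNorm (fun x => χ x • w x) 2 (surfaceMeasure Ω) ≤
      NNReal.sqrt C * ‖(cutoff hχ hc : H1Ambient Ω →L[ℂ] H1Ambient Ω)‖ₑ * ‖u‖ₑ := by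
  obtain ⟨v, hv, hgrad, hlim⟩ := exists_tendsto_cutoff hΩ hb hχ hc hA.tendsto_rOut
    hA.tendsto_shift (fun n x hx => hA.mem_of_mem_closedBall n x (subset_closure hx)) u
  have hbound : Tendsto (fun n => (NNReal.sqrt C : ℝ≥0∞) * ‖v n‖ₑ) atTop
      (𝓝 (NNReal.sqrt C * ‖cutoff hχ hc u.1‖ₑ)) :=
    ENNReal.Tendsto.const_mul hlim.enorm (Or.inr ENNReal.coe_ne_top)
  calc eLpNorm (fun x => χ x • w x) 2 (surfaceMeasure Ω)
      ≤ liminf (fun n => eLpNorm (mollify (φs n) (τs n) (Ω.indicator (cutoff hχ hc u.1).fst)) 2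
          (surfaceMeasure Ω)) atTop :=
        Lp.eLpNorm_lim_le_liminf_eLpNorm
          (fun n => (contDiff_mollify
            (locallyIntegrable_indicator hΩ _)).continuous.aestronglyMeasurable) _
          (ae_surfaceMeasure_mem_frontier.mono fun x hx =>
            hA.tendsto_mollify_cutoff hΩ hχ hc hw (frontier_subset_closure hx))
    _ ≤ liminf (fun n => (NNReal.sqrt C : ℝ≥0∞) * ‖v n‖ₑ) atTop :=
        liminf_le_liminf (Eventually.of_forall fun n =>
          hA.eLpNorm_mollify_cutoff_le hΩ hχ hc u.1 (hv n) (hgrad n))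
    _ = NNReal.sqrt C * ‖cutoff hχ hc u.1‖ₑ := hbound.liminf_eq
    _ ≤ _ := by
        rw [mul_assoc]
        gcongr
        exact ContinuousLinearMap.le_opENorm _ _

end IsAdapted

theorem IsContRep.aestronglyMeasurable {u : H1 Ω} {w : E d → ℂ} (hw : IsContRep u w) :
    AEStronglyMeasurable w (surfaceMeasure Ω) :=
  (hw.1.mono frontier_subset_closure).aestronglyMeasurable isClosed_frontier.measurableSet

/-- The trace inequality `‖w|_Γ‖ ≤ C ‖u‖` for all `u ∈ C(Ω̄) ∩ H¹(Ω)`, with continuous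
representative `w`. -/
def HasTraceBound (Ω : Set (E d)) (C : ℝ≥0) : Prop :=
  ∀ (u : H1 Ω) (w : E d → ℂ), IsContRep u w → eLpNorm w 2 (surfaceMeasure Ω) ≤ C * ‖u‖ₑ

theorem exists_hasTraceBound (hΩ : IsOpen Ω) (hb : Bornology.IsBounded Ω)
    (hL : HasLipschitzBoundary Ω) : ∃ C, HasTraceBound Ω C := by
  obtain ⟨ι, _, χ, hχ, hc, hsum, hA⟩ := exists_partition_isAdapted hΩ hb hL
  choose φs τs C hA using hA
  refine ⟨∑ k, NNReal.sqrt (C k) *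
    ‖(cutoff (hχ k) (hc k) : H1Ambient Ω →L[ℂ] H1Ambient Ω)‖₊, fun u w hw => ?_⟩
  calc eLpNorm w 2 (surfaceMeasure Ω)
      = eLpNorm (∑ k, fun x => χ k x • w x) 2 (surfaceMeasure Ω) := by
        refine eLpNorm_congr_ae (ae_surfaceMeasure_mem_frontier.mono fun x hx => ?_)
        rw [Finset.sum_apply, ← Finset.sum_smul, hsum x (frontier_subset_closure hx), one_smul]
    _ ≤ ∑ k, eLpNorm (fun x => χ k x • w x) 2 (surfaceMeasure Ω) :=
        eLpNorm_sum_le (fun k _ =>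
          (hχ k).continuous.aestronglyMeasurable.smul hw.aestronglyMeasurable) (by norm_num)
    _ ≤ ∑ k, NNReal.sqrt (C k) *
          ‖(cutoff (hχ k) (hc k) : H1Ambient Ω →L[ℂ] H1Ambient Ω)‖ₑ * ‖u‖ₑ :=
        Finset.sum_le_sum fun k _ => (hA k).eLpNorm_smul_le hΩ hb (hχ k) (hc k) hw
    _ = _ := by
        push_cast
        rw [Finset.sum_mul]
        rfl

end TraceInequality

section Density

theorem toL2_sum {ι : Type*} (s : Finset ι) (v : ι → H1 Ω) :
    toL2 (∑ k ∈ s, v k) = ∑ k ∈ s, toL2 (v k) :=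
  map_sum (WithLp.fstL 2 ℂ (L2 Ω) (PiLp 2 fun _ : Fin d => L2 Ω) ∘L (H1 Ω).subtypeL) v s

variable {ι : Type*} [Fintype ι]

theorem coeFn_sum_mulL2 {η : ι → E d → ℝ} (hη : ∀ k, Continuous (η k))
    (hc : ∀ k, HasCompactSupport (η k)) (f : L2 Ω) :
    (∑ k, mulL2 (hη k) (hc k) f : L2 Ω) =ᵐ[volume.restrict Ω] fun x => (∑ k, η k x) • f x := by
  filter_upwards [Lp.coeFn_finsetSum Finset.univ (fun k => mulL2 (hη k) (hc k) f),
    eventually_countable_forall.mpr fun k => coeFn_mulL2 (hη k) (hc k) f] with x hsum hmul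
  rw [hsum, Finset.sum_apply, Finset.sum_smul]
  exact Finset.sum_congr rfl fun k _ => hmul k

theorem sum_mulL2_eq_smul (hΩ : IsOpen Ω) {η : ι → E d → ℝ} (hη : ∀ k, Continuous (η k))
    (hc : ∀ k, HasCompactSupport (η k)) {c : ℝ} (hsum : ∀ x ∈ Ω, ∑ k, η k x = c) (f : L2 Ω) :
    ∑ k, mulL2 (hη k) (hc k) f = c • f := by
  refine Lp.ext ?_
  filter_upwards [coeFn_sum_mulL2 hη hc f, Lp.coeFn_smul c f, ae_restrict_mem hΩ.measurableSet]
    with x hmul hsmul hx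
  rw [hmul, hsmul, hsum x hx, Pi.smul_apply]

variable {χ : ι → E d → ℝ}

theorem sum_partialDeriv_eq_zero (hΩ : IsOpen Ω) (hχ : ∀ k, Differentiable ℝ (χ k)) {c : ℝ}
    (hsum : ∀ x ∈ Ω, ∑ k, χ k x = c) (i : Fin d) {x : E d} (hx : x ∈ Ω) :
    ∑ k, partialDeriv i (χ k) x = 0 := by
  have hconst : (fun y => ∑ k, χ k y) =ᶠ[𝓝 x] fun _ => c :=
    mem_of_superset (hΩ.mem_nhds hx) hsum
  have hfderiv : ∑ k, fderiv ℝ (χ k) x = 0 := by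
    rw [← fderiv_fun_sum fun k _ => hχ k x, hconst.fderiv_eq, fderiv_const_apply]
  simpa [partialDeriv] using DFunLike.congr_fun hfderiv (EuclideanSpace.single i 1)

theorem sum_cutoff (hΩ : IsOpen Ω) (hχ : ∀ k, ContDiff ℝ ∞ (χ k))
    (hc : ∀ k, HasCompactSupport (χ k)) (hsum : ∀ x ∈ Ω, ∑ k, χ k x = 1) (p : H1Ambient Ω) :
    ∑ k, cutoff (hχ k) (hc k) p = p := by
  have hone : ∀ f : L2 Ω, ∑ k, mulL2 (hχ k).continuous (hc k) f = f := fun f => by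
    rw [sum_mulL2_eq_smul hΩ _ hc hsum, one_smul]
  have hfst : (∑ k, cutoff (hχ k) (hc k) p).fst = p.fst :=
    (map_sum (WithLp.fstL 2 ℂ (L2 Ω) (PiLp 2 fun _ : Fin d => L2 Ω)) _ _).trans (hone p.fst)
  have hsnd : ∀ i, (∑ k, cutoff (hχ k) (hc k) p).snd i = p.snd i := fun i => by
    have hzero : ∑ k, mulL2 (continuous_partialDeriv (hχ k) i)
        (hasCompactSupport_partialDeriv (hc k) i) p.fst = 0 := by
      rw [sum_mulL2_eq_smul hΩ _ _ (fun x => sum_partialDeriv_eq_zero hΩ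
        (fun k => (hχ k).differentiable (by simp)) hsum i), zero_smul]
    refine (map_sum (PiLp.proj 2 (fun _ : Fin d => L2 Ω) i ∘L
      WithLp.sndL 2 ℂ (L2 Ω) (PiLp 2 fun _ : Fin d => L2 Ω)) _ _).trans ?_
    exact (Finset.sum_add_distrib (f := fun k => mulL2 (hχ k).continuous (hc k) (p.snd i))).trans
      ((congrArg₂ (· + ·) (hone (p.snd i)) hzero).trans (add_zero _))
  exact WithLp.ofLp_injective 2 (Prod.ext hfst (PiLp.ext hsnd))

theorem exists_tendsto_contRep (hΩ : IsOpen Ω) (hb : Bornology.IsBounded Ω)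
    (hL : HasLipschitzBoundary Ω) (u : H1 Ω) :
    ∃ (v : ℕ → H1 Ω) (w : ℕ → E d → ℂ), (∀ n, IsContRep (v n) (w n)) ∧
      Tendsto v atTop (𝓝 u) := by
  obtain ⟨ι, _, χ, hχ, hc, hsum, hA⟩ := exists_partition_isAdapted hΩ hb hL
  choose φs τs C hA using hA
  choose v hv _ hlim using fun k => exists_tendsto_cutoff hΩ hb (hχ k) (hc k)
    (hA k).tendsto_rOut (hA k).tendsto_shift
    (fun n x hx => (hA k).mem_of_mem_closedBall n x (subset_closure hx)) u
  refine ⟨fun n => ∑ k, v k n, fun n x => ∑ k, mollify (φs k n) (τs k n)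
    (Ω.indicator (cutoff (hχ k) (hc k) u.1).fst) x, fun n => ⟨?_, ?_⟩, ?_⟩
  · exact (continuous_finsetSum _ fun k _ =>
      (contDiff_mollify (locallyIntegrable_indicator hΩ _)).continuous).continuousOn
  · rw [toL2_sum]
    filter_upwards [Lp.coeFn_finsetSum Finset.univ (fun k => toL2 (v k n)),
      eventually_countable_forall.mpr fun k => hv k n] with x hsum_apply hvx
    rw [hsum_apply, Finset.sum_apply]
    exact Finset.sum_congr rfl fun k _ => hvx k
  · rw [tendsto_subtype_rng, ← sum_cutoff hΩ hχ hc (fun x hx => hsum x (subset_closure hx)) u.1]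
    simpa only [AddSubmonoidClass.coe_finsetSum] using
      tendsto_finsetSum Finset.univ fun k _ => hlim k

end Density

section Trace

variable {u v : H1 Ω} {w k : E d → ℂ} {φ ψ : L2Bdry Ω}

theorem IsContRep.add (hu : IsContRep u w) (hv : IsContRep v k) : IsContRep (u + v) (w + k) :=
  ⟨hu.1.add hv.1, (Lp.coeFn_add (toL2 u) (toL2 v)).trans (hu.2.add hv.2)⟩

theorem IsContRep.const_smul (c : ℂ) (hu : IsContRep u w) : IsContRep (c • u) (c • w) :=
  ⟨hu.1.const_smul c, (Lp.coeFn_smul c (toL2 u)).trans (hu.2.const_smul c)⟩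

theorem IsContRep.sub (hu : IsContRep u w) (hv : IsContRep v k) : IsContRep (u - v) (w - k) := by
  simpa [sub_eq_add_neg] using hu.add (hv.const_smul (-1))

theorem IsTrace.add (hu : IsTrace u φ) (hv : IsTrace v ψ) : IsTrace (u + v) (φ + ψ) := by
  obtain ⟨a, w, haw, ha, hw⟩ := hu
  obtain ⟨b, k, hbk, hb, hk⟩ := hv
  refine ⟨a + b, w + k, fun n => (haw n).add (hbk n), ha.add hb, ?_⟩
  refine tendsto_of_tendsto_of_tendsto_of_le_of_le tendsto_const_nhds
    ((hw.add hk).trans_eq (by rw [add_zero])) (fun _ => zero_le) fun n => ?_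
  have hsub : (fun x => (w + k) n x - (φ + ψ : L2Bdry Ω) x) =ᵐ[surfaceMeasure Ω]
      (fun x => w n x - φ x) + fun x => k n x - ψ x := by
    filter_upwards [Lp.coeFn_add φ ψ] with x hx
    rw [hx]
    exact add_sub_add_comm _ _ _ _
  calc eLpNorm (fun x => (w + k) n x - (φ + ψ : L2Bdry Ω) x) 2 (surfaceMeasure Ω)
      = eLpNorm ((fun x => w n x - φ x) + fun x => k n x - ψ x) 2 (surfaceMeasure Ω) :=
        eLpNorm_congr_ae hsub
    _ ≤ eLpNorm (fun x => w n x - φ x) 2 (surfaceMeasure Ω) +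
          eLpNorm (fun x => k n x - ψ x) 2 (surfaceMeasure Ω) :=
        eLpNorm_add_le ((haw n).aestronglyMeasurable.sub (Lp.aestronglyMeasurable φ))
          ((hbk n).aestronglyMeasurable.sub (Lp.aestronglyMeasurable ψ)) (by norm_num)

theorem IsTrace.const_smul (c : ℂ) (hu : IsTrace u φ) : IsTrace (c • u) (c • φ) := by
  obtain ⟨a, w, haw, ha, hw⟩ := hu
  refine ⟨c • a, c • w, fun n => (haw n).const_smul c, ha.const_smul c, ?_⟩
  have hlim := ENNReal.Tendsto.const_mul hw (Or.inr (enorm_ne_top (x := c)))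
  rw [mul_zero] at hlim
  refine hlim.congr fun n => ?_
  rw [← eLpNorm_const_smul]
  refine eLpNorm_congr_ae ?_
  filter_upwards [Lp.coeFn_smul c φ] with x hx
  rw [hx]
  exact smul_sub c (w n x) (φ x)

theorem IsTrace.sub (hu : IsTrace u φ) (hv : IsTrace v ψ) : IsTrace (u - v) (φ - ψ) := by
  simpa [sub_eq_add_neg] using hu.add (hv.const_smul (-1))

variable {C : ℝ≥0}

namespace HasTraceBound

theorem memLp (hC : HasTraceBound Ω C) (hu : IsContRep u w) : MemLp w 2 (surfaceMeasure Ω) :=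
  ⟨hu.aestronglyMeasurable, (hC u w hu).trans_lt
    (ENNReal.mul_lt_top ENNReal.coe_lt_top enorm_lt_top)⟩

theorem enorm_trace_le (hC : HasTraceBound Ω C) (hu : IsTrace u φ) : ‖φ‖ₑ ≤ C * ‖u‖ₑ := by
  obtain ⟨a, w, haw, ha, hw⟩ := hu
  have hlim := (ENNReal.Tendsto.const_mul ha.enorm (Or.inr (ENNReal.coe_ne_top (r := C)))).add hw
  rw [add_zero] at hlim
  refine ge_of_tendsto hlim (Eventually.of_forall fun n => ?_)
  have hmeas := (haw n).aestronglyMeasurable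
  calc ‖φ‖ₑ = eLpNorm (w n - fun x => w n x - φ x) 2 (surfaceMeasure Ω) := by
        rw [Lp.enorm_def]
        exact congrArg (eLpNorm · 2 _) (sub_sub_cancel (w n) φ).symm
    _ ≤ eLpNorm (w n) 2 (surfaceMeasure Ω) +
          eLpNorm (fun x => w n x - φ x) 2 (surfaceMeasure Ω) :=
        eLpNorm_sub_le hmeas (hmeas.sub (Lp.aestronglyMeasurable φ)) (by norm_num)
    _ ≤ C * ‖a n‖ₑ + eLpNorm (fun x => w n x - φ x) 2 (surfaceMeasure Ω) := by
        gcongr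
        exact hC _ _ (haw n)

theorem trace_unique (hC : HasTraceBound Ω C) (hφ : IsTrace u φ) (hψ : IsTrace u ψ) : φ = ψ := by
  have hle := hC.enorm_trace_le (hφ.sub hψ)
  have hzero : ‖(0 : H1 Ω)‖ₑ = 0 := enorm_eq_zero.mpr rfl
  rwa [sub_self, hzero, mul_zero, nonpos_iff_eq_zero, enorm_eq_zero, sub_eq_zero] at hle

theorem edist_toLp_le (hC : HasTraceBound Ω C) (hu : IsContRep u w) (hv : IsContRep v k) :
    edist ((hC.memLp hu).toLp w) ((hC.memLp hv).toLp k) ≤ C * edist u v := by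
  rw [Lp.edist_toLp_toLp, edist_eq_enorm_sub u v]
  exact hC _ _ (hu.sub hv)

theorem cauchySeq_toLp (hC : HasTraceBound Ω C) {v : ℕ → H1 Ω} {w : ℕ → E d → ℂ}
    (hvw : ∀ n, IsContRep (v n) (w n)) (hv : CauchySeq v) :
    CauchySeq fun n => (hC.memLp (hvw n)).toLp (w n) := by
  rw [cauchySeq_iff_tendsto_dist_atTop_0] at hv ⊢
  have hlim := hv.const_mul (C : ℝ)
  rw [mul_zero] at hlim
  refine squeeze_zero (fun _ => dist_nonneg) (fun n => ?_) hlim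
  have hle := hC.edist_toLp_le (hvw n.1) (hvw n.2)
  simp only [edist_nndist] at hle
  exact_mod_cast hle

theorem exists_isTrace (hC : HasTraceBound Ω C) (hΩ : IsOpen Ω) (hb : Bornology.IsBounded Ω)
    (hL : HasLipschitzBoundary Ω) (u : H1 Ω) : ∃ φ : L2Bdry Ω, IsTrace u φ := by
  obtain ⟨v, w, hvw, hv⟩ := exists_tendsto_contRep hΩ hb hL u
  obtain ⟨φ, hφ⟩ := cauchySeq_tendsto_of_complete (hC.cauchySeq_toLp hvw hv.cauchySeq)
  refine ⟨φ, v, w, hvw, hv, ((Lp.tendsto_Lp_iff_tendsto_eLpNorm' _ _).mp hφ).congr fun n => ?_⟩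
  exact eLpNorm_congr_ae ((hC.memLp (hvw n)).coeFn_toLp.sub .rfl)

end HasTraceBound

theorem IsContRep.isTrace (hu : IsContRep u w) (hw : MemLp w 2 (surfaceMeasure Ω)) :
    IsTrace u (hw.toLp w) := by
  refine ⟨fun _ => u, fun _ => w, fun _ => hu, tendsto_const_nhds, ?_⟩
  have hzero : eLpNorm (fun x => w x - hw.toLp w x) 2 (surfaceMeasure Ω) = 0 :=
    (eLpNorm_congr_ae hw.coeFn_toLp.symm.sub_eq).trans eLpNorm_zero
  exact tendsto_const_nhds.congr fun _ => hzero.symm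

/-- `tr` is the trace operator `u ↦ u_Γ`. -/
def IsTraceOperator (tr : H1 Ω →L[ℂ] L2Bdry Ω) : Prop :=
  ∀ u φ, IsTrace u φ ↔ φ = tr u

theorem IsTraceOperator.existsUnique_isTrace {tr : H1 Ω →L[ℂ] L2Bdry Ω} (htr : IsTraceOperator tr)
    (u : H1 Ω) : ∃! φ, IsTrace u φ :=
  ⟨tr u, (htr u _).mpr rfl, fun φ hφ => (htr u φ).mp hφ⟩

theorem exists_isTraceOperator (hΩ : IsOpen Ω) (hb : Bornology.IsBounded Ω)
    (hL : HasLipschitzBoundary Ω) : ∃ tr : H1 Ω →L[ℂ] L2Bdry Ω, IsTraceOperator tr := by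
  obtain ⟨C, hC⟩ := exists_hasTraceBound hΩ hb hL
  choose t ht using hC.exists_isTrace hΩ hb hL
  let tr : H1 Ω →ₗ[ℂ] L2Bdry Ω :=
    { toFun := t
      map_add' := fun u v => hC.trace_unique (ht _) ((ht u).add (ht v))
      map_smul' := fun c u => hC.trace_unique (ht _) ((ht u).const_smul c) }
  refine ⟨tr.mkContinuous C fun u => ?_, fun u φ =>
    ⟨fun hφ => hC.trace_unique hφ (ht u), fun hφ => hφ ▸ ht u⟩⟩
  have hle := hC.enorm_trace_le (ht u)
  simp only [enorm_eq_nnnorm] at hle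
  exact_mod_cast hle

theorem IsTraceOperator.coeFn_eq {tr : H1 Ω →L[ℂ] L2Bdry Ω} (htr : IsTraceOperator tr)
    (hw : IsContRep u w) (hmem : MemLp w 2 (surfaceMeasure Ω)) : tr u =ᵐ[surfaceMeasure Ω] w := by
  rw [← (htr u _).mp (hw.isTrace hmem)]
  exact hmem.coeFn_toLp

end Trace

section WeakLaplacian

theorem IsTestFunction.partialDeriv {φ : E d → ℝ} (hφ : IsTestFunction Ω φ) (i : Fin d) :
    IsTestFunction Ω (partialDeriv i φ) where
  contDiff := (hφ.contDiff.fderiv_right (m := ∞) (by simp)).clm_apply contDiff_const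
  hasCompactSupport := hasCompactSupport_partialDeriv hφ.hasCompactSupport i
  tsupport_subset := hφ.tsupport_partialDeriv_subset i

theorem laplacian_eq_sum_partialDeriv {φ : E d → ℝ} (hφ : ContDiff ℝ 2 φ) (x : E d) :
    Laplacian.laplacian φ x = ∑ i, partialDeriv i (partialDeriv i φ) x := by
  rw [InnerProductSpace.laplacian_eq_iteratedFDeriv_orthonormalBasis φ
    (EuclideanSpace.basisFun (Fin d) ℝ)]
  refine Finset.sum_congr rfl fun i _ => ?_
  have hdiff : DifferentiableAt ℝ (fderiv ℝ φ) x :=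
    (hφ.fderiv_right (m := 1) le_rfl).differentiable one_ne_zero x
  change _ = fderiv ℝ (fun y => fderiv ℝ φ y (EuclideanSpace.single i 1)) x _
  rw [iteratedFDeriv_two_apply, fderiv_clm_apply hdiff (differentiableAt_const _)]
  simp

theorem integral_laplacian_smul {φ : E d → ℝ} (hφ : IsTestFunction Ω φ) (u : H1 Ω) :
    ∫ x in Ω, Laplacian.laplacian φ x • toL2 u x =
      -∑ i, ∫ x in Ω, partialDeriv i φ x • grad u i x := by
  have hφ₂ : ContDiff ℝ 2 φ := contDiff_infty.mp hφ.contDiff 2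
  simp only [laplacian_eq_sum_partialDeriv hφ₂, Finset.sum_smul]
  rw [integral_finsetSum _ fun i _ => (hφ.partialDeriv i).integrable_partialDeriv_smul i _,
    ← Finset.sum_neg_distrib]
  exact Finset.sum_congr rfl fun i _ => isWeakPartialDeriv_grad u i _ (hφ.partialDeriv i)

theorem IsLaplacian.unique (hΩ : IsOpen Ω) {u : H1 Ω} {f g : L2 Ω} (hf : IsLaplacian u f)
    (hg : IsLaplacian u g) : f = g :=
  L2_ext_of_test hΩ fun φ hφ => (hf φ hφ).symm.trans (hg φ hφ)

theorem integral_mul_star {α : Type*} [MeasurableSpace α] {μ : Measure α} (f g : Lp ℂ 2 μ) :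
    ∫ x, f x * star (g x) ∂μ = inner ℂ g f :=
  L2.inner_def g f |>.symm

theorem integral_smul_eq_inner {α : Type*} [MeasurableSpace α] {μ : Measure α} {η : α → ℝ}
    {g : Lp ℂ 2 μ} (hg : g =ᵐ[μ] fun x => (η x : ℂ)) (f : Lp ℂ 2 μ) :
    ∫ x, η x • f x ∂μ = inner ℂ g f := by
  rw [← integral_mul_star]
  refine integral_congr_ae ?_
  filter_upwards [hg] with x hx
  rw [hx, Complex.star_def, Complex.conj_ofReal, mul_comm, Complex.real_smul]

theorem IsTestFunction.exists_H1 (hb : Bornology.IsBounded Ω) {φ : E d → ℝ}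
    (hφ : IsTestFunction Ω φ) : ∃ v : H1 Ω, toL2 v =ᵐ[volume.restrict Ω] (fun x => (φ x : ℂ)) ∧
      ∀ i, grad v i =ᵐ[volume.restrict Ω] fun x => (Wentzell.partialDeriv i φ x : ℂ) := by
  obtain ⟨v, hv, hgrad⟩ := exists_H1_of_contDiff (Ω := Ω) hb (w := fun x => (φ x : ℂ))
    (Complex.ofRealCLM.contDiff.comp (hφ.contDiff.of_le (by simp)))
  refine ⟨v, hv, fun i => (hgrad i).trans (.of_forall fun x => ?_)⟩
  have hderiv : HasFDerivAt (fun x => (φ x : ℂ)) (Complex.ofRealCLM ∘L fderiv ℝ φ x) x :=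
    Complex.ofRealCLM.hasFDerivAt.comp x (hφ.contDiff.differentiable (by simp) x).hasFDerivAt
  change fderiv ℝ (fun x => (φ x : ℂ)) x _ = _
  rw [hderiv.fderiv]
  rfl

end WeakLaplacian

section WentzellForm

theorem inner_H1 (u v : H1 Ω) :
    inner ℂ v u = inner ℂ (toL2 v) (toL2 u) + ∑ i, inner ℂ (grad v i) (grad u i) := by
  change inner ℂ (v : H1Ambient Ω) (u : H1Ambient Ω) = _
  rw [WithLp.prod_inner_apply, PiLp.inner_apply]
  rfl

theorem integral_sum_grad (u v : H1 Ω) :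
    ∫ x in Ω, ∑ i, grad u i x * star (grad v i x) = ∑ i, inner ℂ (grad v i) (grad u i) :=
  (integral_finsetSum _ fun i _ => L2.integrable_inner (𝕜 := ℂ) (grad v i) (grad u i)).trans
    (Finset.sum_congr rfl fun _ _ => integral_mul_star _ _)

theorem continuous_toL2 : Continuous (toL2 : H1 Ω → L2 Ω) :=
  continuous_fst_ambient.comp continuous_subtype_val

theorem continuous_grad (i : Fin d) : Continuous fun u : H1 Ω => grad u i :=
  (continuous_snd_ambient i).comp continuous_subtype_val

/-- Multiplication by `β ∈ L^∞(Γ)` on `L²(Γ)`. -/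
def mulBdry (β : LInfBdry Ω) : L2Bdry Ω →L[ℂ] L2Bdry Ω :=
  (ContinuousLinearMap.mul ℂ ℂ).holderL (surfaceMeasure Ω) ⊤ 2 2 β

theorem coeFn_mulBdry (β : LInfBdry Ω) (φ : L2Bdry Ω) :
    mulBdry β φ =ᵐ[surfaceMeasure Ω] fun x => β x * φ x :=
  (ContinuousLinearMap.mul ℂ ℂ).coeFn_holder (r := 2) β φ

theorem eq_neg_mulBdry_sub_iff (β : LInfBdry Ω) (h φ ψ : L2Bdry Ω) :
    h = -mulBdry β φ - ψ ↔ ∀ᵐ x ∂(surfaceMeasure Ω), h x + β x * φ x + ψ x = 0 := by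
  have hcoe : (-mulBdry β φ - ψ : L2Bdry Ω) =ᵐ[surfaceMeasure Ω]
      fun x => -(β x * φ x) - ψ x :=
    (Lp.coeFn_sub _ _).trans (((Lp.coeFn_neg _).trans (coeFn_mulBdry β φ).neg).sub .rfl)
  rw [Lp.ext_iff]
  refine ⟨fun hh => ?_, fun hh => ?_⟩ <;> filter_upwards [hh, hcoe] with x hx hcoex
  · rw [hx, hcoex]
    ring
  · rw [hcoex]
    linear_combination hx

variable (tr : H1 Ω →L[ℂ] L2Bdry Ω)

/-- The embedding `u ↦ (u, u_Γ)` of `H¹(Ω)` into `L²(Ω) × L²(Γ)`. -/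
def traceEmbedding : H1 Ω →L[ℂ] WithLp 2 (L2 Ω × L2Bdry Ω) :=
  (WithLp.prodContinuousLinearEquiv 2 ℂ _ _).symm.toContinuousLinearMap ∘L
    ((WithLp.fstL 2 ℂ _ _ ∘L (H1 Ω).subtypeL).prod tr)

/-- The bounded operator `(f, φ) ↦ (-f, βφ)` on `L²(Ω) × L²(Γ)`. -/
def robinPerturbation (β : LInfBdry Ω) :
    WithLp 2 (L2 Ω × L2Bdry Ω) →L[ℂ] WithLp 2 (L2 Ω × L2Bdry Ω) :=
  (WithLp.prodContinuousLinearEquiv 2 ℂ _ _).symm.toContinuousLinearMap ∘L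
    ((-WithLp.fstL 2 ℂ _ _).prod (mulBdry β ∘L WithLp.sndL 2 ℂ _ _))

theorem traceEmbedding_apply (u : H1 Ω) :
    traceEmbedding tr u = WithLp.toLp 2 (toL2 u, tr u) := rfl

theorem robinPerturbation_apply (β : LInfBdry Ω) (f : L2 Ω) (φ : L2Bdry Ω) :
    robinPerturbation β (WithLp.toLp 2 (f, φ)) = WithLp.toLp 2 (-f, mulBdry β φ) := rfl

theorem traceEmbedding_injective (hΩ : IsOpen Ω) : Function.Injective (traceEmbedding tr) :=
  fun _ _ h => toL2_injective hΩ (Prod.ext_iff.mp (WithLp.toLp_injective 2 h)).1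

/-- Green's identity `∫ f v̄ + ∫ ∇u · ∇v̄ = ∫ h v̄_Γ` for all `v ∈ H¹(Ω)`, where `v_Γ = tr v`. -/
def GreenIdentity (u : H1 Ω) (f : L2 Ω) (h : L2Bdry Ω) : Prop :=
  ∀ v : H1 Ω, inner ℂ (toL2 v) f + ∑ i, inner ℂ (grad v i) (grad u i) = inner ℂ (tr v) h

theorem formRel_iff_greenIdentity (β : LInfBdry Ω) (u f : H1 Ω) :
    formRel (traceEmbedding tr) (robinPerturbation β) u f ↔
      GreenIdentity tr u (toL2 f) (-mulBdry β (tr u) - tr f) := by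
  refine forall_congr' fun v => ?_
  simp only [traceEmbedding_apply, robinPerturbation_apply, WithLp.prod_inner_apply, inner_H1,
    inner_neg_right, inner_sub_right]
  constructor <;> intro h <;> linear_combination h

variable {tr}

theorem greenIdentity_of_contRep (hΩ : IsOpen Ω) (hb : Bornology.IsBounded Ω)
    (hL : HasLipschitzBoundary Ω) {u : H1 Ω} {f : L2 Ω} {h : L2Bdry Ω}
    (hgreen : ∀ (v : H1 Ω) (w : E d → ℂ), IsContRep v w →
      inner ℂ (toL2 v) f + ∑ i, inner ℂ (grad v i) (grad u i) = inner ℂ (tr v) h) :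
    GreenIdentity tr u f h := by
  intro v
  obtain ⟨a, w, haw, hlim⟩ := exists_tendsto_contRep hΩ hb hL v
  have hclosed : IsClosed {v : H1 Ω |
      inner ℂ (toL2 v) f + ∑ i, inner ℂ (grad v i) (grad u i) = inner ℂ (tr v) h} :=
    isClosed_eq ((continuous_toL2.inner continuous_const).add
        (continuous_finsetSum _ fun i _ => (continuous_grad i).inner continuous_const))
      (tr.continuous.inner continuous_const)
  exact hclosed.mem_of_tendsto hlim (.of_forall fun n => hgreen (a n) (w n) (haw n))

theorem IsTraceOperator.integral_mul_star_contRep (htr : IsTraceOperator tr) {v : H1 Ω}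
    {w : E d → ℂ} (hw : IsContRep v w) (hmem : MemLp w 2 (surfaceMeasure Ω)) (h : L2Bdry Ω) :
    ∫ x, h x * star (w x) ∂(surfaceMeasure Ω) = inner ℂ (tr v) h := by
  rw [← integral_mul_star]
  refine integral_congr_ae ?_
  filter_upwards [htr.coeFn_eq hw hmem] with x hx
  rw [hx]

theorem greenIdentity_iff (hΩ : IsOpen Ω) (hb : Bornology.IsBounded Ω)
    (hL : HasLipschitzBoundary Ω) (htr : IsTraceOperator tr) (u : H1 Ω) (f : L2 Ω)
    (h : L2Bdry Ω) :
    GreenIdentity tr u f h ↔ ∀ (v : H1 Ω) (w : E d → ℂ), IsContRep v w →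
      (∫ x in Ω, f x * star (toL2 v x)) + (∫ x in Ω, ∑ i, grad u i x * star (grad v i x)) =
        ∫ x, h x * star (w x) ∂(surfaceMeasure Ω) := by
  obtain ⟨C, hC⟩ := exists_hasTraceBound hΩ hb hL
  have hinner : GreenIdentity tr u f h ↔ ∀ (v : H1 Ω) (w : E d → ℂ), IsContRep v w →
      inner ℂ (toL2 v) f + ∑ i, inner ℂ (grad v i) (grad u i) = inner ℂ (tr v) h :=
    ⟨fun hgreen v _ _ => hgreen v, greenIdentity_of_contRep hΩ hb hL⟩
  rw [hinner]
  refine forall₃_congr fun v w hw => ?_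
  rw [integral_mul_star, integral_sum_grad, htr.integral_mul_star_contRep hw (hC.memLp hw)]

theorem IsTraceOperator.eq_zero_of_isTestFunction (htr : IsTraceOperator tr) (hΩ : IsOpen Ω)
    {φ : E d → ℝ} (hφ : IsTestFunction Ω φ) {v : H1 Ω}
    (hv : toL2 v =ᵐ[volume.restrict Ω] fun x => (φ x : ℂ)) : tr v = 0 := by
  have hrep : IsContRep v fun x => (φ x : ℂ) :=
    ⟨(Complex.continuous_ofReal.comp hφ.contDiff.continuous).continuousOn, hv⟩
  have hzero : (fun x => (φ x : ℂ)) =ᵐ[surfaceMeasure Ω] 0 := by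
    filter_upwards [ae_surfaceMeasure_mem_frontier] with x hx
    have hxφ : x ∉ tsupport φ := fun hmem =>
      (hΩ.frontier_eq ▸ hx).2 (hφ.tsupport_subset hmem)
    simp [image_eq_zero_of_notMem_tsupport hxφ]
  have hmem : MemLp (fun x => (φ x : ℂ)) 2 (surfaceMeasure Ω) :=
    (memLp_congr_ae hzero).mpr MemLp.zero
  exact (Lp.eq_zero_iff_ae_eq_zero).mpr ((htr.coeFn_eq hrep hmem).trans hzero)

theorem GreenIdentity.isLaplacian (hΩ : IsOpen Ω) (hb : Bornology.IsBounded Ω)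
    (htr : IsTraceOperator tr) {u : H1 Ω} {f : L2 Ω} {h : L2Bdry Ω}
    (hgreen : GreenIdentity tr u f h) : IsLaplacian u f := by
  intro φ hφ
  obtain ⟨v, hv, hgrad⟩ := hφ.exists_H1 hb
  have hinner := hgreen v
  rw [htr.eq_zero_of_isTestFunction hΩ hφ hv, inner_zero_left] at hinner
  simp only [integral_laplacian_smul hφ, integral_smul_eq_inner hv,
    integral_smul_eq_inner (hgrad _)]
  linear_combination -hinner

theorem isWentzellLaplacian_iff_formRel (hΩ : IsOpen Ω) (hb : Bornology.IsBounded Ω)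
    (hL : HasLipschitzBoundary Ω) (htr : IsTraceOperator tr) (β : LInfBdry Ω) (u f : H1 Ω) :
    IsWentzellLaplacian β u f ↔ formRel (traceEmbedding tr) (robinPerturbation β) u f := by
  rw [formRel_iff_greenIdentity]
  constructor
  · rintro ⟨hlap, h, uΓ, fΓ, ⟨f', hlap', hgreen⟩, hu, hf, hbc⟩
    rw [(htr u uΓ).mp hu, (htr f fΓ).mp hf, ← eq_neg_mulBdry_sub_iff] at hbc
    rw [← hbc, hlap.unique hΩ hlap']
    exact (greenIdentity_iff hΩ hb hL htr u f' h).mpr hgreen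
  · intro hgreen
    have hlap := hgreen.isLaplacian hΩ hb htr
    exact ⟨hlap, _, tr u, tr f, ⟨toL2 f, hlap, (greenIdentity_iff hΩ hb hL htr _ _ _).mp hgreen⟩,
      (htr _ _).mpr rfl, (htr _ _).mpr rfl, (eq_neg_mulBdry_sub_iff β _ _ _).mp rfl⟩

theorem exists_isMSectorial_isWentzellLaplacian (hΩ : IsOpen Ω) (hb : Bornology.IsBounded Ω)
    (hL : HasLipschitzBoundary Ω) (htr : IsTraceOperator tr) (β : LInfBdry Ω) :
    ∃ a, IsMSectorial (IsWentzellLaplacian β) 1 a := by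
  have hform : IsWentzellLaplacian β = formRel (traceEmbedding tr) (robinPerturbation β) :=
    funext₂ fun u f => propext (isWentzellLaplacian_iff_formRel hΩ hb hL htr β u f)
  exact ⟨_, hform ▸ isMSectorial_formRel (traceEmbedding_injective tr hΩ) (robinPerturbation β)⟩

end WentzellForm

end Wentzell

end

theorem corollary5p2 (d : ℕ) (hd : 1 ≤ d) (Ω : Set (Wentzell.E d)) (hΩ : IsOpen Ω)
    (hb : Bornology.IsBounded Ω) (hL : Wentzell.HasLipschitzBoundary Ω)
    (β : Wentzell.LInfBdry Ω) :
    (∀ u : Wentzell.H1 Ω, ∃! φ : Wentzell.L2Bdry Ω, Wentzell.IsTrace u φ) ∧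
      ∃ T : ℝ → Wentzell.H1 Ω →L[ℂ] Wentzell.H1 Ω,
        Wentzell.IsHolomorphicC0Semigroup T ∧
          Wentzell.IsGeneratorOf (Wentzell.IsWentzellLaplacian β) T := by
  obtain ⟨tr, htr⟩ := Wentzell.exists_isTraceOperator hΩ hb hL
  obtain ⟨a, hsector⟩ := Wentzell.exists_isMSectorial_isWentzellLaplacian hΩ hb hL htr β
  exact ⟨htr.existsUnique_isTrace, hsector.exists_isHolomorphicC0Semigroup one_pos⟩
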